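/- **Setting.** For every security parameter $\lambda$ let $e:\mathbb G_1\times\mathbb G_2\to\mathbb G_T$ be a non-degenerate bilinear pairing of groups of prime order $p=p(\lambda)$, whose elements are represented by $\mathrm{poly}(\lambda)$ bits, with $1/p$ negligible, and let $d=d(\lambda)$, $K=K(\lambda)$ be polynomially bounded. "Polynomial-time" means non-uniform probabilistic polynomial time (families of programs of polynomial length with random coins, whose unit steps are the field operations, group operations, the pairing, zero tests and access to the bits of representations), and "negligible" means smaller than every inverse polynomial in $\lambda$. **The scheme rKZGb.** *Setup* chooses uniformly generators $g\in\mathbb G_1$, $h\in\mathbb G_2$ and $\alpha,x\in\mathbb F_p\setminus\{0,1\}$, and publishes $\mathsf{srs}=\big((g^{x^i})_{-d\le i\le d},\,(g^{\alpha x^i})_{-d\le i\le d,\,i\ne0},\,h,h^{\alpha},h^{\alpha x}\big)$. The *commitment* to a Laurent polynomial $f=\sum_{0<|i|\le d}a_iX^i$ over $\mathbb F_p$ (zero constant term) is $\prod_{i\neq 0}(g^{\alpha x^i})^{a_i}=g^{\alpha f(x)}$. Polynomials $f_1,\dots,f_K$ are opened together at subsets $S_1,\dots,S_K$ of a finite set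 $S\subset\mathbb F_p\setminus\{0\}$. Let $Z_A(X)=\prod_{z\in A}(X-z)$, let $\gamma_i$ be the interpolation polynomial of $f_i$ on $S_i$, and $\Psi_i(\mu)=\beta^{i-1}Z_{S\setminus S_i}(\mu)$. On a uniform challenge $\beta\in\mathbb F_p$ the prover sends $\pi_1=g^{q(x)}$ with $q=\frac1{Z_S}\sum_i\beta^{i-1}Z_{S\setminus S_i}(f_i-\gamma_i)$; on a uniform challenge $\mu\in\mathbb F_p$ it sends $\pi_2=g^{w(x)}$ with $w=\frac1{X-\mu}\big(\sum_i\Psi_i(\mu)(f_i-\gamma_i(\mu))-Z_S(\mu)\,q\big)$; both are computed from $\mathsf{srs}$. The verifier, given commitments $F_i$ and polynomials $\gamma_i$, makes the single pairing check $$e\big(\pi_2,h^{\alpha x}\big)=e\Big(\prod_iF_i^{\Psi_i(\mu)},\,h\Big)\cdot e\Big(\pi_2^{\mu}\,\pi_1^{-Z_S(\mu)}\prod_ig^{-\gamma_i(\mu)\Psi_i(\mu)},\,h^{\alpha}\Big).$$ **Theorem.** The scheme rKZGb has the following properties. 1. *Correctness.* For all setups, all $f_i$, $S$, $S_i$ as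 above and all challenges $\beta,\mu\in\mathbb F_p$, the honest proof $(\pi_1,\pi_2)$ passes the check, and $\gamma_i(z)=f_i(z)$ for all $z\in S_i$. 2. *Knowledge soundness in the algebraic group model.* Assume $q$-DLOG: every polynomial-time algorithm that is given $\mathsf{srs}$ outputs $x$ with negligible probability only. Then for every polynomial-time algebraic adversary $\mathcal A$ (one that outputs, with every element of $\mathbb G_1$, its exponents as a product of powers of the $\mathbb G_1$-elements of $\mathsf{srs}$) there is a polynomial-time extractor $\mathcal E_{\mathcal A}$ such that $\mathcal A$ wins the following game with negligible probability: $\mathcal A(\mathsf{srs})$ outputs $F_1,\dots,F_K$; $\mathcal E_{\mathcal A}$, from the internal state of $\mathcal A$, outputs Laurent polynomials $f_i=\sum_{0<|t|\le d}a_{i,t}X^t$; $\mathcal A$ outputs a set $S\subset\mathbb F_p\setminus\{0\}$, subsets $S_i\subseteq S$ and polynomials $\gamma_i$; it receives $\beta$, outputs $\pi_1$, receives $\mu$, outputs $\pi_2$. It wins if the check passes but for some $j$ either $F_j$ is not the commitment to $f_j$, or $f_j(z)\ne\gamma_j(z)$ for some $z\in S_j$. Moreover, this holds for the extractor that takes as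 $a_{i,t}$ the exponent of $g^{\alpha x^t}$ in $\mathcal A$'s representation of $F_i$. 3. *Computational hiding.* Assume that every polynomial-time algorithm that is given $g$ and $g^a$, for a uniform generator $g$ of $\mathbb G_1$ and uniform $a\in\mathbb F_p$, outputs $a$ with negligible probability only. Then every polynomial-time adversary wins the following game with negligible probability: $f_1,\dots,f_K$ are chosen independently and uniformly among the Laurent polynomials $\sum_{0<|i|\le d}a_iX^i$; the adversary receives $\mathsf{srs}$ and the commitments, chooses $S\subset\mathbb F_p\setminus\{0\}$ and subsets $S_i\subseteq S$ (possibly empty), receives the values of $f_i$ on $S_i$, chooses $\beta$, receives the honest $\pi_1$, chooses $\mu$, receives the honest $\pi_2$, and outputs for each $j$ a point $z_j$ and a value $v_j$. It wins if for some $j$ with $|S_j|<d$ it has $z_j\ne0$, $z_j\notin S_j$ and $f_j(z_j)=v_j$. -/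

import Mathlib

open scoped LaurentPolynomial
open Filter

noncomputable section

namespace RKZGb

/-! ### Bilinear groups -/

/-- A description of a bilinear group: two cyclic groups `G₁`, `G₂` and a target group `G_T`, all of
prime order `p`, and a non-degenerate bilinear pairing `e`.  The groups are written additively, as
vector spaces over `ZMod p`: the power `g ^ a` with `a` in the field of `p` elements is `a • g`, and a
product of group elements is a sum.  The maps `enc` represent the group elements injectively by
bit strings of length `len`. -/
structure BilinearGroup where
  p : ℕ
  prime : Fact p.Prime
  G₁ : Type
  G₂ : Type
  G_T : Type
  acg₁ : AddCommGroup G₁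
  acg₂ : AddCommGroup G₂
  acgT : AddCommGroup G_T
  mod₁ : Module (ZMod p) G₁
  mod₂ : Module (ZMod p) G₂
  modT : Module (ZMod p) G_T
  card₁ : Nat.card G₁ = p
  card₂ : Nat.card G₂ = p
  cardT : Nat.card G_T = p
  e : G₁ →ₗ[ZMod p] G₂ →ₗ[ZMod p] G_T
  e_ne_zero : e ≠ 0
  len : ℕ
  enc₁ : G₁ → Fin len → Bool
  enc₂ : G₂ → Fin len → Bool
  encT : G_T → Fin len → Bool
  enc₁_inj : Function.Injective enc₁
  enc₂_inj : Function.Injective enc₂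
  encT_inj : Function.Injective encT

attribute [instance] BilinearGroup.prime BilinearGroup.acg₁ BilinearGroup.acg₂ BilinearGroup.acgT
  BilinearGroup.mod₁ BilinearGroup.mod₂ BilinearGroup.modT

/-- The scalar field, i.e. the integers modulo `p`. -/
abbrev BilinearGroup.F (B : BilinearGroup) : Type := ZMod B.p

/-! ### Laurent polynomials -/

/-- The exponents `-d, …, d`. -/
def exps (d : ℕ) : Finset ℤ := Finset.Icc (-(d : ℤ)) d

/-- The non-zero exponents among `-d, …, d`. -/
def nzExps (d : ℕ) : Finset ℤ := (exps d).erase 0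

/-- The value of a Laurent polynomial at `z`; only meaningful, and only used, for `z ≠ 0`. -/
def lev {F : Type} [Field F] (f : F[T;T⁻¹]) (z : F) : F := f.coeff.sum fun i a => a * z ^ i

open Classical in
/-- The quotient of two Laurent polynomials: the `q` with `f = g * q` if `g` divides `f` (it is
unique for `g ≠ 0`), and `0` otherwise. -/
def lquot {F : Type} [Field F] (f g : F[T;T⁻¹]) : F[T;T⁻¹] :=
  if h : g ∣ f then h.choose else 0

/-- The vanishing polynomial of a finite set. -/
def vanish {F : Type} [Field F] (S : Finset F) : Polynomial F :=
  ∏ z ∈ S, (Polynomial.X - Polynomial.C z)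

/-! ### The scheme -/

/-- A structured reference string. The entries of `gx` and `gax` are read at exponents in `exps d`
and `nzExps d` only. -/
structure Srs (B : BilinearGroup) where
  gx : ℤ → B.G₁
  gax : ℤ → B.G₁
  h : B.G₂
  ha : B.G₂
  hax : B.G₂

/-- The random choices of the setup: generators `g`, `h` and scalars `α`, `x` different from
`0` and `1`. -/
abbrev Secrets (B : BilinearGroup) : Type :=
  {g : B.G₁ // g ≠ 0} × {h : B.G₂ // h ≠ 0} × {α : B.F // α ≠ 0 ∧ α ≠ 1} × {x : B.F // x ≠ 0 ∧ x ≠ 1}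

/-- Setup: `g^(x^i)` for `|i| ≤ d`, `g^(α x^i)` for `0 < |i| ≤ d`, and `h, h^α, h^(α x)`. -/
def setup (B : BilinearGroup) (d : ℕ) (s : Secrets B) : Srs B where
  gx i := if i ∈ exps d then ((s.2.2.2 : B.F) ^ i) • (s.1 : B.G₁) else 0
  gax i := if i ∈ nzExps d then ((s.2.2.1 : B.F) * (s.2.2.2 : B.F) ^ i) • (s.1 : B.G₁) else 0
  h := s.2.1
  ha := (s.2.2.1 : B.F) • (s.2.1 : B.G₂)
  hax := ((s.2.2.1 : B.F) * (s.2.2.2 : B.F)) • (s.2.1 : B.G₂)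

/-- Commitment to a Laurent polynomial with zero constant term, from the reference string. -/
def commit {B : BilinearGroup} (d : ℕ) (srs : Srs B) (f : B.F[T;T⁻¹]) : B.G₁ :=
  ∑ i ∈ nzExps d, f.coeff i • srs.gax i

/-- The proof element `g^(q[x])`, from the reference string. -/
def expo {B : BilinearGroup} (d : ℕ) (srs : Srs B) (q : B.F[T;T⁻¹]) : B.G₁ :=
  ∑ i ∈ exps d, q.coeff i • srs.gx i

section Scheme

variable {B : BilinearGroup} {K : ℕ}

/-- The polynomial `γ` of an opening on `S`: Lagrange interpolation of the values of `f` on `S`. -/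
def interp (f : B.F[T;T⁻¹]) (S : Finset B.F) : Polynomial B.F :=
  Lagrange.interpolate S id fun z => lev f z

/-- `f̂ = ∑ β^(i-1) Z_{S \ Sᵢ} (fᵢ - γᵢ)` (the index `i` is counted from `0` here). -/
def fhat (S : Finset B.F) (Si : Fin K → Finset B.F) (f : Fin K → B.F[T;T⁻¹])
    (γ : Fin K → Polynomial B.F) (β : B.F) : B.F[T;T⁻¹] :=
  ∑ i : Fin K, LaurentPolynomial.C (β ^ (i : ℕ)) * Polynomial.toLaurent (vanish (S \ Si i)) *
    (f i - Polynomial.toLaurent (γ i))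

/-- `p = f̂ / Z_S`. -/
def pPoly (S : Finset B.F) (Si : Fin K → Finset B.F) (f : Fin K → B.F[T;T⁻¹])
    (γ : Fin K → Polynomial B.F) (β : B.F) : B.F[T;T⁻¹] :=
  lquot (fhat S Si f γ β) (Polynomial.toLaurent (vanish S))

/-- `Ψᵢ[μ] = β^(i-1) Z_{S \ Sᵢ}[μ]`. -/
def Psi (S : Finset B.F) (Si : Fin K → Finset B.F) (β μ : B.F) (i : Fin K) : B.F :=
  β ^ (i : ℕ) * (vanish (S \ Si i)).eval μ

/-- `w_μ = ℓ_μ / (X - μ)`, where `ℓ_μ = ∑ Ψᵢ[μ] (fᵢ - γᵢ[μ]) - Z_S[μ] p`. -/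
def wPoly (S : Finset B.F) (Si : Fin K → Finset B.F) (f : Fin K → B.F[T;T⁻¹])
    (γ : Fin K → Polynomial B.F) (β μ : B.F) : B.F[T;T⁻¹] :=
  lquot
    (∑ i, LaurentPolynomial.C (Psi S Si β μ i) * (f i - LaurentPolynomial.C ((γ i).eval μ))
      - LaurentPolynomial.C ((vanish S).eval μ) * pPoly S Si f γ β)
    (LaurentPolynomial.T 1 - LaurentPolynomial.C μ)

/-- First proof element of the honest prover, computed on the challenge `β`. -/
def open₁ (d : ℕ) (srs : Srs B) (S : Finset B.F) (Si : Fin K → Finset B.F)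
    (f : Fin K → B.F[T;T⁻¹]) (β : B.F) : B.G₁ :=
  expo d srs (pPoly S Si f (fun i => interp (f i) (Si i)) β)

/-- Second proof element of the honest prover, computed on the challenges `β` and `μ`. -/
def open₂ (d : ℕ) (srs : Srs B) (S : Finset B.F) (Si : Fin K → Finset B.F)
    (f : Fin K → B.F[T;T⁻¹]) (β μ : B.F) : B.G₁ :=
  expo d srs (wPoly S Si f (fun i => interp (f i) (Si i)) β μ)

/-- The pairing check of the verifier. -/
def BatchVerify (srs : Srs B) (Fc : Fin K → B.G₁) (S : Finset B.F) (Si : Fin K → Finset B.F)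
    (γ : Fin K → Polynomial B.F) (β μ : B.F) (π₁ π₂ : B.G₁) : Prop :=
  B.e π₂ srs.hax =
    B.e (∑ i, Psi S Si β μ i • Fc i) srs.h +
    B.e (μ • π₂ - (vanish S).eval μ • π₁ - ∑ i, ((γ i).eval μ * Psi S Si β μ i) • srs.gx 0) srs.ha

end Scheme

/-- Correctness: honest commitments and openings of Laurent polynomials with zero constant term are
accepted for all setups and all challenges, and the opened values are those of the polynomials. -/
def Correct (B : BilinearGroup) (d K : ℕ) : Prop :=
  ∀ (s : Secrets B) (f : Fin K → B.F[T;T⁻¹]) (S : Finset B.F) (Si : Fin K → Finset B.F) (β μ : B.F),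
    (∀ i, (f i).coeff.support ⊆ nzExps d) → (0 : B.F) ∉ S → (∀ i, Si i ⊆ S) →
    (∀ i, ∀ z ∈ Si i, (interp (f i) (Si i)).eval z = lev (f i) z) ∧
    BatchVerify (setup B d s) (fun i => commit d (setup B d s) (f i)) S Si
      (fun i => interp (f i) (Si i)) β μ
      (open₁ d (setup B d s) S Si f β) (open₂ d (setup B d s) S Si f β μ)

/-! ### Polynomial-time algorithms

Algorithms are families, indexed by the security parameter, of straight-line programs of polynomial
length with random coins. A memory cell holds a scalar or a group element. The instructions are
the operations of the field and of the groups, the pairing, the test for zero, and access to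
the bits of the representation of a scalar or of a group element (so that algorithms are not
restricted to generic ones). This is non-uniform probabilistic polynomial time. -/

/-- The content of a memory cell. -/
inductive Val (B : BilinearGroup) : Type where
  | scalar (a : B.F)
  | left (u : B.G₁)
  | right (u : B.G₂)
  | target (u : B.G_T)

/-- A memory: a growing list of cells. -/
abbrev Mem (B : BilinearGroup) : Type := List (Val B)

/-- The instructions; arguments `i`, `j` are addresses of cells. -/
inductive Instr (B : BilinearGroup) : Type where
  | const (v : Val B)
  | add (i j : ℕ)
  | mul (i j : ℕ)
  | inv (i : ℕ)
  | isZero (i : ℕ)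
  | bit (k i : ℕ)

section Machine

variable {B : BilinearGroup}

/-- The content of cell `i` (the scalar `0` beyond the end of the memory). -/
def Mem.cell (m : Mem B) (i : ℕ) : Val B := m.getD i (.scalar 0)

/-- The scalar in a cell, `0` if the cell holds a group element. -/
def Val.toScalar : Val B → B.F
  | .scalar a => a
  | _ => 0

/-- The scalar in cell `i`. -/
def Mem.fld (m : Mem B) (i : ℕ) : B.F := (m.cell i).toScalar

/-- The element of `G₁` in a cell, `0` if the cell holds something else. -/
def Val.toLeft : Val B → B.G₁
  | .left u => u
  | _ => 0

/-- Addition within the field or within one of the groups. -/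
def Val.add : Val B → Val B → Val B
  | .scalar a, .scalar b => .scalar (a + b)
  | .left u, .left v => .left (u + v)
  | .right u, .right v => .right (u + v)
  | .target u, .target v => .target (u + v)
  | _, _ => .scalar 0

/-- Multiplication in the field, multiplication of a group element by a scalar, or the pairing. -/
def Val.mul : Val B → Val B → Val B
  | .scalar a, .scalar b => .scalar (a * b)
  | .scalar a, .left u => .left (a • u)
  | .scalar a, .right u => .right (a • u)
  | .scalar a, .target u => .target (a • u)
  | .left u, .right v => .target (B.e u v)
  | _, _ => .scalar 0

open Classical in
/-- The scalar `1` if the value is zero, and `0` otherwise. -/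
def Val.isZero : Val B → Val B
  | .scalar a => .scalar (if a = 0 then 1 else 0)
  | .left u => .scalar (if u = 0 then 1 else 0)
  | .right u => .scalar (if u = 0 then 1 else 0)
  | .target u => .scalar (if u = 0 then 1 else 0)

/-- Bit `k` of a string of bits. -/
def bitOf {n : ℕ} (k : ℕ) (s : Fin n → Bool) : Bool := if h : k < n then s ⟨k, h⟩ else false

/-- Bit `k` of the representation of a value, as a scalar `0` or `1`. -/
def Val.bit (k : ℕ) : Val B → Val B
  | .scalar a => .scalar (if (ZMod.val a).testBit k then 1 else 0)
  | .left u => .scalar (if bitOf k (B.enc₁ u) then 1 else 0)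
  | .right u => .scalar (if bitOf k (B.enc₂ u) then 1 else 0)
  | .target u => .scalar (if bitOf k (B.encT u) then 1 else 0)

/-- The value that an instruction computes. -/
def Instr.eval (m : Mem B) : Instr B → Val B
  | .const v => v
  | .add i j => (m.cell i).add (m.cell j)
  | .mul i j => (m.cell i).mul (m.cell j)
  | .inv i => .scalar (m.fld i)⁻¹
  | .isZero i => (m.cell i).isZero
  | .bit k i => (m.cell i).bit k

/-- A straight-line program. Its number of steps is its length. -/
abbrev Prog (B : BilinearGroup) : Type := List (Instr B)

/-- Running a program: each instruction appends its value to the memory. -/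
def run (P : Prog B) (m : Mem B) : Mem B := P.foldl (fun m c => m ++ [c.eval m]) m

/-- Random coins, as memory cells. -/
def coinCells {r : ℕ} (ω : Fin r → B.F) : Mem B := List.ofFn fun k => .scalar (ω k)

/-- The exponents `-d, …, d` in increasing order. -/
def expList (d : ℕ) : List ℤ := (List.range (2 * d + 1)).map fun k => (k : ℤ) - d

/-- The memory cells that hold the reference string. -/
def srsCells (d : ℕ) (srs : Srs B) : Mem B :=
  (expList d).map (fun i => .left (srs.gx i)) ++
  ((expList d).filter (fun i => i ≠ 0)).map (fun i => .left (srs.gax i)) ++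
  [.right srs.h, .right srs.ha, .right srs.hax]

end Machine

/-! ### Probabilities and asymptotics -/

/-- The probability of an event under the uniform distribution on a finite type. -/
def prob (Ω : Type) (P : Ω → Prop) : ℝ := (Nat.card {ω // P ω} : ℝ) / Nat.card Ω

/-- Boundedness by a polynomial. -/
def PolyBounded (f : ℕ → ℕ) : Prop := ∃ q : Polynomial ℕ, ∀ n, f n ≤ q.eval n

/-- Negligible functions: they decay faster than every inverse polynomial. -/
def Negligible (ε : ℕ → ℝ) : Prop :=
  Asymptotics.SuperpolynomialDecay atTop (fun n : ℕ => (n : ℝ)) ε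

/-- A family of bilinear groups, indexed by the security parameter, is admissible if group elements
are represented by polynomially many bits and the group order is superpolynomial. -/
def Admissible (𝒢 : ℕ → BilinearGroup) : Prop :=
  PolyBounded (fun n => (𝒢 n).len) ∧ Negligible (fun n => 1 / ((𝒢 n).p : ℝ))

/-! ### Hardness assumptions -/

/-- An algorithm with random coins that outputs the scalar in cell `out`. -/
structure Solver (B : BilinearGroup) where
  coins : ℕ
  prog : Prog B
  out : ℕ

def Solver.size {B : BilinearGroup} (A : Solver B) : ℕ := A.coins + A.prog.length

/-- The scalar that the algorithm outputs on an input and coins. -/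
def Solver.output {B : BilinearGroup} (A : Solver B) (input : Mem B) (ω : Fin A.coins → B.F) : B.F :=
  (run A.prog (input ++ coinCells ω)).fld A.out

/-- The probability that the algorithm computes the trapdoor `x` from the reference string. -/
def qdlogAdv {B : BilinearGroup} (d : ℕ) (A : Solver B) : ℝ :=
  prob (Secrets B × (Fin A.coins → B.F)) fun ω =>
    A.output (srsCells d (setup B d ω.1)) ω.2 = (ω.1.2.2.2 : B.F)

/-- The `q`-DLOG assumption for the reference string of the scheme. -/
def QDLog (𝒢 : ℕ → BilinearGroup) (d : ℕ → ℕ) : Prop :=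
  ∀ A : ∀ n, Solver (𝒢 n), PolyBounded (fun n => (A n).size) →
    Negligible fun n => qdlogAdv (d n) (A n)

/-- The probability that the algorithm computes `a` from `g` and `g^a`. -/
def dlogAdv {B : BilinearGroup} (A : Solver B) : ℝ :=
  prob (({g : B.G₁ // g ≠ 0} × B.F) × (Fin A.coins → B.F)) fun ω =>
    A.output [.left (ω.1.1 : B.G₁), .left (ω.1.2 • (ω.1.1 : B.G₁))] ω.2 = ω.1.2

/-- The assumption that it is hard to compute `a` from `g` and `g^a` in `G₁`. -/
def DLog (𝒢 : ℕ → BilinearGroup) : Prop :=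
  ∀ A : ∀ n, Solver (𝒢 n), PolyBounded (fun n => (A n).size) → Negligible fun n => dlogAdv (A n)

/-! ### Evaluation points chosen by an adversary -/

section Points

variable {B : BilinearGroup} {K n : ℕ}

/-- The set `S` of the points in the cells `pt`. -/
def readS (m : Mem B) (pt : Fin n → ℕ) : Finset B.F := Finset.univ.image fun k => m.fld (pt k)

/-- The subset `Sᵢ` of `S`: the points whose flag for `i` is not zero. -/
def readSi (m : Mem B) (pt : Fin n → ℕ) (flag : Fin K → Fin n → ℕ) (i : Fin K) : Finset B.F :=
  (Finset.univ.filter fun k => m.fld (flag i k) ≠ 0).image fun k => m.fld (pt k)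

end Points

/-! ### Knowledge soundness in the algebraic group model -/

/-- The addresses of the coefficients of a linear combination of the elements of `G₁` in the
reference string. -/
structure Rep where
  plain : ℤ → ℕ
  shifted : ℤ → ℕ

/-- The linear combination with the coefficients found at these addresses. -/
def Rep.value {B : BilinearGroup} (R : Rep) (d : ℕ) (srs : Srs B) (m : Mem B) : B.G₁ :=
  ∑ i ∈ exps d, m.fld (R.plain i) • srs.gx i + ∑ i ∈ nzExps d, m.fld (R.shifted i) • srs.gax i

/-- An adversary against knowledge soundness, i.e. a malicious prover. It starts on the
reference string and its coins; `prog₀` yields the commitments, `prog₁` the points, their subsets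
and the polynomials `γᵢ` (by their coefficients), `prog₂` runs after the challenge `β` and yields
`π₁`, `prog₃` runs after the challenge `μ` and yields `π₂`. With each group element come the
addresses of the coefficients of its representation. -/
structure Prover (B : BilinearGroup) (K : ℕ) where
  coins : ℕ
  points : ℕ
  terms : ℕ
  prog₀ : Prog B
  com : Fin K → ℕ
  comRep : Fin K → Rep
  prog₁ : Prog B
  pt : Fin points → ℕ
  flag : Fin K → Fin points → ℕ
  gam : Fin K → Fin terms → ℕ
  prog₂ : Prog B
  pi₁ : ℕ
  pi₁Rep : Rep
  prog₃ : Prog B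
  pi₂ : ℕ
  pi₂Rep : Rep

/-- An extractor: a program that runs on the internal state of the prover after it has sent the
commitments, and the addresses of the coefficients of the extracted polynomials. -/
structure Extractor (B : BilinearGroup) (K : ℕ) where
  prog : Prog B
  coef : Fin K → ℤ → ℕ

namespace Prover

variable {B : BilinearGroup} {K : ℕ} (A : Prover B K)

def size : ℕ := A.coins + A.points + A.terms + A.prog₀.length + A.prog₁.length + A.prog₂.length +
  A.prog₃.length

/-- The internal state after the commitments. -/
def mem₀ (srs : Srs B) (d : ℕ) (ω : Fin A.coins → B.F) : Mem B :=
  run A.prog₀ (srsCells d srs ++ coinCells ω)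

/-- The internal state after the choice of points and polynomials. -/
def mem₁ (srs : Srs B) (d : ℕ) (ω : Fin A.coins → B.F) : Mem B := run A.prog₁ (A.mem₀ srs d ω)

/-- The internal state after the first proof element. -/
def mem₂ (srs : Srs B) (d : ℕ) (ω : Fin A.coins → B.F) (β : B.F) : Mem B :=
  run A.prog₂ (A.mem₁ srs d ω ++ [.scalar β])

/-- The internal state after the second proof element. -/
def mem₃ (srs : Srs B) (d : ℕ) (ω : Fin A.coins → B.F) (β μ : B.F) : Mem B :=
  run A.prog₃ (A.mem₂ srs d ω β ++ [.scalar μ])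

/-- The prover is algebraic: each group element that it outputs is the linear combination of
the reference string given by the coefficients that it outputs with it. -/
def Algebraic (d : ℕ) : Prop :=
  ∀ (s : Secrets B) (ω : Fin A.coins → B.F) (β μ : B.F), let srs := setup B d s
    (∀ i, (A.mem₀ srs d ω).cell (A.com i) = .left ((A.comRep i).value d srs (A.mem₀ srs d ω))) ∧
    (A.mem₂ srs d ω β).cell A.pi₁ = .left (A.pi₁Rep.value d srs (A.mem₂ srs d ω β)) ∧
    (A.mem₃ srs d ω β μ).cell A.pi₂ = .left (A.pi₂Rep.value d srs (A.mem₃ srs d ω β μ))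

/-- The extractor that does no computation and reads off, as the coefficients of the polynomials, those
of the elements `g^(α x^i)` in the representations of the commitments. -/
def readOff : Extractor B K where
  prog := []
  coef i := (A.comRep i).shifted

/-- The polynomials that the extractor outputs: Laurent polynomials with zero constant term. -/
def extracted (E : Extractor B K) (srs : Srs B) (d : ℕ) (ω : Fin A.coins → B.F) (i : Fin K) :
    B.F[T;T⁻¹] :=
  ∑ t ∈ nzExps d, LaurentPolynomial.C ((run E.prog (A.mem₀ srs d ω)).fld (E.coef i t)) *
    LaurentPolynomial.T t

/-- The prover wins against the extractor: the points are admissible (non-zero) and the proof is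
accepted, but for some `j` the extracted polynomial does not have the sent commitment, or
it takes on `S_j` a value that is not the claimed one. -/
def Wins (E : Extractor B K) (d : ℕ) (s : Secrets B) (ω : Fin A.coins → B.F) (β μ : B.F) : Prop :=
  let srs := setup B d s
  let m₁ := A.mem₁ srs d ω
  let S := readS m₁ A.pt
  let Si := readSi m₁ A.pt A.flag
  let γ : Fin K → Polynomial B.F := fun i =>
    ∑ t : Fin A.terms, Polynomial.C (m₁.fld (A.gam i t)) * Polynomial.X ^ (t : ℕ)
  let Fc : Fin K → B.G₁ := fun i => ((A.mem₀ srs d ω).cell (A.com i)).toLeft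
  let f := A.extracted E srs d ω
  (0 : B.F) ∉ S ∧
  BatchVerify srs Fc S Si γ β μ ((A.mem₂ srs d ω β).cell A.pi₁).toLeft
    ((A.mem₃ srs d ω β μ).cell A.pi₂).toLeft ∧
  ∃ j, commit d srs (f j) ≠ Fc j ∨ ∃ z ∈ Si j, lev (f j) z ≠ (γ j).eval z

end Prover

/-- The probability that the prover wins, over setup, coins and challenges. -/
def soundAdv {B : BilinearGroup} {K : ℕ} (d : ℕ) (A : Prover B K) (E : Extractor B K) : ℝ :=
  prob (Secrets B × (Fin A.coins → B.F) × B.F × B.F) fun ω =>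
    A.Wins E d ω.1 ω.2.1 ω.2.2.1 ω.2.2.2

/-- Knowledge soundness: for every polynomial-time algebraic prover there is a polynomial-time
extractor against which the prover wins with negligible probability only. -/
def KnowledgeSound (𝒢 : ℕ → BilinearGroup) (d K : ℕ → ℕ) : Prop :=
  ∀ A : ∀ n, Prover (𝒢 n) (K n), PolyBounded (fun n => (A n).size) →
    (∀ n, (A n).Algebraic (d n)) →
    ∃ E : ∀ n, Extractor (𝒢 n) (K n), PolyBounded (fun n => (E n).prog.length) ∧
      Negligible fun n => soundAdv (d n) (A n) (E n)

/-- Knowledge soundness with the extractor that reads off the representations. -/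
def ReadOffSound (𝒢 : ℕ → BilinearGroup) (d K : ℕ → ℕ) : Prop :=
  ∀ A : ∀ n, Prover (𝒢 n) (K n), PolyBounded (fun n => (A n).size) →
    (∀ n, (A n).Algebraic (d n)) → Negligible fun n => soundAdv (d n) (A n) (A n).readOff

/-! ### Computational hiding -/

/-- An adversary against hiding, i.e. a malicious verifier. It starts on the reference string,
the commitments and its coins; `prog₀` yields the points and subsets where it wants the polynomials
opened. It receives the values there; `prog₁` yields the challenge `β`. It receives `π₁`; `prog₂`
yields the challenge `μ`. It receives `π₂`; `prog₃` yields, for each `j`, a point and a guess for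
the value of the `j`-th polynomial there. -/
structure Spy (B : BilinearGroup) (K : ℕ) where
  coins : ℕ
  points : ℕ
  prog₀ : Prog B
  pt : Fin points → ℕ
  flag : Fin K → Fin points → ℕ
  prog₁ : Prog B
  beta : ℕ
  prog₂ : Prog B
  mu : ℕ
  prog₃ : Prog B
  loc : Fin K → ℕ
  guess : Fin K → ℕ

namespace Spy

variable {B : BilinearGroup} {K : ℕ} (A : Spy B K)

def size : ℕ := A.coins + A.points + A.prog₀.length + A.prog₁.length + A.prog₂.length +
  A.prog₃.length

/-- The values revealed on the chosen subsets, as memory cells (`0` where nothing is asked for). -/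
def valueCells (m : Mem B) (f : Fin K → B.F[T;T⁻¹]) : Mem B :=
  (List.ofFn fun i : Fin K => List.ofFn fun k : Fin A.points =>
    (Val.scalar (if m.fld (A.pt k) ∈ readSi m A.pt A.flag i then lev (f i) (m.fld (A.pt k)) else 0) :
      Val B)).flatten

/-- The adversary wins: the points are admissible (non-zero), and for some `j` of which fewer than `d`
values have been revealed, it outputs a new non-zero point and the value there. -/
def Wins (d : ℕ) (s : Secrets B) (f : Fin K → B.F[T;T⁻¹]) (ω : Fin A.coins → B.F) : Prop :=
  let srs := setup B d s
  let m₀ := run A.prog₀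
    (srsCells d srs ++ (List.ofFn fun i => Val.left (commit d srs (f i))) ++ coinCells ω)
  let S := readS m₀ A.pt
  let Si := readSi m₀ A.pt A.flag
  let m₁ := run A.prog₁ (m₀ ++ A.valueCells m₀ f)
  let β := m₁.fld A.beta
  let m₂ := run A.prog₂ (m₁ ++ [.left (open₁ d srs S Si f β)])
  let μ := m₂.fld A.mu
  let m₃ := run A.prog₃ (m₂ ++ [.left (open₂ d srs S Si f β μ)])
  (0 : B.F) ∉ S ∧
  ∃ j, (Si j).card < d ∧ m₃.fld (A.loc j) ≠ 0 ∧ m₃.fld (A.loc j) ∉ Si j ∧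
    m₃.fld (A.guess j) = lev (f j) (m₃.fld (A.loc j))

end Spy

/-- The Laurent polynomial with given coefficients at the exponents `0 < |i| ≤ d`. -/
def ofCoeffs {F : Type} [Field F] {d : ℕ} (a : nzExps d → F) : F[T;T⁻¹] :=
  ∑ i : nzExps d, LaurentPolynomial.C (a i) * LaurentPolynomial.T (i : ℤ)

/-- The probability that the adversary wins, over setup, coins, and independent uniformly random
Laurent polynomials with zero constant term. -/
def hidingAdv {B : BilinearGroup} {K : ℕ} (d : ℕ) (A : Spy B K) : ℝ :=
  prob (Secrets B × (Fin K → nzExps d → B.F) × (Fin A.coins → B.F)) fun ω =>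
    A.Wins d ω.1 (fun i => ofCoeffs (ω.2.1 i)) ω.2.2

/-- Computational hiding: no polynomial-time adversary determines, with more than negligible
probability, an unrevealed value of a committed random polynomial. -/
def Hiding (𝒢 : ℕ → BilinearGroup) (d K : ℕ → ℕ) : Prop :=
  ∀ A : ∀ n, Spy (𝒢 n) (K n), PolyBounded (fun n => (A n).size) →
    Negligible fun n => hidingAdv (d n) (A n)

end RKZGb

end

open scoped LaurentPolynomial
open Filter

noncomputable section

namespace RKZGb

/-! ### Values available to a program

The sample space is a type `Ω`; a value held by a memory cell is a function on it. A symbolic memory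
is a list of such functions. -/

section Machine

variable {B : BilinearGroup} {Ω : Type}

/-! Correctness is an identity of Laurent polynomials. Dividing `f - γ` by a vanishing polynomial
does not enlarge the range of exponents (`quo_spec`), so `q` and `w` can be committed to with the
reference string. The pairing check is then `α` times the identity defining `w`, evaluated at `x`.

Knowledge soundness: an algebraic prover reveals every discrete logarithm to the base `g` as a
polynomial in `α` and `x`. The check therefore reads `eq₀(x) + α eq₁(x) + α² eq₂(x) = 0`
(`Prover.verification`), with coefficients computable from the run. By `Prover.wins_cases` a winning
run has one of these forms. Either `eq₀` or `eq₁` is a non-zero polynomial with root `x`; or `α` is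
a root of a non-zero quadratic polynomial; or `eq₀` and `eq₁` vanish identically although the prover
cheated. In the first case the `q`-DLOG trapdoor plays the role of `x` and `α` is chosen by the
solver; in the second it plays the role of `α` and `x` is chosen. The third case is a
Schwartz–Zippel count over `β` and `μ` (`Prover.prob_lucky_le`).

Extracting the root in polynomial time (`Der.root`) uses half-powers `(X + s) ^ ((p - 1) / 2)`
modulo the polynomial, as in Berlekamp–Rabin factoring. The exponents held in the group allow a zero
test at the unknown root. This test selects the right factor, and non-uniformity supplies good
shifts `s`, so that neither gcds nor randomness are needed.

Hiding: write `f_j = base_j + t X Z`, where `Z` vanishes on `S_j`. The revealed values do not depend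
on `t`, whereas a correct value at a new point determines `t`. The unknown logarithm is embedded as
`f_j(x)` if `x ∉ S_j`, and as `t` itself if `x ∈ S_j`. The whole game can be simulated with the
coefficients of the `f_i` known only in the exponent, because all the honest computations are linear
in them.

Throughout, a solver is built by composing statements `Derives S n T` over a sample space that
contains winning runs only, so it need be right only on these. An injection of winning runs, times
some fresh randomness, into the sample space of the hardness game then bounds the advantage
(`prob_le_of_injective`). -/

/-- The value that an instruction computes on a symbolic memory. -/
def evalF (c : Instr B) (l : List (Ω → Val B)) : Ω → Val B := fun ω => c.eval (l.map (· ω))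

/-- Running a program on a symbolic memory. -/
def runF (P : Prog B) (l : List (Ω → Val B)) : List (Ω → Val B) :=
  P.foldl (fun l c => l ++ [evalF c l]) l

@[simp] lemma runF_nil (l : List (Ω → Val B)) : runF [] l = l := rfl

@[simp] lemma runF_cons (c : Instr B) (P : Prog B) (l : List (Ω → Val B)) :
    runF (c :: P) l = runF P (l ++ [evalF c l]) := rfl

lemma runF_append (P Q : Prog B) (l : List (Ω → Val B)) :
    runF (P ++ Q) l = runF Q (runF P l) := by
  simp [runF]

/-- Programs are straight-line, so the same instructions are executed for every `ω`, and running
commutes with evaluating the symbolic memory at `ω`. -/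
lemma run_map (P : Prog B) (l : List (Ω → Val B)) (ω : Ω) :
    run P (l.map (· ω)) = (runF P l).map (· ω) := by
  induction P generalizing l with
  | nil => rfl
  | cons c P ih =>
    have := ih (l ++ [evalF c l])
    simpa [run, evalF] using this

lemma mem_runF {P : Prog B} {l : List (Ω → Val B)} {v : Ω → Val B} (h : v ∈ l) : v ∈ runF P l := by
  induction P generalizing l with
  | nil => exact h
  | cons c P ih => exact ih (by simp [h])

/-- The scalar zero, which is found beyond the end of the memory. -/
def zeroVal : Ω → Val B := fun _ => .scalar 0

lemma cell_map (l : List (Ω → Val B)) (i : ℕ) (ω : Ω) :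
    Mem.cell (l.map (· ω)) i = l.getD i zeroVal ω := by
  unfold Mem.cell
  by_cases h : i < l.length
  · simp [List.getD, h]
  · simp [List.getD, h, zeroVal]

/-- From a memory that holds the values `S`, some program of at most `n` steps computes the values `T`. -/
def Derives (S : Set (Ω → Val B)) (n : ℕ) (T : Set (Ω → Val B)) : Prop :=
  ∀ l : List (Ω → Val B), (∀ v ∈ S, v ∈ l) → ∃ Q : Prog B, Q.length ≤ n ∧ ∀ v ∈ T, v ∈ runF Q l

/-- Computability of a single value. -/
abbrev Der (S : Set (Ω → Val B)) (n : ℕ) (v : Ω → Val B) : Prop := Derives S n {v}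

variable {S S' T T' U : Set (Ω → Val B)} {a b n : ℕ} {u v w : Ω → Val B}

lemma Derives.mono (h : Derives S a T) (hS : S ⊆ S') (hab : a ≤ b) (hT : T' ⊆ T) :
    Derives S' b T' := by
  intro l hl
  obtain ⟨Q, hQ, h⟩ := h l fun v hv => hl v (hS hv)
  exact ⟨Q, hQ.trans hab, fun v hv => h v (hT hv)⟩

lemma Derives.le (h : Derives S a T) (hab : a ≤ b) : Derives S b T := h.mono le_rfl hab le_rfl

lemma Derives.weaken (h : Derives S a T) (hS : S ⊆ S') : Derives S' a T := h.mono hS le_rfl le_rfl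

lemma Derives.sub (h : Derives S a T) (hT : T' ⊆ T) : Derives S a T' := h.mono le_rfl le_rfl hT

lemma Derives.get (h : Derives S a T) (hv : v ∈ T) : Der S a v := h.sub (by simpa using hv)

lemma Derives.refl (h : T ⊆ S) : Derives S 0 T :=
  fun _ hl => ⟨[], le_rfl, fun v hv => hl v (h hv)⟩

lemma Der.of_mem (h : v ∈ S) : Der S 0 v := Derives.refl (by simpa using h)

lemma Derives.trans (h : Derives S a T) (h' : Derives (S ∪ T) b U) : Derives S (a + b) U := by
  intro l hl
  obtain ⟨Q, hQ, h⟩ := h l hl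
  obtain ⟨Q', hQ', h'⟩ := h' (runF Q l) (by
    rintro v (hv | hv)
    · exact mem_runF (hl v hv)
    · exact h v hv)
  refine ⟨Q ++ Q', by simpa using Nat.add_le_add hQ hQ', fun v hv => ?_⟩
  rw [runF_append]
  exact h' v hv

lemma Derives.union (h : Derives S a T) (h' : Derives S b U) : Derives S (a + b) (T ∪ U) := by
  intro l hl
  obtain ⟨Q, hQ, h⟩ := h l hl
  obtain ⟨Q', hQ', h'⟩ := h' (runF Q l) fun v hv => mem_runF (hl v hv)
  refine ⟨Q ++ Q', by simpa using Nat.add_le_add hQ hQ', fun v hv => ?_⟩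
  rw [runF_append]
  rcases hv with hv | hv
  · exact mem_runF (h v hv)
  · exact h' v hv

/-- Computing in stages. -/
lemma Derives.next (h : Derives S a T) (h' : Derives T b U) : Derives S (a + b) (T ∪ U) := by
  intro l hl
  obtain ⟨Q, hQ, h⟩ := h l hl
  obtain ⟨Q', hQ', h'⟩ := h' (runF Q l) h
  refine ⟨Q ++ Q', by simpa using Nat.add_le_add hQ hQ', fun v hv => ?_⟩
  rw [runF_append]
  exact hv.elim (fun hv => mem_runF (h v hv)) (h' v)

lemma Derives.keep (h : Derives S a T) : Derives S a (S ∪ T) := by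
  simpa using (Derives.refl (le_refl S)).union h

lemma Derives.biUnion {ι : Type*} (J : Finset ι) (T : ι → Set (Ω → Val B))
    (h : ∀ i ∈ J, Derives S a (T i)) : Derives S (J.card * a) (⋃ i ∈ J, T i) := by
  classical
  induction J using Finset.induction_on with
  | empty => simpa using Derives.refl (S := S) (Set.empty_subset S)
  | insert i J hi ih =>
    have h1 := (h i (by simp)).union (ih fun k hk => h k (by simp [hk]))
    rw [Finset.card_insert_of_notMem hi, Finset.set_biUnion_insert]
    exact h1.le (by ring_nf; omega)

/-- Repeated computation. -/
lemma Derives.iterate (T : ℕ → Set (Ω → Val B)) (k : ℕ)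
    (h : ∀ i < k, Derives (S ∪ T i) a (T (i + 1))) : Derives (S ∪ T 0) (k * a) (T k) := by
  induction k with
  | zero => exact (Derives.refl Set.subset_union_right).le (by simp)
  | succ k ih =>
    have h1 := (ih fun i hi => h i (by omega)).trans
      ((h k (by omega)).weaken (S' := S ∪ T 0 ∪ T k) (by
        rintro v (hv | hv)
        · exact .inl (.inl hv)
        · exact .inr hv))
    exact h1.le (by ring_nf; omega)

lemma Der.const (c : Val B) : Der S 1 (fun _ => c) := by
  intro l _
  refine ⟨[.const c], by simp, ?_⟩
  rintro v rfl
  exact List.mem_append_right _ (by simp [funext_iff, evalF, Instr.eval])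

lemma exists_address {l : List (Ω → Val B)} (h : v ∈ l) :
    ∃ i, ∀ ω, Mem.cell (l.map (· ω)) i = v ω := by
  obtain ⟨i, hi, rfl⟩ := List.getElem_of_mem h
  exact ⟨i, fun ω => by simp [cell_map, List.getD, hi]⟩

/-- The addresses in the last instruction depend on where the operands were placed, hence on the
initial memory. This is why `Derives` chooses the program after the memory. -/
lemma Derives.instr (hQ : ∀ l, (∀ v ∈ T, v ∈ l) → ∃ c, evalF c l = u)
    (h : Derives S a T) : Der S (a + 1) u := by
  intro l hl
  obtain ⟨Q, hQl, h⟩ := h l hl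
  obtain ⟨c, hc⟩ := hQ (runF Q l) h
  refine ⟨Q ++ [c], by simpa using hQl, ?_⟩
  rintro v rfl
  simp [runF_append, hc]

lemma Der.op₁ {f : Val B → Val B} (c : ℕ → Instr B) (hc : ∀ i (m : Mem B), (c i).eval m = f (m.cell i))
    (h : Der S a u) : Der S (a + 1) (fun ω => f (u ω)) := by
  refine Derives.instr (fun l hl => ?_) h
  obtain ⟨i, hi⟩ := exists_address (hl u rfl)
  exact ⟨c i, funext fun ω => by simp [evalF, hc, hi]⟩

lemma Der.op₂ {f : Val B → Val B → Val B} (c : ℕ → ℕ → Instr B)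
    (hc : ∀ i j (m : Mem B), (c i j).eval m = f (m.cell i) (m.cell j))
    (h : Der S a u) (h' : Der S b v) : Der S (a + b + 1) (fun ω => f (u ω) (v ω)) := by
  refine Derives.instr (fun l hl => ?_) (h.union h')
  obtain ⟨i, hi⟩ := exists_address (hl u (by simp))
  obtain ⟨j, hj⟩ := exists_address (hl v (by simp))
  exact ⟨c i j, funext fun ω => by simp [evalF, hc, hi, hj]⟩

lemma Der.vadd (h : Der S a u) (h' : Der S b v) :
    Der S (a + b + 1) (fun ω => (u ω).add (v ω)) := .op₂ .add (fun _ _ _ => rfl) h h'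

lemma Der.vmul (h : Der S a u) (h' : Der S b v) :
    Der S (a + b + 1) (fun ω => (u ω).mul (v ω)) := .op₂ .mul (fun _ _ _ => rfl) h h'

lemma Der.visZero (h : Der S a u) : Der S (a + 1) (fun ω => (u ω).isZero) :=
  .op₁ .isZero (fun _ _ => rfl) h

lemma Der.vinv (h : Der S a u) : Der S (a + 1) (fun ω => .scalar (u ω).toScalar⁻¹) :=
  .op₁ (f := fun w => .scalar w.toScalar⁻¹) .inv (fun _ _ => rfl) h

lemma Der.bit (k : ℕ) (h : Der S a u) : Der S (a + 1) (fun ω => (u ω).bit k) :=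
  .op₁ (.bit k) (fun _ _ => rfl) h

/-- A program can be run on any memory whose cells are available. -/
lemma Derives.simulate (P : Prog B) {l : List (Ω → Val B)} (hl : ∀ v ∈ l, v ∈ S)
    (h0 : zeroVal ∈ S) : Derives S P.length {v | v ∈ runF P l} := by
  induction P generalizing l S with
  | nil => exact Derives.refl fun v hv => hl v hv
  | cons c P ih =>
    -- An address beyond the end reads the scalar `0`, which is why `zeroVal` has to be available.
    have hcell : ∀ i, Der S 0 (fun ω => Mem.cell (l.map (· ω)) i) := by
      intro i
      have : (fun ω => Mem.cell (l.map (· ω)) i) = l.getD i zeroVal := funext fun ω => cell_map l i ω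
      rw [this]
      refine Der.of_mem ?_
      by_cases h : i < l.length
      · simpa [List.getD, h] using hl _ (List.getElem_mem h)
      · simpa [List.getD, h] using h0
    have h1 : Der S 1 (evalF c l) := by
      cases c with
      | const v => exact Der.const v
      | add i j => exact (hcell i).vadd (hcell j)
      | mul i j => exact (hcell i).vmul (hcell j)
      | inv i => exact (hcell i).vinv
      | isZero i => exact (hcell i).visZero
      | bit k i => exact (hcell i).bit k
    have h2 := ih (S := S ∪ {evalF c l}) (l := l ++ [evalF c l]) (by
      intro v hv
      rcases List.mem_append.1 hv with hv | hv
      · exact .inl (hl v hv)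
      · exact .inr (by simpa using hv)) (.inl h0)
    exact (h1.trans h2).le (by simp; omega)

/-! #### Scalars and group elements -/

/-- A scalar. -/
def sc (u : Ω → B.F) : Ω → Val B := fun ω => .scalar (u ω)

/-- An element of `G₁`. -/
def lf (u : Ω → B.G₁) : Ω → Val B := fun ω => .left (u ω)

/-- An element of `G₂`. -/
def rt (u : Ω → B.G₂) : Ω → Val B := fun ω => .right (u ω)

/-- The truth value of a proposition as a scalar. -/
def ind {F : Type} [Zero F] [One F] (P : Prop) : F := by classical exact if P then 1 else 0

@[simp] lemma ind_true {F : Type} [Zero F] [One F] {P : Prop} (h : P) : (ind P : F) = 1 := if_pos h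

@[simp] lemma ind_false {F : Type} [Zero F] [One F] {P : Prop} (h : ¬P) : (ind P : F) = 0 := if_neg h

variable {f g : Ω → B.F} {x y : Ω → B.G₁} {x' y' : Ω → B.G₂} {p q : Ω → Prop}

lemma Der.congr (h : Der S a u) (huv : ∀ ω, u ω = v ω) : Der S a v := by
  rwa [show v = u from funext fun ω => (huv ω).symm]

lemma Der.sconst (c : B.F) : Der S 1 (sc fun _ => c) := Der.const _

lemma Der.add (h : Der S a (sc f)) (h' : Der S b (sc g)) :
    Der S (a + b + 1) (sc fun ω => f ω + g ω) := h.vadd h'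

lemma Der.mul (h : Der S a (sc f)) (h' : Der S b (sc g)) :
    Der S (a + b + 1) (sc fun ω => f ω * g ω) := h.vmul h'

lemma Der.inv (h : Der S a (sc f)) : Der S (a + 1) (sc fun ω => (f ω)⁻¹) := h.vinv

lemma Der.neg (h : Der S a (sc f)) : Der S (a + 2) (sc fun ω => -f ω) :=
  (((Der.sconst (-1)).mul h).congr fun ω => by simp [sc]).le (by omega)

lemma Der.sub' (h : Der S a (sc f)) (h' : Der S b (sc g)) :
    Der S (a + b + 3) (sc fun ω => f ω - g ω) :=
  ((h.add h'.neg).congr fun ω => by simp [sc, sub_eq_add_neg]).le (by omega)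

/-- Inversion always writes a scalar, and `0⁻¹ = 0`. Inverting twice thus keeps a scalar and turns a
group element into `0`. -/
lemma Der.toScalar (h : Der S a u) : Der S (a + 2) (sc fun ω => (u ω).toScalar) :=
  h.vinv.vinv.congr fun ω => by simp [sc, Val.toScalar]

lemma Der.addL (h : Der S a (lf x)) (h' : Der S b (lf y)) :
    Der S (a + b + 1) (lf fun ω => x ω + y ω) := h.vadd h'

lemma Der.addR (h : Der S a (rt x')) (h' : Der S b (rt y')) :
    Der S (a + b + 1) (rt fun ω => x' ω + y' ω) := h.vadd h'

lemma Der.smulL (h : Der S a (sc f)) (h' : Der S b (lf y)) :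
    Der S (a + b + 1) (lf fun ω => f ω • y ω) := h.vmul h'

lemma Der.smulR (h : Der S a (sc f)) (h' : Der S b (rt y')) :
    Der S (a + b + 1) (rt fun ω => f ω • y' ω) := h.vmul h'

lemma Der.eqZero (h : Der S a (sc f)) : Der S (a + 1) (sc fun ω => ind (f ω = 0)) :=
  h.visZero.congr fun ω => by simp only [sc, Val.isZero, ind]; congr

lemma Der.eqZeroL (h : Der S a (lf x)) : Der S (a + 1) (sc fun ω => ind (x ω = 0)) :=
  h.visZero.congr fun ω => by simp only [sc, lf, Val.isZero, ind]

lemma Der.eqZeroR (h : Der S a (rt x')) : Der S (a + 1) (sc fun ω => ind (x' ω = 0)) :=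
  h.visZero.congr fun ω => by simp only [sc, rt, Val.isZero, ind]

lemma Der.not (h : Der S a (sc fun ω => ind (p ω))) :
    Der S (a + 1) (sc fun ω => ind (¬p ω)) :=
  h.eqZero.congr fun ω => by by_cases hp : p ω <;> simp [sc, hp]

lemma Der.and (h : Der S a (sc fun ω => ind (p ω))) (h' : Der S b (sc fun ω => ind (q ω))) :
    Der S (a + b + 1) (sc fun ω => ind (p ω ∧ q ω)) :=
  (h.mul h').congr fun ω => by by_cases hp : p ω <;> by_cases hq : q ω <;> simp [sc, hp, hq]

lemma Der.eq (h : Der S a (sc f)) (h' : Der S b (sc g)) :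
    Der S (a + b + 4) (sc fun ω => ind (f ω = g ω)) :=
  ((h.sub' h').eqZero.congr fun ω => by simp only [sub_eq_zero]).le (by omega)

-- There are no jumps: both alternatives are computed and then combined with the indicator as a
-- weight.
open Classical in
lemma Der.ite (hp : Der S n (sc fun ω => ind (p ω))) (h : Der S a (sc f)) (h' : Der S b (sc g)) :
    Der S (2 * n + a + b + 4) (sc fun ω => if p ω then f ω else g ω) :=
  (((hp.mul h).add (hp.not.mul h')).congr fun ω => by
    by_cases hp : p ω <;> simp [sc, hp]).le (by omega)

lemma Der.sum {ι : Type*} (J : Finset ι) {f : ι → Ω → B.F} (h : ∀ i ∈ J, Der S a (sc (f i))) :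
    Der S (J.card * (a + 1) + 1) (sc fun ω => ∑ i ∈ J, f i ω) := by
  classical
  induction J using Finset.induction_on with
  | empty => simpa using Der.sconst (S := S) (0 : B.F)
  | insert i J hi ih =>
    have := ((h i (by simp)).add (ih fun k hk => h k (by simp [hk])))
    simp only [Finset.sum_insert hi, Finset.card_insert_of_notMem hi]
    exact this.le (by ring_nf; omega)

lemma Der.sumL {ι : Type*} (J : Finset ι) {f : ι → Ω → B.G₁} (h : ∀ i ∈ J, Der S a (lf (f i))) :
    Der S (J.card * (a + 1) + 1) (lf fun ω => ∑ i ∈ J, f i ω) := by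
  classical
  induction J using Finset.induction_on with
  | empty => exact ((Der.const (S := S) (Val.left (B := B) 0)).congr fun ω => by simp [lf]).le (by simp)
  | insert i J hi ih =>
    have := ((h i (by simp)).addL (ih fun k hk => h k (by simp [hk])))
    simp only [Finset.sum_insert hi, Finset.card_insert_of_notMem hi]
    exact this.le (by ring_nf; omega)

lemma Der.prod {ι : Type*} (J : Finset ι) {f : ι → Ω → B.F} (h : ∀ i ∈ J, Der S a (sc (f i))) :
    Der S (J.card * (a + 1) + 1) (sc fun ω => ∏ i ∈ J, f i ω) := by
  classical
  induction J using Finset.induction_on with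
  | empty => simpa using Der.sconst (S := S) (1 : B.F)
  | insert i J hi ih =>
    have := ((h i (by simp)).mul (ih fun k hk => h k (by simp [hk])))
    simp only [Finset.prod_insert hi, Finset.card_insert_of_notMem hi]
    exact this.le (by ring_nf; omega)

lemma Der.forall {ι : Type*} (J : Finset ι) {p : ι → Ω → Prop}
    (h : ∀ i ∈ J, Der S a (sc fun ω => ind (p i ω))) :
    Der S (J.card * (a + 1) + 1) (sc fun ω => ind (∀ i ∈ J, p i ω)) :=
  (Der.prod J h).congr fun ω => by
    by_cases hp : ∀ i ∈ J, p i ω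
    · simp only [sc]
      rw [ind_true hp, Finset.prod_eq_one fun i hi => ind_true (hp i hi)]
    · simp only [sc]
      rw [ind_false hp]
      push Not at hp
      obtain ⟨i, hi, hp⟩ := hp
      rw [Finset.prod_eq_zero hi (ind_false hp)]

lemma Der.exists {ι : Type*} (J : Finset ι) {p : ι → Ω → Prop}
    (h : ∀ i ∈ J, Der S a (sc fun ω => ind (p i ω))) :
    Der S (J.card * (a + 2) + 2) (sc fun ω => ind (∃ i ∈ J, p i ω)) :=
  ((Der.forall J fun i hi => (h i hi).not).not.congr fun ω => by
    congr 2; simp).le (by ring_nf; omega)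

lemma Der.pow (h : Der S a (sc f)) (k : ℕ) : Der S (k * (a + 1) + 1) (sc fun ω => f ω ^ k) := by
  simpa using Der.prod (Finset.range k) (f := fun _ => f) fun _ _ => h

lemma Der.zpow (h : Der S a (sc f)) (k : ℤ) :
    Der S (k.natAbs * (a + 1) + 2) (sc fun ω => f ω ^ k) := by
  rcases Int.natAbs_eq k with hk | hk
  · refine ((h.pow k.natAbs).congr fun ω => ?_).le (by omega)
    simp only [sc]
    conv_rhs => rw [hk]
    rw [zpow_natCast]
  · refine (h.pow k.natAbs).inv.congr fun ω => ?_
    simp only [sc]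
    conv_rhs => rw [hk]
    rw [zpow_neg, zpow_natCast]

/-- A family of scalars. -/
def scs {ι : Type*} (J : Finset ι) (f : ι → Ω → B.F) : Set (Ω → Val B) := (fun i => sc (f i)) '' J

lemma mem_scs {ι : Type*} {J : Finset ι} {f : ι → Ω → B.F} {i : ι} (h : i ∈ J) :
    sc (f i) ∈ scs J f := ⟨i, h, rfl⟩

lemma Derives.family {ι : Type*} (J : Finset ι) {f : ι → Ω → Val B} (h : ∀ i ∈ J, Der S a (f i)) :
    Derives S (J.card * a) (f '' J) :=
  (Derives.biUnion J (fun i => {f i}) h).sub (by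
    rintro _ ⟨i, hi, rfl⟩
    simp only [Set.mem_iUnion]
    exact ⟨i, hi, rfl⟩)

lemma Derives.scs {ι : Type*} (J : Finset ι) {f : ι → Ω → B.F} (h : ∀ i ∈ J, Der S a (sc (f i))) :
    Derives S (J.card * a) (scs J f) := Derives.family J h

end Machine

/-! ### Arithmetic modulo a polynomial that depends on the random choices -/

section Modular

open Polynomial

variable {B : BilinearGroup} {Ω : Type} {S S' : Set (Ω → Val B)} {N : ℕ}

/-- The coefficients of a polynomial up to degree `N`. -/
def cf (N : ℕ) (Q : Ω → B.F[X]) : Set (Ω → Val B) :=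
  scs (Finset.range (N + 1)) fun j ω => (Q ω).coeff j

lemma Der.coeff {Q : Ω → B.F[X]} (hQ : cf N Q ⊆ S) (hdeg : ∀ ω, (Q ω).natDegree ≤ N) (j : ℕ) :
    Der S 1 (sc fun ω => (Q ω).coeff j) := by
  by_cases hj : j ≤ N
  · exact (Der.of_mem (hQ (mem_scs (f := fun j ω => (Q ω).coeff j)
      (Finset.mem_range.2 (by omega))))).le (by omega)
  · exact (Der.sconst 0).congr fun ω => by
      simp [sc, coeff_eq_zero_of_natDegree_lt (lt_of_le_of_lt (hdeg ω) (not_le.1 hj))]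

lemma Derives.coeffs {Q : Ω → B.F[X]} {a : ℕ} (h : ∀ j ≤ N, Der S a (sc fun ω => (Q ω).coeff j)) :
    Derives S ((N + 1) * a) (cf N Q) :=
  (Derives.scs (Finset.range (N + 1)) fun j hj => h j (by simpa [Nat.lt_succ_iff] using hj)).le
    (by simp)

/-- This turns the degree, which varies with the run, into a combination of zero tests on
coefficients. -/
lemma natDegree_eq_iff_coeff {F : Type} [Field F] {Q : F[X]} (hdeg : Q.natDegree ≤ N) (m : ℕ) :
    (Q.coeff m ≠ 0 ∧ ∀ k ∈ Finset.Ioc m N, Q.coeff k = 0) ↔ Q ≠ 0 ∧ Q.natDegree = m := by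
  constructor
  · rintro ⟨h, h'⟩
    refine ⟨fun h0 => h (by simp [h0]), le_antisymm ?_ (le_natDegree_of_ne_zero h)⟩
    rw [natDegree_le_iff_coeff_eq_zero]
    intro k hk
    by_cases hkN : k ≤ N
    · exact h' k (by simp; omega)
    · exact coeff_eq_zero_of_natDegree_lt (by omega)
  · rintro ⟨h, rfl⟩
    refine ⟨by simpa using h, fun k hk => coeff_eq_zero_of_natDegree_lt ?_⟩
    simp at hk
    omega

lemma Der.degree {Q : Ω → B.F[X]} (hQ : cf N Q ⊆ S) (hdeg : ∀ ω, (Q ω).natDegree ≤ N) (m : ℕ) :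
    Der S (3 * N + 6) (sc fun ω => ind (Q ω ≠ 0 ∧ (Q ω).natDegree = m)) := by
  have h := ((Der.coeff hQ hdeg m).eqZero.not).and
    (Der.forall (Finset.Ioc m N) fun k _ => (Der.coeff hQ hdeg k).eqZero)
  refine (h.congr fun ω => ?_).le ?_
  · simp only [sc]
    rw [← natDegree_eq_iff_coeff (hdeg ω) m]
  · have : (Finset.Ioc m N).card ≤ N := by simp
    ring_nf
    omega

/-- The position of the leading coefficient is not known in advance, so it is picked out by a sum
over all positions weighted with degree indicators. -/
lemma Der.leadingCoeff {Q : Ω → B.F[X]} (hQ : cf N Q ⊆ S)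
    (hdeg : ∀ ω, (Q ω).natDegree ≤ N) :
    Der S ((N + 1) * (3 * N + 9) + 1) (sc fun ω => (Q ω).leadingCoeff) := by
  have h := Der.sum (Finset.range (N + 1)) fun m _ =>
    (Der.degree hQ hdeg m).mul (Der.coeff hQ hdeg m)
  refine (h.congr fun ω => ?_).le (by simp)
  simp only [sc]
  congr 1
  by_cases h0 : Q ω = 0
  · simp [h0]
  · rw [Finset.sum_eq_single (Q ω).natDegree]
    · rw [ind_true ⟨h0, rfl⟩, one_mul]; rfl
    · intro m _ hm
      rw [ind_false fun h => hm h.2.symm, zero_mul]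
    · intro h
      exact absurd (Finset.mem_range.2 (Nat.lt_succ_of_le (hdeg ω))) h

variable {P y z : Ω → B.F[X]}

/-- The coefficients of a residue modulo `P`. -/
def mc (N : ℕ) (P y : Ω → B.F[X]) : Set (Ω → Val B) := cf N fun ω => y ω %ₘ P ω

lemma natDegree_modByMonic_le_of_le {F : Type} [Field F] {P : F[X]} (y : F[X]) (hP : P.Monic)
    (hdeg : P.natDegree ≤ N) : (y %ₘ P).natDegree ≤ N :=
  (natDegree_modByMonic_le y hP).trans hdeg

/-- Multiplying a residue by `X` raises its degree to at most that of `P`, so subtracting one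
multiple of `P` completes the reduction. -/
lemma X_mul_modByMonic {F : Type} [Field F] {P : F[X]} (y : F[X]) (hP : P.Monic)
    (h1 : 1 ≤ P.natDegree) :
    (X * y) %ₘ P = X * (y %ₘ P) - C ((y %ₘ P).coeff (P.natDegree - 1)) * P := by
  set R := y %ₘ P with hR
  have hRdeg : R.degree < P.degree := degree_modByMonic_lt y hP
  refine (div_modByMonic_unique (X * (y /ₘ P) + C (R.coeff (P.natDegree - 1))) _ hP ⟨?_, ?_⟩).2
  · have := modByMonic_add_div y P
    rw [← hR] at this
    conv_rhs => rw [← this]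
    ring
  · rw [degree_eq_natDegree hP.ne_zero] at hRdeg ⊢
    rw [degree_lt_iff_coeff_zero] at hRdeg ⊢
    intro m hm
    obtain ⟨m, rfl⟩ : ∃ k, m = k + 1 := ⟨m - 1, by omega⟩
    rw [coeff_sub, coeff_X_mul, coeff_C_mul]
    rcases Nat.eq_or_lt_of_le hm with h | h
    · rw [← h, show P.natDegree - 1 = m by omega]
      simp [hP.coeff_natDegree]
    · rw [hRdeg m (by omega), coeff_eq_zero_of_natDegree_lt h]
      simp

lemma Der.modTop (hP : cf N P ⊆ S) (hM : ∀ ω, (P ω).Monic) (h1 : ∀ ω, 1 ≤ (P ω).natDegree)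
    (hN : ∀ ω, (P ω).natDegree ≤ N) (hy : mc N P y ⊆ S) :
    Der S (N * (3 * N + 9) + 1) (sc fun ω => (y ω %ₘ P ω).coeff ((P ω).natDegree - 1)) := by
  have h := Der.sum (Finset.range N) fun m _ => (Der.degree hP hN (m + 1)).mul
    (Der.coeff hy (fun ω => natDegree_modByMonic_le_of_le _ (hM ω) (hN ω)) m)
  refine (h.congr fun ω => ?_).le (by simp)
  simp only [sc]
  congr 1
  have h1 := h1 ω
  have hN := hN ω
  rw [Finset.sum_eq_single ((P ω).natDegree - 1)]
  · rw [ind_true ⟨(hM ω).ne_zero, by omega⟩, one_mul]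
  · intro m _ hm
    rw [ind_false fun h => hm (by omega), zero_mul]
  · intro h
    exact absurd (Finset.mem_range.2 (by omega)) h

lemma Der.modMulX (hP : cf N P ⊆ S) (hM : ∀ ω, (P ω).Monic) (h1 : ∀ ω, 1 ≤ (P ω).natDegree)
    (hN : ∀ ω, (P ω).natDegree ≤ N) (hy : mc N P y ⊆ S) (j : ℕ) :
    Der S (N * (3 * N + 9) + 7) (sc fun ω => ((X * y ω) %ₘ P ω).coeff j) := by
  have hdeg : ∀ ω, (y ω %ₘ P ω).natDegree ≤ N :=
    fun ω => natDegree_modByMonic_le_of_le _ (hM ω) (hN ω)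
  have h0 : Der S 1 (sc fun ω => (X * (y ω %ₘ P ω)).coeff j) := by
    cases j with
    | zero => exact (Der.sconst 0).congr fun ω => by simp [sc]
    | succ j => exact (Der.coeff hy hdeg j).congr fun ω => by simp [sc]
  refine ((h0.sub' ((Der.modTop hP hM h1 hN hy).mul (Der.coeff hP hN j))).congr fun ω => ?_).le
    (by omega)
  simp only [sc]
  rw [X_mul_modByMonic _ (hM ω) (h1 ω), coeff_sub, coeff_C_mul]

/-- The cost of a multiplication modulo `P`. -/
def mulCost (N : ℕ) : ℕ := (N + 1) * ((N + 1) * (N * (3 * N + 9) + 11)) + (N + 1)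

/-- The steps of Horner's scheme for `y * r`. -/
def horner {F : Type} [Field F] (N : ℕ) (y r : F[X]) : ℕ → F[X]
  | 0 => 0
  | i + 1 => X * horner N y r i + C (r.coeff (N - i)) * y

lemma horner_eq {F : Type} [Field F] (y r : F[X]) (hr : r.natDegree ≤ N) :
    horner N y r (N + 1) = r * y := by
  have h : ∀ i ≤ N + 1, horner N y r i = (∑ j ∈ Finset.range i, C (r.coeff (N + 1 - i + j)) * X ^ j) * y := by
    intro i hi
    induction i with
    | zero => simp [horner]
    | succ i ih =>
      rw [horner, ih (by omega), Finset.sum_range_succ', add_mul, ← mul_assoc, Finset.mul_sum]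
      refine congrArg₂ (· + ·) (congrArg (· * y) ?_) ?_
      · refine Finset.sum_congr rfl fun j _ => ?_
        rw [show N + 1 - i + j = N + 1 - (i + 1) + (j + 1) by omega]
        ring
      · simp [show N + 1 - (i + 1) = N - i by omega]
  rw [h _ le_rfl]
  conv_rhs => rw [r.as_sum_range' (N + 1) (by omega)]
  simp [C_mul_X_pow_eq_monomial]

/-- Horner's scheme in the coefficients of the residue of `z`: each step is one multiplication by
`X` modulo `P` and one addition. Always using `N + 1` coefficients makes the program independent of
the actual degree of `P`. -/
lemma Derives.modMul (hP : cf N P ⊆ S) (hM : ∀ ω, (P ω).Monic) (h1 : ∀ ω, 1 ≤ (P ω).natDegree)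
    (hN : ∀ ω, (P ω).natDegree ≤ N) (hy : mc N P y ⊆ S) (hz : mc N P z ⊆ S) :
    Derives S (mulCost N) (mc N P fun ω => z ω * y ω) := by
  have hdeg : ∀ (y : Ω → B.F[X]) ω, (y ω %ₘ P ω).natDegree ≤ N :=
    fun y ω => natDegree_modByMonic_le_of_le _ (hM ω) (hN ω)
  have h0 : Derives S (N + 1) (mc N P fun ω => horner N (y ω) (z ω %ₘ P ω) 0) :=
    (Derives.coeffs (a := 1) fun j _ => (Der.sconst 0).congr fun ω => by simp [sc, horner]).le
      (by simp)
  have hit := Derives.iterate (S := S) (a := (N + 1) * (N * (3 * N + 9) + 11))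
    (fun i => mc N P fun ω => horner N (y ω) (z ω %ₘ P ω) i) (N + 1) (by
      intro i _
      refine (Derives.coeffs (a := N * (3 * N + 9) + 11) fun j _ => ?_)
      refine (((Der.modMulX (hP.trans Set.subset_union_left) hM h1 hN
        (y := fun ω => horner N (y ω) (z ω %ₘ P ω) i) Set.subset_union_right j).add
        ((Der.coeff (hz.trans Set.subset_union_left) (hdeg z) (N - i)).mul
          (Der.coeff (hy.trans Set.subset_union_left) (hdeg y) j))).congr fun ω => ?_).le (by omega)
      simp only [sc, horner]
      rw [add_modByMonic, coeff_add, ← smul_eq_C_mul, smul_modByMonic, coeff_smul, smul_eq_mul])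
  refine (h0.trans hit).mono le_rfl (by unfold mulCost; omega) ?_
  rintro v ⟨j, hj, rfl⟩
  refine ⟨j, hj, ?_⟩
  funext ω
  simp only [sc]
  rw [horner_eq _ _ (hdeg z ω)]
  have := modByMonic_eq_self_iff (hM ω) |>.2 (degree_modByMonic_lt (z ω) (hM ω))
  rw [mul_modByMonic, this, ← mul_modByMonic]

/-- Square and multiply. The exponent is a constant of the program; only `y` and `P` vary with the
run. -/
lemma Derives.modPow (hP : cf N P ⊆ S) (hM : ∀ ω, (P ω).Monic) (h1 : ∀ ω, 1 ≤ (P ω).natDegree)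
    (hN : ∀ ω, (P ω).natDegree ≤ N) (hy : mc N P y ⊆ S) (k h : ℕ) (hk : h < 2 ^ k) :
    Derives S (k * (2 * mulCost N) + (N + 1)) (mc N P fun ω => y ω ^ h) := by
  induction k generalizing h with
  | zero =>
    obtain rfl : h = 0 := by simpa using hk
    refine (Derives.coeffs (a := 1) fun j _ => ?_).le (by omega)
    refine (Der.sconst (if j = 0 then 1 else 0)).congr fun ω => ?_
    simp only [sc]
    rw [pow_zero, (modByMonic_eq_self_iff (hM ω)).2, coeff_one]
    rw [degree_one, degree_eq_natDegree (hM ω).ne_zero]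
    exact_mod_cast h1 ω
  | succ k ih =>
    have h2 := ih (h / 2) (by rw [pow_succ] at hk; omega)
    have h3 := h2.trans (Derives.modMul (S := S ∪ mc N P fun ω => y ω ^ (h / 2))
      (hP.trans Set.subset_union_left) hM h1 hN
      (y := fun ω => y ω ^ (h / 2)) (z := fun ω => y ω ^ (h / 2)) Set.subset_union_right
      Set.subset_union_right)
    rcases Nat.mod_two_eq_zero_or_one h with hm | hm
    · refine h3.mono le_rfl (by ring_nf; omega) ?_
      rw [show (fun ω => y ω ^ h) = fun ω => y ω ^ (h / 2) * y ω ^ (h / 2) from funext fun ω => by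
        rw [← pow_add]; congr 1; omega]
    · have h4 := h3.trans (Derives.modMul
        (S := S ∪ mc N P fun ω => y ω ^ (h / 2) * y ω ^ (h / 2))
        (hP.trans Set.subset_union_left) hM h1 hN
        (y := y) (z := fun ω => y ω ^ (h / 2) * y ω ^ (h / 2))
        (hy.trans Set.subset_union_left) Set.subset_union_right)
      refine h4.mono le_rfl (by ring_nf; omega) ?_
      rw [show (fun ω => y ω ^ h) = fun ω => y ω ^ (h / 2) * y ω ^ (h / 2) * y ω from
        funext fun ω => by rw [← pow_add, ← pow_succ]; congr 1; omega]

end Modular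

/-! ### Finding the root of a polynomial at which polynomials can be tested for zero -/

section RootFinding

open Polynomial

section Algebra

variable {F : Type} [Field F]

/-- A descent step: if `(X + s) ^ h` is not constant modulo `P`, then `P` is replaced by a polynomial
of smaller degree with the same root `x`. -/
def descend (h : ℕ) (x : F) (P : F[X]) (s : F) : F[X] := by
  classical exact
    let Q := (X + C s) ^ h %ₘ P - C ((x + s) ^ h)
    if Q = 0 then P else Q * C Q.leadingCoeff⁻¹

lemma one_le_natDegree_of_root {P : F[X]} {x : F} (hM : P.Monic) (hx : P.eval x = 0) :
    1 ≤ P.natDegree := by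
  by_contra h
  rw [hM.natDegree_eq_zero.1 (by omega)] at hx
  simp at hx

lemma eval_modByMonic_of_root {P : F[X]} {x : F} (y : F[X]) (hx : P.eval x = 0) :
    (y %ₘ P).eval x = y.eval x := by
  conv_rhs => rw [← modByMonic_add_div y P]
  simp [hx]

lemma natDegree_descent_lt {P : F[X]} {x : F} (hM : P.Monic) (hx : P.eval x = 0) (y : F[X])
    (c : F) : (y %ₘ P - C c).natDegree < P.natDegree := by
  have h1 := one_le_natDegree_of_root hM hx
  rw [natDegree_sub_C]
  rcases eq_or_ne (y %ₘ P) 0 with h0 | h0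
  · rw [h0]; simp; omega
  · exact natDegree_lt_natDegree h0 (degree_modByMonic_lt y hM)

/-- The subtracted constant is the value of the residue at `x`. If the difference is non-zero, it
still vanishes at `x` and has degree below that of `P`, so it can replace `P` without any gcd. If it
is zero, then `P` divides the half-power minus its value at `x`. -/
lemma descend_spec {P : F[X]} {x : F} (h : ℕ) (hM : P.Monic) (hx : P.eval x = 0) (s : F) :
    (descend h x P s).Monic ∧ (descend h x P s).eval x = 0 ∧
      ((descend h x P s = P ∧ P ∣ (X + C s) ^ h - C ((x + s) ^ h)) ∨
        (descend h x P s).natDegree < P.natDegree) := by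
  unfold descend
  simp only
  split_ifs with hQ
  · refine ⟨hM, hx, .inl ⟨rfl, ?_⟩⟩
    rw [sub_eq_zero] at hQ
    rw [← hQ]
    exact ⟨(X + C s) ^ h /ₘ P, by
      conv_lhs => rw [← modByMonic_add_div ((X + C s) ^ h) P]
      rw [modByMonic_add_div]
      nth_rewrite 1 [← modByMonic_add_div ((X + C s) ^ h) P]
      ring⟩
  · refine ⟨monic_mul_leadingCoeff_inv hQ, ?_, .inr ?_⟩
    · simp [eval_modByMonic_of_root _ hx]
    · rw [natDegree_mul_leadingCoeff_inv _ hQ]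
      exact natDegree_descent_lt hM hx _ _

/-- If a pass over the shifts does not lower the degree, then `P` never changed, and all the shifts
failed for this same `P`. -/
lemma foldl_descend_spec {P : F[X]} {x : F} (h : ℕ) (hM : P.Monic) (hx : P.eval x = 0)
    (L : List F) :
    (L.foldl (descend h x) P).Monic ∧ (L.foldl (descend h x) P).eval x = 0 ∧
      ((L.foldl (descend h x) P = P ∧ ∀ s ∈ L, P ∣ (X + C s) ^ h - C ((x + s) ^ h)) ∨
        (L.foldl (descend h x) P).natDegree < P.natDegree) := by
  induction L generalizing P with
  | nil => exact ⟨hM, hx, .inl ⟨rfl, by simp⟩⟩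
  | cons s L ih =>
    obtain ⟨h1, h2, h3⟩ := descend_spec h hM hx s
    obtain ⟨h4, h5, h6⟩ := ih h1 h2
    refine ⟨h4, h5, ?_⟩
    simp only [List.foldl_cons]
    rcases h3 with ⟨h3, h3'⟩ | h3
    · rw [h3] at h6 ⊢
      rcases h6 with ⟨h6, h6'⟩ | h6
      · exact .inl ⟨h6, List.forall_mem_cons.2 ⟨h3', h6'⟩⟩
      · exact .inr h6
    · rcases h6 with ⟨h6, -⟩ | h6
      · exact .inr (by rw [h6]; exact h3)
      · exact .inr (h6.trans h3)

end Algebra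

variable {p : ℕ} [Fact p.Prime]

/-- The exceptional `s` are roots of `(X + x) ^ h - (X + r) ^ h`. Its coefficient at degree `h - 1`
is `h (x - r)`, which is non-zero as `0 < h < p`. -/
lemma card_unseparated_le {h : ℕ} (h0 : 1 ≤ h) (hp : h < p) {x r : ZMod p} (hxr : x ≠ r) :
    (Finset.univ.filter fun s : ZMod p => (x + s) ^ h = (r + s) ^ h).card ≤ h := by
  classical
  set Q : (ZMod p)[X] := (X + C x) ^ h - (X + C r) ^ h with hQ
  have hne : Q ≠ 0 := by
    intro hz
    have h1 := congrArg (fun q => q.coeff (h - 1)) hz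
    simp only [hQ, coeff_sub, coeff_X_add_C_pow, coeff_zero] at h1
    rw [show h - (h - 1) = 1 by omega, pow_one, pow_one, ← sub_mul, mul_eq_zero] at h1
    rcases h1 with h1 | h1
    · exact hxr (sub_eq_zero.1 h1)
    · rw [show h.choose (h - 1) = h by
        obtain ⟨k, rfl⟩ : ∃ k, h = k + 1 := ⟨h - 1, by omega⟩
        simp, ZMod.natCast_eq_zero_iff] at h1
      exact absurd (Nat.le_of_dvd h0 h1) (by omega)
  have hdeg : Q.natDegree ≤ h := by
    refine (natDegree_sub_le _ _).trans (max_le ?_ ?_) <;> simp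
  calc _ ≤ Q.roots.toFinset.card := by
        refine Finset.card_le_card fun s hs => ?_
        simp only [Finset.mem_filter, Finset.mem_univ, true_and] at hs
        rw [Multiset.mem_toFinset, mem_roots hne]
        simp [hQ, IsRoot, add_comm s, hs]
    _ ≤ _ := (Multiset.toFinset_card_le _).trans ((card_roots' _).trans hdeg)

/-- By averaging, some shift separates at least half of the remaining pairs. The list may therefore
be hard-wired into a non-uniform program. -/
lemma exists_separating_list {h : ℕ} (h0 : 1 ≤ h) (hp : 2 * h ≤ p) (m : ℕ)
    (U : Finset (ZMod p × ZMod p)) (hU : ∀ u ∈ U, u.1 ≠ u.2) (hm : U.card < 2 ^ m) :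
    ∃ L : List (ZMod p), L.length ≤ m ∧ ∀ u ∈ U, ∃ s ∈ L, (u.1 + s) ^ h ≠ (u.2 + s) ^ h := by
  classical
  induction m generalizing U with
  | zero =>
    obtain rfl : U = ∅ := by simpa using hm
    exact ⟨[], by simp, by simp⟩
  | succ m ih =>
    obtain ⟨s, hs⟩ : ∃ s : ZMod p,
        2 * (U.filter fun u => (u.1 + s) ^ h = (u.2 + s) ^ h).card ≤ U.card := by
      by_contra! hcon
      have h1 : ∑ s : ZMod p, (U.filter fun u => (u.1 + s) ^ h = (u.2 + s) ^ h).card ≤ U.card * h := by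
        simp only [Finset.card_filter]
        rw [Finset.sum_comm, ← smul_eq_mul]
        refine Finset.sum_le_card_nsmul _ _ _ fun u hu => ?_
        rw [← Finset.card_filter]
        exact card_unseparated_le h0 (by omega) (hU u hu)
      have h2 : ∑ _s : ZMod p, U.card < ∑ s : ZMod p,
          2 * (U.filter fun u => (u.1 + s) ^ h = (u.2 + s) ^ h).card :=
        Finset.sum_lt_sum_of_nonempty Finset.univ_nonempty fun s _ => hcon s
      rw [← Finset.mul_sum, Finset.sum_const, Finset.card_univ, ZMod.card, smul_eq_mul] at h2
      -- Otherwise `p |U| < 2 |U| h ≤ p |U|`.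
      nlinarith
    obtain ⟨L, hL, hL'⟩ := ih (U.filter fun u => (u.1 + s) ^ h = (u.2 + s) ^ h)
      (fun u hu => hU u (Finset.mem_filter.1 hu).1) (by rw [pow_succ] at hm; omega)
    refine ⟨s :: L, by simpa using hL, fun u hu => ?_⟩
    by_cases hus : (u.1 + s) ^ h = (u.2 + s) ^ h
    · obtain ⟨t, ht, ht'⟩ := hL' u (Finset.mem_filter.2 ⟨hu, hus⟩)
      exact ⟨t, by simp [ht], ht'⟩
    · exact ⟨s, by simp, hus⟩

/-- Polynomially many shifts separate all pairs of scalars. -/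
lemma exists_shifts {k : ℕ} (hp2 : p ≠ 2) (hk : p ≤ 2 ^ k) :
    ∃ L : List (ZMod p), L.length ≤ 2 * k + 2 ∧ 0 ∈ L ∧
      ∀ x r : ZMod p, x ≠ r → ∃ s ∈ L, (x + s) ^ ((p - 1) / 2) ≠ (r + s) ^ ((p - 1) / 2) := by
  classical
  have h2 := (Fact.out : p.Prime).two_le
  -- There are at most `p² ≤ 2 ^ (2k)` pairs, so `2k + 1` halvings leave none. The shift `0` is
  -- added because it is what forces a stuck polynomial to divide `X ^ p - X`.
  obtain ⟨L, hL, hL'⟩ := exists_separating_list (p := p) (h := (p - 1) / 2) (by omega) (by omega)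
    (2 * k + 1) (Finset.univ.filter fun u => u.1 ≠ u.2) (by simp) (by
      refine lt_of_le_of_lt (Finset.card_filter_le _ _) ?_
      simp only [Finset.card_univ, Fintype.card_prod, ZMod.card]
      calc p * p ≤ 2 ^ k * 2 ^ k := Nat.mul_le_mul hk hk
        _ < 2 ^ (2 * k + 1) := by
          rw [pow_succ, two_mul, pow_add]
          have : 0 < 2 ^ k * 2 ^ k := by positivity
          omega)
  exact ⟨0 :: L, by simpa using hL, by simp, fun x r hxr => by
    obtain ⟨s, hs, hs'⟩ := hL' (x, r) (by simpa using hxr)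
    exact ⟨s, by simp [hs], hs'⟩⟩

/-- For `z ≠ 0` the half-power squares to `1`, by Fermat. With only three possible values, two
equality tests are enough to find it. -/
lemma pow_half_cases (hp2 : p ≠ 2) (z : ZMod p) :
    z ^ ((p - 1) / 2) = 0 ∨ z ^ ((p - 1) / 2) = 1 ∨ z ^ ((p - 1) / 2) = -1 := by
  have hodd := (Fact.out : p.Prime).odd_of_ne_two hp2
  have h2 := (Fact.out : p.Prime).two_le
  rcases eq_or_ne z 0 with rfl | hz
  · left
    obtain ⟨k, hk⟩ := hodd
    rw [zero_pow]
    omega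
  · right
    rw [← sq_eq_one_iff]
    rw [← pow_mul, show (p - 1) / 2 * 2 = p - 1 by obtain ⟨k, hk⟩ := hodd; omega]
    exact ZMod.pow_card_sub_one_eq_one hz

/-- A polynomial on which every shift is stuck divides `X ^ p - X`, so it is a product of distinct
linear factors. A root `r` other than `x` would agree with `x` on all the half-powers, contrary to
the choice of `L`. -/
lemma natDegree_eq_one_of_dvd (hp2 : p ≠ 2) {L : List (ZMod p)} (h0 : 0 ∈ L)
    (hL : ∀ x r : ZMod p, x ≠ r → ∃ s ∈ L, (x + s) ^ ((p - 1) / 2) ≠ (r + s) ^ ((p - 1) / 2))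
    {P : (ZMod p)[X]} {x : ZMod p} (hM : P.Monic) (hx : P.eval x = 0) (hx0 : x ≠ 0)
    (hP : ∀ s ∈ L, P ∣ (X + C s) ^ ((p - 1) / 2) - C ((x + s) ^ ((p - 1) / 2))) :
    P.natDegree = 1 := by
  have hodd := (Fact.out : p.Prime).odd_of_ne_two hp2
  have h2 := (Fact.out : p.Prime).two_le
  obtain ⟨k, hk⟩ := hodd
  -- With `c = x ^ ((p - 1) / 2)` and `c² = 1` (as `x ≠ 0`), the polynomial `X ^ p - X` is `(X ^ ((p
  -- - 1) / 2) - c) (X ^ ((p - 1) / 2) + c) X`.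
  have hdvd : P ∣ X ^ p - X := by
    have h1 := hP 0 h0
    rw [C_0, add_zero, add_zero] at h1
    have hc : (x ^ ((p - 1) / 2)) ^ 2 = 1 := by
      rw [← pow_mul, show (p - 1) / 2 * 2 = p - 1 by omega]
      exact ZMod.pow_card_sub_one_eq_one hx0
    refine h1.trans ⟨(X ^ ((p - 1) / 2) + C (x ^ ((p - 1) / 2))) * X, ?_⟩
    have : (X : (ZMod p)[X]) ^ p = X ^ ((p - 1) / 2) * X ^ ((p - 1) / 2) * X := by
      rw [← pow_add, ← pow_succ]; congr 1; omega
    rw [this]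
    have hC : (C (x ^ ((p - 1) / 2)) : (ZMod p)[X]) * C (x ^ ((p - 1) / 2)) = 1 := by
      rw [← C_mul, ← sq, hc, C_1]
    linear_combination X * hC
  obtain ⟨P₁, rfl⟩ := dvd_iff_isRoot.2 hx
  have hM₁ : P₁.Monic := (monic_X_sub_C x).of_mul_monic_left hM
  by_contra hdeg
  have hdeg₁ : P₁.degree ≠ 0 := by
    intro hz
    apply hdeg
    rw [natDegree_mul (X_sub_C_ne_zero x) hM₁.ne_zero, natDegree_X_sub_C,
      natDegree_eq_zero_iff_degree_le_zero.2 hz.le]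
  have hne := FiniteField.X_pow_card_sub_X_ne_zero (ZMod p) (Fact.out : p.Prime).one_lt
  have hsplit : (X ^ p - X : (ZMod p)[X]).Splits := by
    simpa using GaloisField.splits_zmod_X_pow_sub_X p
  obtain ⟨r, hr⟩ := (hsplit.of_dvd hne ((Dvd.intro_left _ rfl).trans hdvd)).exists_eval_eq_zero hdeg₁
  rcases eq_or_ne x r with rfl | hxr
  -- A double root at `x` would be a zero of the derivative of `X ^ p - X`, which is the constant
  -- `-1`.
  · obtain ⟨W, rfl⟩ := dvd_iff_isRoot.2 hr
    obtain ⟨V, hV⟩ := hdvd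
    have := congrArg (fun q => (derivative q).eval x) hV
    simp [derivative_mul, derivative_X_pow] at this
  · obtain ⟨s, hs, hs'⟩ := hL x r hxr
    obtain ⟨V, hV⟩ := hP s hs
    have := congrArg (eval r) hV
    simp only [eval_sub, eval_pow, eval_add, eval_X, eval_C, eval_mul, hr, mul_zero, zero_mul] at this
    exact hs' (sub_eq_zero.1 this).symm

/-- Enough rounds of descent isolate the root. -/
lemma descent_rounds (hp2 : p ≠ 2) {L : List (ZMod p)} (h0 : 0 ∈ L)
    (hL : ∀ x r : ZMod p, x ≠ r → ∃ s ∈ L, (x + s) ^ ((p - 1) / 2) ≠ (r + s) ^ ((p - 1) / 2))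
    {P : (ZMod p)[X]} {x : ZMod p} (hM : P.Monic) (hx : P.eval x = 0) (hx0 : x ≠ 0) (n : ℕ) :
    let R := (fun Q => L.foldl (descend ((p - 1) / 2) x) Q)^[n] P
    R.Monic ∧ R.eval x = 0 ∧ (R.natDegree = 1 ∨ R.natDegree + n ≤ P.natDegree) := by
  induction n with
  | zero => exact ⟨hM, hx, .inr le_rfl⟩
  | succ n ih =>
    simp only [Function.iterate_succ_apply'] at ih ⊢
    set R := (fun Q => L.foldl (descend ((p - 1) / 2) x) Q)^[n] P
    obtain ⟨h1, h2, h3⟩ := ih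
    obtain ⟨h4, h5, h6⟩ := foldl_descend_spec ((p - 1) / 2) h1 h2 L
    refine ⟨h4, h5, ?_⟩
    rcases h6 with ⟨h6, h7⟩ | h6
    · exact .inl (by rw [h6]; exact natDegree_eq_one_of_dvd hp2 h0 hL h1 h2 hx0 h7)
    · have := one_le_natDegree_of_root h4 h5
      omega

end RootFinding

/-! ### The root finder as a straight-line program -/

section RootProgram

open Polynomial

variable {B : BilinearGroup} {Ω : Type} {S S' : Set (Ω → Val B)} {N k t : ℕ} {x : Ω → B.F}
  {P : Ω → B.F[X]}

/-- Polynomials of degree less than `N` with available coefficients can be tested for vanishing at `x`. -/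
def ZeroTest (S : Set (Ω → Val B)) (N t : ℕ) (x : Ω → B.F) : Prop :=
  ∀ S', S ⊆ S' → ∀ r : ℕ → Ω → B.F, (∀ j < N, Der S' 5 (sc (r j))) →
    Der S' t (sc fun ω => ind (∑ j ∈ Finset.range N, r j ω * x ω ^ j = 0))

lemma ZeroTest.weaken (h : ZeroTest S N t x) (hS : S ⊆ S') : ZeroTest S' N t x :=
  fun T hT => h T (hS.trans hT)

/-- Testing the value of a polynomial at `x`. -/
lemma ZeroTest.eval_eq (hT : ZeroTest S N t x) {Q : Ω → B.F[X]} (hQ : cf N Q ⊆ S)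
    (hdeg : ∀ ω, (Q ω).natDegree < N) (c : B.F) :
    Der S t (sc fun ω => ind ((Q ω).eval (x ω) = c)) := by
  -- The constant `c` is moved into coefficient `0`. The cost `1 + 1 + 3` of such a difference is
  -- the bound `5` in `ZeroTest`.
  refine (hT S le_rfl (fun j ω => (Q ω).coeff j - if j = 0 then c else 0) fun j _ =>
    ((Der.coeff hQ (fun ω => (hdeg ω).le) j).sub' (Der.sconst _))).congr fun ω => ?_
  simp only [sc]
  congr 2
  have hN : 0 < N := (Nat.zero_le _).trans_lt (hdeg ω)
  rw [eval_eq_sum_range' (hdeg ω), ← sub_eq_zero (b := c)]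
  simp only [sub_mul, Finset.sum_sub_distrib, ite_mul, zero_mul]
  rw [Finset.sum_ite_eq' (Finset.range N) 0, if_pos (by simpa using hN)]
  simp

/-- The cost of a descent step. -/
def descendCost (N k t : ℕ) : ℕ :=
  (N + 1) * (N * (3 * N + 9) + 11) + (N + 1) + (k * (2 * mulCost N) + (N + 1)) + (2 * t + 3) +
    (N + 1) * 6 + (N + 1) * (2 * ((N + 1) * 3 + 1) + ((N + 1) * (3 * N + 9) + 1) + 10)

/-- Everything in a descent step is arithmetic with the coefficients of `P`, except the number `(x +
s) ^ h`. That number is the value at `x` of a residue, and the zero test identifies it. -/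
lemma Derives.descend (hp2 : B.p ≠ 2) (hk : B.p ≤ 2 ^ k) (hT : ZeroTest S N t x) (hP : cf N P ⊆ S)
    (hM : ∀ ω, (P ω).Monic) (hx : ∀ ω, (P ω).eval (x ω) = 0) (hN : ∀ ω, (P ω).natDegree ≤ N)
    (s : B.F) :
    Derives S (descendCost N k t)
      (cf N fun ω => RKZGb.descend ((B.p - 1) / 2) (x ω) (P ω) s) := by
  set h := (B.p - 1) / 2 with hh
  have h1 : ∀ ω, 1 ≤ (P ω).natDegree := fun ω => one_le_natDegree_of_root (hM ω) (hx ω)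
  have hdeg : ∀ (y : Ω → B.F[X]) ω, (y ω %ₘ P ω).natDegree ≤ N :=
    fun y ω => natDegree_modByMonic_le_of_le _ (hM ω) (hN ω)
  set R : Ω → B.F[X] := fun ω => (X + C s) ^ h %ₘ P ω with hR
  set Q : Ω → B.F[X] := fun ω => R ω - C ((x ω + s) ^ h) with hQ
  have hone : Derives S (N + 1) (mc N P fun _ => 1) := by
    refine (Derives.coeffs (a := 1) fun j _ => ?_).le (by simp)
    refine (Der.sconst (if j = 0 then 1 else 0)).congr fun ω => ?_
    simp only [sc]
    rw [(modByMonic_eq_self_iff (hM ω)).2, coeff_one]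
    rw [degree_one, degree_eq_natDegree (hM ω).ne_zero]
    exact_mod_cast h1 ω
  have hlin : Derives (S ∪ mc N P fun _ => 1) ((N + 1) * (N * (3 * N + 9) + 11))
      (mc N P fun _ => X + C s) := by
    refine Derives.coeffs fun j _ => ?_
    refine (((Der.modMulX (hP.trans Set.subset_union_left) hM h1 hN
      (y := fun _ => 1) Set.subset_union_right j).add ((Der.sconst s).mul
        (Der.coeff (Q := fun ω => 1 %ₘ P ω) Set.subset_union_right (hdeg _) j))).congr
          fun ω => ?_).le (by omega)
    simp only [sc]
    rw [add_modByMonic, coeff_add, mul_one,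
      show (C s : B.F[X]) = s • 1 by rw [smul_eq_C_mul, mul_one], smul_modByMonic, coeff_smul,
      smul_eq_mul]
  have hpow := (hone.trans hlin).trans (Derives.modPow (S := S ∪ mc N P fun _ => X + C s)
    (hP.trans Set.subset_union_left) hM h1 hN (y := fun _ => X + C s) Set.subset_union_right k h
    (by have := B.prime.out.two_le; omega))
  have hRev : ∀ ω, (R ω).eval (x ω) = (x ω + s) ^ h := fun ω => by
    simp [hR, eval_modByMonic_of_root _ (hx ω)]
  -- The zero test handles degrees below `N` only; a residue modulo `P` has degree below that of
  -- `P`, which is at most `N`.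
  have hRlt : ∀ ω, (R ω).natDegree < N := fun ω => by
    have := natDegree_descent_lt (hM ω) (hx ω) ((X + C s) ^ h) 0
    rw [C_0, sub_zero] at this
    exact lt_of_lt_of_le this (hN ω)
  -- The value is `0`, `1` or `-1`, hence equal to the indicator of `1` minus the indicator of `-1`;
  -- these two are distinct as `p ≠ 2`.
  have hchi : Derives (S ∪ cf N R) (2 * t + 3) {sc fun ω => (x ω + s) ^ h} := by
    have hT' := hT.weaken (S' := S ∪ cf N R) Set.subset_union_left
    refine (((hT'.eval_eq Set.subset_union_right hRlt 1).sub'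
      (hT'.eval_eq Set.subset_union_right hRlt (-1))).congr fun ω => ?_).le (by omega)
    simp only [sc, hRev]
    have hne : (1 : B.F) ≠ -1 := by
      have : Fact (2 < B.p) := ⟨lt_of_le_of_ne B.prime.out.two_le (Ne.symm hp2)⟩
      exact (ZMod.neg_one_ne_one (n := B.p)).symm
    rcases pow_half_cases hp2 (x ω + s) with h | h | h <;> rw [← hh] at h <;>
      simp [h, hne, hne.symm, ind]
  have hRQ := (hpow.keep.trans (hchi.keep.weaken (S' := S ∪ (S ∪ cf N R))
    Set.subset_union_right)).trans
    (U := cf N Q) (b := (N + 1) * 6) (by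
      refine Derives.coeffs fun j _ => ?_
      have hS1 : cf N R ⊆ S ∪ (S ∪ cf N R ∪ {sc fun ω => (x ω + s) ^ h}) := fun v hv =>
        .inr (.inl (.inr hv))
      have hc : Der (S ∪ (S ∪ cf N R ∪ {sc fun ω => (x ω + s) ^ h})) 1
          (sc fun ω => if j = 0 then (x ω + s) ^ h else 0) := by
        split_ifs
        · exact (Der.of_mem (.inr (.inr rfl))).le (by omega)
        · exact Der.sconst 0
      refine (((Der.coeff hS1 (fun ω => (hRlt ω).le) j).sub' hc).congr fun ω => ?_).le (by omega)
      simp only [sc, hQ, coeff_sub, coeff_C])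
  have hQdeg : ∀ ω, (Q ω).natDegree ≤ N := fun ω =>
    (natDegree_descent_lt (hM ω) (hx ω) _ _).le.trans (hN ω)
  refine (hRQ.trans (b := (N + 1) * (2 * ((N + 1) * 3 + 1) + ((N + 1) * (3 * N + 9) + 1) + 10)) ?_).le
    (by unfold descendCost; omega)
  refine Derives.coeffs fun j _ => ?_
  have hQS : cf N Q ⊆ S ∪ cf N Q := Set.subset_union_right
  -- Whether the degree drops depends on the run, so each new coefficient is selected arithmetically
  -- between that of `P` and that of the normalised difference.
  have hz := Der.forall (Finset.range (N + 1)) fun j _ => (Der.coeff hQS hQdeg j).eqZero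
  have hq := ((Der.coeff hQS hQdeg j).mul (Der.leadingCoeff hQS hQdeg).inv)
  refine ((hz.ite (Der.coeff (hP.trans Set.subset_union_left) hN j) hq).congr fun ω => ?_).le
    (by simp; omega)
  simp only [sc, RKZGb.descend]
  have hiff : (∀ i ∈ Finset.range (N + 1), (Q ω).coeff i = 0) ↔ Q ω = 0 := by
    refine ⟨fun hi => ?_, fun hi => by simp [hi]⟩
    ext i
    by_cases hiN : i ∈ Finset.range (N + 1)
    · simpa using hi i hiN
    · rw [coeff_zero, coeff_eq_zero_of_natDegree_lt]
      have := hQdeg ω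
      simp at hiN
      omega
  by_cases h0 : Q ω = 0
  · rw [if_pos (hiff.2 h0), if_pos h0]
  · rw [if_neg (fun h => h0 (hiff.1 h)), if_neg h0, coeff_mul_C]

lemma Derives.foldl_descend (hp2 : B.p ≠ 2) (hk : B.p ≤ 2 ^ k) (hT : ZeroTest S N t x)
    (hP : cf N P ⊆ S) (hM : ∀ ω, (P ω).Monic) (hx : ∀ ω, (P ω).eval (x ω) = 0)
    (hN : ∀ ω, (P ω).natDegree ≤ N) (L : List B.F) :
    Derives S (L.length * descendCost N k t)
      (cf N fun ω => L.foldl (RKZGb.descend ((B.p - 1) / 2) (x ω)) (P ω)) := by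
  induction L generalizing P S with
  | nil => exact (Derives.refl hP).le (by simp)
  | cons s L ih =>
    have hs := fun ω => descend_spec ((B.p - 1) / 2) (hM ω) (hx ω) s
    have h1 := Derives.descend hp2 hk hT hP hM hx hN s
    refine (h1.trans (ih (hT.weaken Set.subset_union_left) Set.subset_union_right
      (fun ω => (hs ω).1) (fun ω => (hs ω).2.1) fun ω => ?_)).le (by simp; ring_nf; omega)
    rcases (hs ω).2.2 with h | h
    · rw [h.1]; exact hN ω
    · exact h.le.trans (hN ω)

/-- The cost of finding a root. -/
def rootCost (N k t : ℕ) : ℕ :=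
  (N + 1) * ((N + 1) * (3 * N + 9) + 4) + N * ((2 * k + 2) * descendCost N k t) + 3

/-- A program that is given the coefficients of a non-zero polynomial with the root `x`, and that can
test polynomials for vanishing at `x`, can compute `x`. -/
theorem Der.root (hp2 : B.p ≠ 2) (hk : B.p ≤ 2 ^ k) (hT : ZeroTest S N t x)
    (hP : cf N P ⊆ S) (h0 : ∀ ω, P ω ≠ 0) (hx : ∀ ω, (P ω).eval (x ω) = 0)
    (hN : ∀ ω, (P ω).natDegree ≤ N) (hx0 : ∀ ω, x ω ≠ 0) :
    Der S (rootCost N k t) (sc x) := by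
  obtain ⟨L, hL, hL0, hLs⟩ := exists_shifts hp2 hk
  set P₀ : Ω → B.F[X] := fun ω => P ω * C (P ω).leadingCoeff⁻¹ with hP₀
  have hM₀ : ∀ ω, (P₀ ω).Monic := fun ω => monic_mul_leadingCoeff_inv (h0 ω)
  have hx₀ : ∀ ω, (P₀ ω).eval (x ω) = 0 := fun ω => by simp [hP₀, hx ω]
  have hN₀ : ∀ ω, (P₀ ω).natDegree ≤ N := fun ω => by
    rw [hP₀]
    simp only
    rw [natDegree_mul_leadingCoeff_inv _ (h0 ω)]
    exact hN ω
  have h1 : Derives S ((N + 1) * ((N + 1) * (3 * N + 9) + 4)) (cf N P₀) := by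
    refine Derives.coeffs fun j _ => ?_
    refine (((Der.coeff hP hN j).mul (Der.leadingCoeff hP hN).inv).congr fun ω => ?_).le (by omega)
    simp only [sc, hP₀, coeff_mul_C]
  set R : ℕ → Ω → B.F[X] := fun n ω =>
    (fun Q => L.foldl (RKZGb.descend ((B.p - 1) / 2) (x ω)) Q)^[n] (P₀ ω) with hR
  have hRs : ∀ n ω, (R n ω).Monic ∧ (R n ω).eval (x ω) = 0 ∧
      ((R n ω).natDegree = 1 ∨ (R n ω).natDegree + n ≤ (P₀ ω).natDegree) := fun n ω =>
    descent_rounds hp2 hL0 hLs (hM₀ ω) (hx₀ ω) (hx0 ω) n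
  have hRN : ∀ n ω, (R n ω).natDegree ≤ N := fun n ω => by
    have := one_le_natDegree_of_root (hM₀ ω) (hx₀ ω)
    have := hN₀ ω
    rcases (hRs n ω).2.2 with h | h <;> omega
  have h2 := Derives.iterate (S := S) (a := (2 * k + 2) * descendCost N k t) (fun n => cf N (R n)) N
    (by
      intro n _
      refine ((Derives.foldl_descend (S := S ∪ cf N (R n)) hp2 hk (hT.weaken Set.subset_union_left)
        Set.subset_union_right (fun ω => (hRs n ω).1) (fun ω => (hRs n ω).2.1) (hRN n) L).le
          (Nat.mul_le_mul_right _ hL)).sub ?_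
      rintro v ⟨j, hj, rfl⟩
      refine ⟨j, hj, ?_⟩
      simp only [hR, Function.iterate_succ_apply'])
  have h3 : Der (S ∪ cf N (R N)) 3 (sc x) := by
    refine ((Der.coeff (Q := R N) Set.subset_union_right (hRN N) 0).neg).congr fun ω => ?_
    -- Without reaching degree `1`, each of the `N` rounds would have lowered the degree, which
    -- starts at `N` at most. The result would then be constant, which is impossible for a monic
    -- polynomial with a root.
    have hdeg : (R N ω).natDegree = 1 := by
      have := one_le_natDegree_of_root (hRs N ω).1 (hRs N ω).2.1
      have := hN₀ ω
      rcases (hRs N ω).2.2 with h | h <;> omega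
    have he := (hRs N ω).2.1
    rw [eval_eq_sum_range, hdeg, Finset.sum_range_succ, Finset.sum_range_one, pow_zero, mul_one,
      pow_one, show (R N ω).coeff 1 = 1 by rw [← hdeg]; exact (hRs N ω).1.coeff_natDegree,
      one_mul] at he
    simp only [sc]
    rw [neg_eq_iff_add_eq_zero.2 he]
  exact ((h1.trans h2).trans h3).le (by unfold rootCost; omega)

end RootProgram

/-! ### Laurent polynomials with exponents between `-d` and `d` -/

section Laurent

open LaurentPolynomial

variable {F : Type} [Field F]

/-- The Laurent polynomials with exponents between `-d` and `d`. -/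
def win (F : Type) [Field F] (d : ℕ) : Submodule F F[T;T⁻¹] where
  carrier := {f | ∀ i, i ∉ exps d → f.coeff i = 0}
  add_mem' := fun hf hg i hi => by simp [hf i hi, hg i hi]
  zero_mem' := by simp
  smul_mem' := fun c f hf i hi => by simp [hf i hi]

lemma C_mul_mem_win {d : ℕ} {f : F[T;T⁻¹]} (c : F) (hf : f ∈ win F d) : C c * f ∈ win F d := by
  rw [← smul_eq_C_mul]
  exact Submodule.smul_mem _ _ hf

lemma C_mem_win (d : ℕ) (c : F) : C c ∈ win F d := fun i hi => by
  rw [C_apply, if_neg]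
  rintro rfl
  simp [exps] at hi

lemma coeff_T_mul (n i : ℤ) (f : F[T;T⁻¹]) : (T n * f).coeff i = f.coeff (i - n) := by
  have := AddMonoidAlgebra.coeff_single_mul_apply f (1 : F) n i
  rw [one_mul] at this
  rw [T, this]
  congr 1
  ring

/-- The Laurent polynomial `X ^ (-d) * g`. -/
def shift (d : ℕ) (g : Polynomial F) : F[T;T⁻¹] := T (-(d : ℤ)) * Polynomial.toLaurent g

lemma shift_sub (d : ℕ) (g h : Polynomial F) : shift d (g - h) = shift d g - shift d h := by
  simp [shift, mul_sub]

lemma shift_sum {ι : Type*} (J : Finset ι) (d : ℕ) (g : ι → Polynomial F) :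
    shift d (∑ i ∈ J, g i) = ∑ i ∈ J, shift d (g i) := by
  simp [shift, Finset.mul_sum]

lemma shift_mul (d : ℕ) (g h : Polynomial F) :
    shift d (g * h) = Polynomial.toLaurent g * shift d h := by
  simp only [shift, map_mul]
  ring

lemma shift_C_mul (d : ℕ) (c : F) (h : Polynomial F) :
    shift d (Polynomial.C c * h) = C c * shift d h := by
  rw [shift_mul, Polynomial.toLaurent_C]

lemma shift_X_pow_mul (d : ℕ) (h : Polynomial F) :
    shift d (Polynomial.X ^ d * h) = Polynomial.toLaurent h := by
  rw [shift, map_mul, Polynomial.toLaurent_X_pow, ← mul_assoc, ← T_add, neg_add_cancel, T_zero,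
    one_mul]

lemma shift_injective (d : ℕ) : Function.Injective (shift d (F := F)) := fun _ _ hgh =>
  Polynomial.toLaurent_injective ((isUnit_T (R := F) (-(d : ℤ))).mul_right_injective hgh)

lemma coeff_toLaurent_natCast (g : Polynomial F) (k : ℕ) :
    (Polynomial.toLaurent g).coeff (k : ℤ) = g.coeff k := by
  rw [coeff_toLaurent]
  exact Finsupp.mapDomain_apply Nat.cast_injective _ _

lemma coeff_toLaurent_neg (g : Polynomial F) {i : ℤ} (hi : i < 0) :
    (Polynomial.toLaurent g).coeff i = 0 := by
  rw [coeff_toLaurent]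
  refine Finsupp.mapDomain_of_notMem_range _ _ ?_
  rintro ⟨k, rfl⟩
  simp at hi
  omega

lemma shift_mem_win {d : ℕ} {g : Polynomial F} (hg : g.natDegree ≤ 2 * d) : shift d g ∈ win F d := by
  intro i hi
  rw [shift, coeff_T_mul]
  rcases lt_or_ge (i - -(d : ℤ)) 0 with h | h
  · exact coeff_toLaurent_neg g h
  · obtain ⟨k, hk⟩ := Int.eq_ofNat_of_zero_le h
    rw [hk, coeff_toLaurent_natCast, Polynomial.coeff_eq_zero_of_natDegree_lt]
    simp [exps] at hi
    omega

/-- Multiplication by `X ^ d` carries the exponents `-d, …, d` to `0, …, 2d`; divisibility and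
evaluation can then be treated for ordinary polynomials. -/
lemma exists_shift {d : ℕ} {f : F[T;T⁻¹]} (hf : f ∈ win F d) :
    ∃ g : Polynomial F, g.natDegree ≤ 2 * d ∧ shift d g = f := by
  set g : Polynomial F := ∑ k ∈ Finset.range (2 * d + 1), Polynomial.monomial k (f.coeff (k - d))
    with hg
  have hdeg : g.natDegree ≤ 2 * d := by
    refine Polynomial.natDegree_sum_le_of_forall_le _ _ fun k hk => ?_
    refine (Polynomial.natDegree_monomial_le _).trans ?_
    simp at hk
    omega
  refine ⟨g, hdeg, LaurentPolynomial.ext fun i => ?_⟩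
  by_cases hi : i ∈ exps d
  · simp only [exps, Finset.mem_Icc] at hi
    obtain ⟨k, hk⟩ := Int.eq_ofNat_of_zero_le (show 0 ≤ i - -(d : ℤ) by omega)
    rw [shift, coeff_T_mul, hk, coeff_toLaurent_natCast, hg, Polynomial.finsetSum_coeff]
    simp only [Polynomial.coeff_monomial]
    rw [Finset.sum_ite_eq', if_pos (by simp; omega)]
    congr 1
    omega
  · rw [hf i hi, shift_mem_win hdeg i hi]

lemma lev_eq_sum {f : F[T;T⁻¹]} {J : Finset ℤ} (hf : ∀ i, i ∉ J → f.coeff i = 0) (z : F) :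
    lev f z = ∑ i ∈ J, f.coeff i * z ^ i := by
  rw [lev, Finsupp.sum]
  refine Finset.sum_subset (fun i hi => ?_) fun i _ hi => ?_
  · by_contra h
    exact Finsupp.mem_support_iff.1 hi (hf i h)
  · rw [Finsupp.notMem_support_iff.1 hi, zero_mul]

/-- At a unit, evaluation is a ring homomorphism on Laurent polynomials. This yields all the
algebraic rules for `lev`, and is the reason why they require `z ≠ 0`. -/
lemma lev_eq_eval₂ (f : F[T;T⁻¹]) {z : F} (hz : z ≠ 0) :
    lev f z = eval₂ (RingHom.id F) (Units.mk0 z hz) f := by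
  induction f using LaurentPolynomial.induction_on' with
  | add f g hf hg =>
    rw [map_add, ← hf, ← hg, lev, AddMonoidAlgebra.coeff_add, Finsupp.sum_add_index']
    · rfl
    · simp
    · intros; ring
  | C_mul_T n a =>
    rw [eval₂_C_mul_T, lev, ← single_eq_C_mul_T, AddMonoidAlgebra.coeff_single,
      Finsupp.sum_single_index (by simp)]
    simp

section Lev

variable {z : F}

lemma lev_add (hz : z ≠ 0) (f g : F[T;T⁻¹]) : lev (f + g) z = lev f z + lev g z := by simp [lev_eq_eval₂ _ hz]

lemma lev_sub (hz : z ≠ 0) (f g : F[T;T⁻¹]) : lev (f - g) z = lev f z - lev g z := by simp [lev_eq_eval₂ _ hz]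

lemma lev_mul (hz : z ≠ 0) (f g : F[T;T⁻¹]) : lev (f * g) z = lev f z * lev g z := by simp [lev_eq_eval₂ _ hz]

lemma lev_sum {ι : Type*} (hz : z ≠ 0) (J : Finset ι) (f : ι → F[T;T⁻¹]) :
    lev (∑ i ∈ J, f i) z = ∑ i ∈ J, lev (f i) z := by simp [lev_eq_eval₂ _ hz]

lemma lev_C (hz : z ≠ 0) (c : F) : lev (C c) z = c := by simp [lev_eq_eval₂ _ hz]

lemma lev_T (hz : z ≠ 0) (n : ℤ) : lev (T n) z = z ^ n := by simp [lev_eq_eval₂ _ hz]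

lemma lev_toLaurent (hz : z ≠ 0) (g : Polynomial F) : lev (Polynomial.toLaurent g) z = g.eval z := by
  rw [lev_eq_eval₂ _ hz, eval₂_toLaurent]
  rfl

lemma lev_shift (hz : z ≠ 0) (d : ℕ) (g : Polynomial F) : lev (shift d g) z = z ^ (-(d : ℤ)) * g.eval z := by
  rw [shift, lev_mul hz, lev_T hz, lev_toLaurent hz]

end Lev

lemma lquot_eq {f g q : F[T;T⁻¹]} (hg : g ≠ 0) (h : f = g * q) : lquot f g = q := by
  have hd : g ∣ f := ⟨q, h⟩
  rw [lquot, dif_pos hd]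
  exact mul_left_cancel₀ hg (hd.choose_spec.symm.trans h)

lemma vanish_monic (S : Finset F) : (vanish S).Monic :=
  Polynomial.monic_prod_of_monic _ _ fun z _ => Polynomial.monic_X_sub_C z

lemma natDegree_vanish (S : Finset F) : (vanish S).natDegree = S.card := by
  rw [vanish, Polynomial.natDegree_prod_of_monic _ _ fun z _ => Polynomial.monic_X_sub_C z]
  simp

lemma toLaurent_vanish_ne_zero (S : Finset F) : Polynomial.toLaurent (vanish S) ≠ 0 :=
  Polynomial.toLaurent_ne_zero.2 (vanish_monic S).ne_zero

lemma eval_vanish (S : Finset F) (x : F) : (vanish S).eval x = ∏ z ∈ S, (x - z) := by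
  simp [vanish, Polynomial.eval_prod]

lemma eval_vanish_of_mem {S : Finset F} {x : F} (h : x ∈ S) : (vanish S).eval x = 0 := by
  rw [eval_vanish]
  exact Finset.prod_eq_zero h (sub_self x)

lemma eval_vanish_ne_zero {S : Finset F} {x : F} (h : x ∉ S) : (vanish S).eval x ≠ 0 := by
  rw [eval_vanish]
  refine Finset.prod_ne_zero_iff.2 fun z hz h0 => h ?_
  rwa [sub_eq_zero.1 h0]

lemma vanish_insert [DecidableEq F] {S : Finset F} {z : F} (hz : z ∉ S) :
    vanish (insert z S) = (Polynomial.X - Polynomial.C z) * vanish S :=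
  Finset.prod_insert hz

lemma vanish_sdiff_mul [DecidableEq F] {S S' : Finset F} (h : S' ⊆ S) :
    vanish (S \ S') * vanish S' = vanish S :=
  Finset.prod_sdiff h

lemma linear_ne_zero (z : F) : (T 1 - C z : F[T;T⁻¹]) ≠ 0 := by
  rw [← Polynomial.toLaurent_X, ← Polynomial.toLaurent_C, ← map_sub]
  exact Polynomial.toLaurent_ne_zero.2 (Polynomial.X_sub_C_ne_zero z)

/-- Division by a linear factor does not leave the window. -/
lemma exists_linear_mul {d : ℕ} {g : Polynomial F} (hg : g.natDegree ≤ 2 * d) {z : F}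
    (hz : g.eval z = 0) : ∃ q ∈ win F d, shift d g = (T 1 - C z) * q := by
  obtain ⟨g', rfl⟩ := Polynomial.dvd_iff_isRoot.2 hz
  refine ⟨shift d g', shift_mem_win ?_, ?_⟩
  · rcases eq_or_ne g' 0 with rfl | h0
    · simp
    · rw [Polynomial.natDegree_mul (Polynomial.X_sub_C_ne_zero z) h0] at hg
      omega
  · rw [shift_mul, map_sub, Polynomial.toLaurent_X, Polynomial.toLaurent_C]

lemma exists_linear_mul_of_lev {d : ℕ} {f : F[T;T⁻¹]} (hf : f ∈ win F d) {z : F} (hz0 : z ≠ 0)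
    (hz : lev f z = 0) : ∃ q ∈ win F d, f = (T 1 - C z) * q := by
  obtain ⟨g, hg, rfl⟩ := exists_shift hf
  rw [lev_shift hz0] at hz
  exact exists_linear_mul hg ((mul_eq_zero.1 hz).resolve_left (zpow_ne_zero _ hz0))

lemma coeff_linear_mul (z : F) (q : F[T;T⁻¹]) (i : ℤ) :
    ((T 1 - C z) * q).coeff (i + 1) = q.coeff i - z * q.coeff (i + 1) := by
  rw [sub_mul, AddMonoidAlgebra.coeff_sub, Finsupp.sub_apply, coeff_T_mul, ← smul_eq_C_mul]
  simp

end Laurent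

/-! ### The honest prover -/

section Honest

open LaurentPolynomial

variable {B : BilinearGroup} {K d : ℕ}

/-- The quotient `(f - γ) / Z_S`, where `γ` interpolates `f` on `S`. -/
def quo (f : B.F[T;T⁻¹]) (S : Finset B.F) : B.F[T;T⁻¹] :=
  lquot (f - Polynomial.toLaurent (interp f S)) (Polynomial.toLaurent (vanish S))

lemma eval_interp (f : B.F[T;T⁻¹]) {S : Finset B.F} {z : B.F} (hz : z ∈ S) :
    (interp f S).eval z = lev f z :=
  Lagrange.eval_interpolate_at_node (v := id) _ (Set.injOn_id _) hz

lemma interp_empty (f : B.F[T;T⁻¹]) : interp f ∅ = 0 := by simp [interp]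

/-- Newton interpolation: a new point `z` adds `q(z) Z_S` to the interpolation polynomial, where `q`
is the current quotient. The remainder `Z_S (q - q(z))` then acquires the factor `X - z`. -/
lemma interp_insert {f q q' : B.F[T;T⁻¹]} {S : Finset B.F} {z : B.F} (hz0 : z ≠ 0) (hz : z ∉ S)
    (hq : f = Polynomial.toLaurent (interp f S) + Polynomial.toLaurent (vanish S) * q)
    (hq' : q - C (lev q z) = (T 1 - C z) * q') :
    f = Polynomial.toLaurent (interp f (insert z S)) +
      Polynomial.toLaurent (vanish (insert z S)) * q' := by
  have hI : interp f S + Polynomial.C (lev q z) * vanish S = interp f (insert z S) := by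
    refine Lagrange.eq_interpolate_of_eval_eq (v := id) _ (Set.injOn_id _) ?_ fun y hy => ?_
    · rw [Finset.card_insert_of_notMem hz]
      refine lt_of_le_of_lt (Polynomial.degree_add_le _ _) (max_lt ?_ ?_)
      · refine (Lagrange.degree_interpolate_lt (v := id) _ (Set.injOn_id _)).trans ?_
        exact_mod_cast Nat.lt_succ_self _
      · rw [← Polynomial.smul_eq_C_mul]
        refine lt_of_le_of_lt (Polynomial.degree_smul_le _ _) ?_
        rw [Polynomial.degree_eq_natDegree (vanish_monic S).ne_zero, natDegree_vanish]
        exact_mod_cast Nat.lt_succ_self _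
    · simp only [id, Polynomial.eval_add, Polynomial.eval_mul, Polynomial.eval_C]
      rcases Finset.mem_insert.1 hy with rfl | hy
      · conv_rhs => rw [hq]
        rw [lev_add hz0, lev_mul hz0, lev_toLaurent hz0, lev_toLaurent hz0]
        ring
      · rw [eval_interp f hy, eval_vanish_of_mem hy, mul_zero, add_zero]
  rw [← hI, vanish_insert hz, map_add, map_mul, map_mul, map_sub, Polynomial.toLaurent_X,
    Polynomial.toLaurent_C, Polynomial.toLaurent_C]
  conv_lhs => rw [hq]
  linear_combination Polynomial.toLaurent (vanish S) * hq'

lemma quo_eq {f q : B.F[T;T⁻¹]} {S : Finset B.F}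
    (h : f = Polynomial.toLaurent (interp f S) + Polynomial.toLaurent (vanish S) * q) :
    quo f S = q :=
  lquot_eq (toLaurent_vanish_ne_zero S) (by rw [sub_eq_iff_eq_add']; exact h)

/-- The points are divided out one at a time. Each time a Laurent polynomial in the window that
vanishes at a non-zero `z` is divided by `X - z`, and this stays in the window. The size of `S`
therefore does not matter. -/
lemma quo_spec {f : B.F[T;T⁻¹]} (hf : f ∈ win B.F d) {S : Finset B.F} (hS : (0 : B.F) ∉ S) :
    f = Polynomial.toLaurent (interp f S) + Polynomial.toLaurent (vanish S) * quo f S ∧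
      quo f S ∈ win B.F d := by
  suffices h : ∃ q ∈ win B.F d,
      f = Polynomial.toLaurent (interp f S) + Polynomial.toLaurent (vanish S) * q by
    obtain ⟨q, hq, h⟩ := h
    rw [quo_eq h]
    exact ⟨h, hq⟩
  induction S using Finset.induction_on with
  | empty => exact ⟨f, hf, by simp [interp_empty, vanish]⟩
  | insert z S hz ih =>
    simp only [Finset.mem_insert, not_or] at hS
    obtain ⟨q, hq, h⟩ := ih hS.2
    have hz0 : z ≠ 0 := Ne.symm hS.1
    obtain ⟨q', hq', h'⟩ := exists_linear_mul_of_lev (Submodule.sub_mem _ hq (C_mem_win d (lev q z)))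
      hz0 (by rw [lev_sub hz0, lev_C hz0, sub_self])
    exact ⟨q', hq', interp_insert hz0 hz h h'⟩

/-- One more point: the quotient is divided once more, after subtraction of its value. -/
lemma quo_insert {f : B.F[T;T⁻¹]} (hf : f ∈ win B.F d) {S : Finset B.F} {z : B.F}
    (hS : (0 : B.F) ∉ insert z S) (hz : z ∉ S) :
    quo f S - C (lev (quo f S) z) = (T 1 - C z) * quo f (insert z S) := by
  simp only [Finset.mem_insert, not_or] at hS
  have hz0 : z ≠ 0 := Ne.symm hS.1
  obtain ⟨h, hq⟩ := quo_spec hf hS.2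
  obtain ⟨q', -, h'⟩ := exists_linear_mul_of_lev
    (Submodule.sub_mem _ hq (C_mem_win d (lev (quo f S) z)))
      hz0 (by rw [lev_sub hz0, lev_C hz0, sub_self])
  rw [quo_eq (interp_insert hz0 hz h h'), h']

variable {S : Finset B.F} {Si : Fin K → Finset B.F} {f : Fin K → B.F[T;T⁻¹]}

/-- The polynomials `γᵢ` of an honest opening. -/
abbrev gams (f : Fin K → B.F[T;T⁻¹]) (Si : Fin K → Finset B.F) (i : Fin K) : Polynomial B.F :=
  interp (f i) (Si i)

/-- The factor `Z_{S \ Sᵢ}` completes `Z_{Sᵢ}` to `Z_S`, so that division by `Z_S` amounts to taking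
the individual quotients. -/
lemma fhat_eq (hf : ∀ i, f i ∈ win B.F d) (hS : (0 : B.F) ∉ S) (hSi : ∀ i, Si i ⊆ S) (β : B.F) :
    fhat S Si f (gams f Si) β =
      Polynomial.toLaurent (vanish S) * ∑ i : Fin K, C (β ^ (i : ℕ)) * quo (f i) (Si i) := by
  rw [fhat, Finset.mul_sum]
  refine Finset.sum_congr rfl fun i _ => ?_
  obtain ⟨h, -⟩ := quo_spec (hf i) (fun h => hS (hSi i h))
  rw [← vanish_sdiff_mul (hSi i), map_mul, sub_eq_iff_eq_add'.2 h]
  ring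

lemma pPoly_eq (hf : ∀ i, f i ∈ win B.F d) (hS : (0 : B.F) ∉ S) (hSi : ∀ i, Si i ⊆ S) (β : B.F) :
    pPoly S Si f (gams f Si) β = ∑ i : Fin K, C (β ^ (i : ℕ)) * quo (f i) (Si i) :=
  lquot_eq (toLaurent_vanish_ne_zero S) (fhat_eq hf hS hSi β)

lemma pPoly_mem (hf : ∀ i, f i ∈ win B.F d) (hS : (0 : B.F) ∉ S) (hSi : ∀ i, Si i ⊆ S) (β : B.F) :
    pPoly S Si f (gams f Si) β ∈ win B.F d := by
  rw [pPoly_eq hf hS hSi]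
  exact Submodule.sum_mem _ fun i _ =>
    C_mul_mem_win _ (quo_spec (hf i) fun h => hS (hSi i h)).2

/-- The numerator of `w`. -/
def ellPoly (S : Finset B.F) (Si : Fin K → Finset B.F) (f : Fin K → B.F[T;T⁻¹]) (β μ : B.F) :
    B.F[T;T⁻¹] :=
  ∑ i, C (Psi S Si β μ i) * (f i - C ((gams f Si i).eval μ))
      - C ((vanish S).eval μ) * pPoly S Si f (gams f Si) β

lemma ellPoly_mem (hf : ∀ i, f i ∈ win B.F d) (hS : (0 : B.F) ∉ S) (hSi : ∀ i, Si i ⊆ S)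
    (β μ : B.F) : ellPoly S Si f β μ ∈ win B.F d :=
  Submodule.sub_mem _ (Submodule.sum_mem _ fun i _ => C_mul_mem_win _
    (Submodule.sub_mem _ (hf i) (C_mem_win d _))) (C_mul_mem_win _ (pPoly_mem hf hS hSi β))

/-- At `X = μ` the numerator becomes `f̂(μ) - Z_S(μ) q(μ) = 0`. Since `μ = 0` is allowed, Laurent
polynomials cannot be evaluated there, and the argument is made after multiplication by `X ^ d`. -/
lemma wPoly_spec (hf : ∀ i, f i ∈ win B.F d) (hS : (0 : B.F) ∉ S) (hSi : ∀ i, Si i ⊆ S)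
    (β μ : B.F) :
    ellPoly S Si f β μ = (T 1 - C μ) * wPoly S Si f (gams f Si) β μ ∧
      wPoly S Si f (gams f Si) β μ ∈ win B.F d := by
  suffices h : ∃ q ∈ win B.F d, ellPoly S Si f β μ = (T 1 - C μ) * q by
    obtain ⟨q, hq, h⟩ := h
    have : wPoly S Si f (gams f Si) β μ = q := lquot_eq (linear_ne_zero μ) h
    rw [this]
    exact ⟨h, hq⟩
  choose g hg hgf using fun i => exists_shift (hf i)
  obtain ⟨r, hr, hrp⟩ := exists_shift (pPoly_mem hf hS hSi β)
  have h1 : vanish S * r = ∑ i : Fin K, Polynomial.C (β ^ (i : ℕ)) * (vanish (S \ Si i) *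
      (g i - Polynomial.X ^ d * gams f Si i)) := by
    apply shift_injective d
    rw [shift_mul, hrp, pPoly_eq hf hS hSi, ← fhat_eq hf hS hSi, fhat, shift_sum]
    refine Finset.sum_congr rfl fun i _ => ?_
    rw [shift_C_mul, shift_mul, shift_sub, hgf, shift_X_pow_mul]
    ring
  obtain ⟨e, he, heq⟩ := exists_shift (ellPoly_mem hf hS hSi β μ)
  have h2 : e = ∑ i, Polynomial.C (Psi S Si β μ i) *
      (g i - Polynomial.X ^ d * Polynomial.C ((gams f Si i).eval μ))
        - Polynomial.C ((vanish S).eval μ) * r := by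
    apply shift_injective d
    rw [heq, shift_sub, shift_sum, shift_C_mul, hrp, ellPoly]
    congr 1
    refine Finset.sum_congr rfl fun i _ => ?_
    rw [shift_C_mul, shift_sub, hgf, shift_X_pow_mul, Polynomial.toLaurent_C]
  have h3 : e.eval μ = 0 := by
    have h4 := congrArg (Polynomial.eval μ) h1
    rw [Polynomial.eval_mul, Polynomial.eval_finsetSum] at h4
    rw [h2, Polynomial.eval_sub, Polynomial.eval_mul, Polynomial.eval_C, h4,
      Polynomial.eval_finsetSum, sub_eq_zero]
    refine Finset.sum_congr rfl fun i _ => ?_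
    simp [Psi]
    ring
  rw [← heq]
  exact exists_linear_mul he h3

lemma expo_setup (s : Secrets B) {q : B.F[T;T⁻¹]} (hq : q ∈ win B.F d) :
    expo d (setup B d s) q = lev q (s.2.2.2 : B.F) • (s.1 : B.G₁) := by
  rw [expo, lev_eq_sum hq, Finset.sum_smul]
  refine Finset.sum_congr rfl fun i hi => ?_
  simp only [setup, if_pos hi]
  rw [smul_smul]

lemma commit_setup (s : Secrets B) {f : B.F[T;T⁻¹]} (hf : ∀ i, i ∉ nzExps d → f.coeff i = 0) :
    commit d (setup B d s) f = ((s.2.2.1 : B.F) * lev f (s.2.2.2 : B.F)) • (s.1 : B.G₁) := by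
  rw [commit, lev_eq_sum hf, Finset.mul_sum, Finset.sum_smul]
  refine Finset.sum_congr rfl fun i hi => ?_
  simp only [setup, if_pos hi]
  rw [smul_smul]
  congr 1
  ring

lemma mem_win_of_nz {f : B.F[T;T⁻¹]} (hf : ∀ i, i ∉ nzExps d → f.coeff i = 0) : f ∈ win B.F d :=
  fun i hi => hf i fun h => hi (Finset.mem_of_mem_erase h)

theorem correct (B : BilinearGroup) (d K : ℕ) : Correct B d K := by
  intro s f S Si β μ hf hS hSi
  refine ⟨fun i z hz => eval_interp (f i) hz, ?_⟩
  have hf' : ∀ i j, j ∉ nzExps d → (f i).coeff j = 0 := fun i j hj =>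
    Finsupp.notMem_support_iff.1 fun h => hj (hf i h)
  have hfw : ∀ i, f i ∈ win B.F d := fun i => mem_win_of_nz (hf' i)
  obtain ⟨hw, hwm⟩ := wPoly_spec hfw hS hSi β μ
  have hx0 : (s.2.2.2 : B.F) ≠ 0 := s.2.2.2.2.1
  have hlev := congrArg (fun q => lev q (s.2.2.2 : B.F)) hw
  simp only [ellPoly, lev_sub hx0, lev_mul hx0, lev_sum hx0, lev_C hx0, lev_T hx0, zpow_one] at hlev
  have h0 : (0 : ℤ) ∈ exps d := by simp [exps]
  simp only [BatchVerify, open₁, open₂, expo_setup s (pPoly_mem hfw hS hSi β), expo_setup s hwm,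
    fun i => commit_setup s (hf' i)]
  simp only [setup, if_pos h0, zpow_zero, one_smul, smul_smul, ← Finset.sum_smul, ← sub_smul,
    map_smul, LinearMap.smul_apply, ← add_smul]
  congr 1
  have h1 : ∑ i, Psi S Si β μ i * (lev (f i) (s.2.2.2 : B.F) - (gams f Si i).eval μ) =
      ∑ i, Psi S Si β μ i * lev (f i) (s.2.2.2 : B.F) -
        ∑ i, (gams f Si i).eval μ * Psi S Si β μ i := by
    rw [← Finset.sum_sub_distrib]
    exact Finset.sum_congr rfl fun i _ => by ring
  have h2 : ∑ i, Psi S Si β μ i * ((s.2.2.1 : B.F) * lev (f i) (s.2.2.2 : B.F)) =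
      (s.2.2.1 : B.F) * ∑ i, Psi S Si β μ i * lev (f i) (s.2.2.2 : B.F) := by
    rw [Finset.mul_sum]
    exact Finset.sum_congr rfl fun i _ => by ring
  rw [h1] at hlev
  rw [h2]
  -- Compared as multiples of `e(g, h)`, the two sides of the check differ by `-α` times the
  -- identity for `w` at `x`.
  linear_combination -(s.2.2.1 : B.F) * hlev

end Honest

/-! ### Sets of points that depend on the random choices -/

section DynamicSets

variable {B : BilinearGroup} {Ω : Type} {S S' : Set (Ω → Val B)} {n a b c : ℕ}
  {pts : ℕ → Ω → B.F} {T : Ω → Finset B.F}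

/-- A set that consists of some of the available scalars `pts 0, …, pts (n - 1)`, membership in which
can be decided. -/
structure DynSet (S : Set (Ω → Val B)) (n c : ℕ) (pts : ℕ → Ω → B.F) (T : Ω → Finset B.F) :
    Prop where
  pt : ∀ k < n, Der S c (sc (pts k))
  mem : ∀ k < n, Der S c (sc fun ω => ind (pts k ω ∈ T ω))
  cover : ∀ ω, ∀ z ∈ T ω, ∃ k < n, pts k ω = z

lemma DynSet.weaken (h : DynSet S n c pts T) (hS : S ⊆ S') : DynSet S' n c pts T :=
  ⟨fun k hk => (h.pt k hk).weaken hS, fun k hk => (h.mem k hk).weaken hS, h.cover⟩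

/-- The cost of deciding whether a point occurs for the first time in an enumeration. -/
def freshCost (n c : ℕ) : ℕ := c + (n * (2 * c + 6) + 1) + 1

lemma DynSet.fresh (h : DynSet S n c pts T) {k : ℕ} (hk : k < n) :
    Der S (freshCost n c)
      (sc fun ω => ind (pts k ω ∈ T ω ∧ ∀ i ∈ Finset.range k, ¬ pts i ω = pts k ω)) := by
  refine ((h.mem k hk).and (Der.forall (a := 2 * c + 5) (Finset.range k) fun i hi => ?_)).le ?_
  · refine (((h.pt i ?_).eq (h.pt k hk)).not).le (by omega)
    exact (Finset.mem_range.1 hi).trans hk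
  · have := Nat.mul_le_mul_right (2 * c + 6) hk.le
    rw [Finset.card_range, show 2 * c + 5 + 1 = 2 * c + 6 from rfl]
    unfold freshCost
    omega

/-- Computing a function of a set by adding its points one by one. The scalars are held by the
memory in the form `emb`, e.g. as exponents of a group element. -/
lemma DynSet.fold (h : DynSet S n c pts T) {ι : Type*} (J : Finset ι) (emb : Ω → B.F → Val B)
    (hemb : ∀ {S : Set (Ω → Val B)} {n a b : ℕ} {p : Ω → Prop} {u v : Ω → B.F},
      Der S n (sc fun ω => ind (p ω)) → Der S a (fun ω => emb ω (u ω)) →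
      Der S b (fun ω => emb ω (v ω)) →
      Der S (2 * n + a + b + 4) (fun ω => emb ω (ind (p ω) * u ω + ind (¬ p ω) * v ω)))
    (φ : Ω → Finset B.F → ι → B.F) (upd : Ω → B.F → (ι → B.F) → ι → B.F)
    (hupd : ∀ ω U z, U ⊆ T ω → z ∈ T ω → z ∉ U → ∀ i ∈ J,
      φ ω (insert z U) i = upd ω z (φ ω U) i)
    (hder : ∀ k < n, ∀ U : Ω → Finset B.F, ∀ i ∈ J,
      Der (S ∪ (fun i ω => emb ω (φ ω (U ω) i)) '' J) b
        (fun ω => emb ω (upd ω (pts k ω) (φ ω (U ω)) i))) :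
    Derives (S ∪ (fun i ω => emb ω (φ ω ∅ i)) '' J) (n * (J.card * (2 * freshCost n c + b + 4)))
      ((fun i ω => emb ω (φ ω (T ω) i)) '' J) := by
  classical
  -- `U k` collects the points of `T ω` among the first `k` listed ones. It grows only at first
  -- occurrences of members, so repetitions in the list are harmless and `hupd` is applied to new
  -- points only.
  set U : ℕ → Ω → Finset B.F := fun k ω => (T ω).filter fun z => ∃ i < k, pts i ω = z with hU
  have h0 : U 0 = fun _ => ∅ := by
    funext ω
    simp [hU]
  have hn : U n = T := by
    funext ω
    simp only [hU]
    exact Finset.filter_true_of_mem fun z hz => h.cover ω z hz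
  have hstep : ∀ k ω, U (k + 1) ω =
      if pts k ω ∈ T ω ∧ ∀ i ∈ Finset.range k, ¬ pts i ω = pts k ω
        then insert (pts k ω) (U k ω) else U k ω := by
    intro k ω
    ext z
    split_ifs with hc
    · simp only [hU, Finset.mem_filter, Finset.mem_insert, Nat.lt_succ_iff_lt_or_eq]
      constructor
      · rintro ⟨hz, i, hi | rfl, rfl⟩
        · exact .inr ⟨hz, i, hi, rfl⟩
        · exact .inl rfl
      · rintro (rfl | ⟨hz, i, hi, rfl⟩)
        · exact ⟨hc.1, k, .inr rfl, rfl⟩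
        · exact ⟨hz, i, .inl hi, rfl⟩
    · simp only [hU, Finset.mem_filter, Nat.lt_succ_iff_lt_or_eq]
      constructor
      · rintro ⟨hz, i, hi | rfl, rfl⟩
        · exact ⟨hz, i, hi, rfl⟩
        · simp only [not_and, not_forall, not_not] at hc
          obtain ⟨j, hj, hj'⟩ := hc hz
          exact ⟨hz, j, Finset.mem_range.1 hj, hj'⟩
      · rintro ⟨hz, i, hi, rfl⟩
        exact ⟨hz, i, .inl hi, rfl⟩
  have hit := Derives.iterate (S := S) (a := J.card * (2 * freshCost n c + b + 4))
    (fun k => (fun i ω => emb ω (φ ω (U k ω) i)) '' J) n (by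
      intro k hk
      refine Derives.family J fun i hi => ?_
      refine ((hemb ((h.weaken Set.subset_union_left).fresh hk) (hder k hk (U k) i hi)
        (Der.of_mem (.inr ⟨i, hi, rfl⟩))).congr fun ω => ?_).le (by omega)
      rw [hstep]
      split_ifs with hc
      · rw [ind_true hc, ind_false (not_not.2 hc), one_mul, zero_mul, add_zero,
          hupd ω (U k ω) (pts k ω) (Finset.filter_subset _ _) hc.1 _ i hi]
        simp only [hU, Finset.mem_filter, not_and, not_exists]
        intro _ j hj
        exact hc.2 j (Finset.mem_range.2 hj)
      · rw [ind_false hc, ind_true hc, one_mul, zero_mul, zero_add])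
  rw [h0, hn] at hit
  exact hit

/-- The cost of evaluating a vanishing polynomial. -/
def vanishCost (n c : ℕ) : ℕ := 1 + n * (2 * freshCost n c + (2 * c + 8))

lemma DynSet.evalVanish (h : DynSet S n c pts T) {μ : Ω → B.F} (hμ : Der S c (sc μ)) :
    Der S (vanishCost n c) (sc fun ω => (vanish (T ω)).eval (μ ω)) := by
  have h1 := h.fold (Finset.univ : Finset Unit) (fun _ a => .scalar a)
    (fun hp h h' => ((hp.mul h).add (hp.not.mul h')).le (by omega))
    (fun ω U _ => ∏ z ∈ U, (μ ω - z))
    (fun ω z st i => (μ ω - z) * st i) (b := 2 * c + 4)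
    (fun ω U z _ _ hz _ _ => Finset.prod_insert hz) (by
      intro k hk U i hi
      exact ((Der.sub' (hμ.weaken Set.subset_union_left) ((h.pt k hk).weaken
        Set.subset_union_left)).mul (Der.of_mem (.inr
          (mem_scs (f := fun (_ : Unit) ω => ∏ z ∈ U ω, (μ ω - z)) hi)))).le (by omega))
  have h0 : Derives S 1 (scs (Finset.univ : Finset Unit) fun _ (ω : Ω) =>
      ∏ z ∈ (∅ : Finset B.F), (μ ω - z)) :=
    (Derives.scs Finset.univ fun _ _ => (Der.sconst 1).congr fun ω => by simp [sc]).le (by simp)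
  refine (((h0.trans h1).get (mem_scs (f := fun (_ : Unit) ω => ∏ z ∈ T ω, (μ ω - z))
    (Finset.mem_univ ()))).congr fun ω => ?_).le ?_
  · simp only [sc, eval_vanish]
  · simp only [vanishCost, Finset.card_univ, Fintype.card_unit]
    ring_nf
    omega

end DynamicSets

/-! ### Reading a symbolic memory -/

section Reading

variable {B : BilinearGroup} {Ω : Type} {S : Set (Ω → Val B)} {K n : ℕ}

lemma Der.cell {l : List (Ω → Val B)} (hl : ∀ v ∈ l, v ∈ S) (h0 : zeroVal ∈ S) (i : ℕ) :
    Der S 0 (fun ω => Mem.cell (l.map (· ω)) i) := by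
  rw [show (fun ω => Mem.cell (l.map (· ω)) i) = l.getD i zeroVal from funext fun ω => cell_map l i ω]
  refine Der.of_mem ?_
  by_cases h : i < l.length
  · simpa [List.getD, h] using hl _ (List.getElem_mem h)
  · simpa [List.getD, h] using h0

lemma Der.fld {l : List (Ω → Val B)} (hl : ∀ v ∈ l, v ∈ S) (h0 : zeroVal ∈ S) (i : ℕ) :
    Der S 2 (sc fun ω => Mem.fld (l.map (· ω)) i) :=
  (Der.cell hl h0 i).toScalar

/-- An enumeration of points by natural numbers. -/
def ptsOf {F : Type} [Zero F] (m : Ω → Fin n → F) (k : ℕ) (ω : Ω) : F :=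
  if h : k < n then m ω ⟨k, h⟩ else 0

/-- The cost of deciding membership in the sets chosen by an adversary. -/
def memCost (n : ℕ) : ℕ := 15 * n + 4

/-- The adversary may list a point several times, and a flag on any copy puts it into `Sᵢ`;
membership is thus a disjunction over all indices. -/
lemma dynSet_readSi {l : List (Ω → Val B)} (hl : ∀ v ∈ l, v ∈ S) (h0 : zeroVal ∈ S)
    (pt : Fin n → ℕ) (flag : Fin K → Fin n → ℕ) (i : Fin K) :
    DynSet S n (memCost n) (ptsOf fun ω k => Mem.fld (l.map (· ω)) (pt k))
      (fun ω => readSi (l.map (· ω)) pt flag i) where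
  pt k hk := by
    refine ((Der.fld hl h0 (pt ⟨k, hk⟩)).congr fun ω => ?_).le (by unfold memCost; omega)
    simp [sc, ptsOf, hk]
  mem k hk := by
    have := Der.exists (Finset.univ : Finset (Fin n)) fun j _ =>
      ((Der.fld hl h0 (flag i j)).eqZero.not).and
        ((Der.fld hl h0 (pt j)).eq (Der.fld hl h0 (pt ⟨k, hk⟩)))
    refine (this.congr fun ω => ?_).le (by simp [memCost]; omega)
    simp [sc, ptsOf, hk, readSi]
  cover ω z hz := by
    simp only [readSi, Finset.mem_image] at hz
    obtain ⟨k, -, rfl⟩ := hz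
    exact ⟨k, k.2, by simp [ptsOf]⟩

lemma dynSet_readS {l : List (Ω → Val B)} (hl : ∀ v ∈ l, v ∈ S) (h0 : zeroVal ∈ S)
    (pt : Fin n → ℕ) :
    DynSet S n (memCost n) (ptsOf fun ω k => Mem.fld (l.map (· ω)) (pt k))
      (fun ω => readS (l.map (· ω)) pt) where
  pt k hk := by
    refine ((Der.fld hl h0 (pt ⟨k, hk⟩)).congr fun ω => ?_).le (by unfold memCost; omega)
    simp [sc, ptsOf, hk]
  mem k hk := by
    refine ((Der.sconst 1).congr fun ω => ?_).le (by unfold memCost; omega)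
    simp only [sc]
    rw [ind_true]
    simp [ptsOf, hk, readS]
  cover ω z hz := by
    simp only [readS, Finset.mem_image] at hz
    obtain ⟨k, -, rfl⟩ := hz
    exact ⟨k, k.2, by simp [ptsOf]⟩

lemma dynSet_sdiff {l : List (Ω → Val B)} (hl : ∀ v ∈ l, v ∈ S) (h0 : zeroVal ∈ S)
    (pt : Fin n → ℕ) (flag : Fin K → Fin n → ℕ) (i : Fin K) :
    DynSet S n (memCost n + 1) (ptsOf fun ω k => Mem.fld (l.map (· ω)) (pt k))
      (fun ω => readS (l.map (· ω)) pt \ readSi (l.map (· ω)) pt flag i) where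
  pt k hk := ((dynSet_readS hl h0 pt).pt k hk).le (by omega)
  mem k hk := by
    refine ((dynSet_readSi hl h0 pt flag i).mem k hk).not.congr fun ω => ?_
    simp only [sc]
    congr 2
    simp [ptsOf, hk, readS]
  cover ω z hz := (dynSet_readS hl h0 pt).cover ω z (Finset.mem_sdiff.1 hz).1

lemma readSi_subset (m : Mem B) (pt : Fin n → ℕ) (flag : Fin K → Fin n → ℕ) (i : Fin K) :
    readSi m pt flag i ⊆ readS m pt :=
  Finset.image_subset_image (Finset.filter_subset _ _)

lemma card_readS_le (m : Mem B) (pt : Fin n → ℕ) : (readS m pt).card ≤ n :=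
  Finset.card_image_le.trans (by simp)

/-- The cost of computing `Ψᵢ[μ]`. -/
def psiCost (K n : ℕ) : ℕ := 3 * K + vanishCost n (memCost n + 1) + 2

lemma Der.psi {l : List (Ω → Val B)} (hl : ∀ v ∈ l, v ∈ S) (h0 : zeroVal ∈ S)
    (pt : Fin n → ℕ) (flag : Fin K → Fin n → ℕ) {β μ : Ω → B.F} (hβ : Der S 2 (sc β))
    (hμ : Der S 2 (sc μ)) (i : Fin K) :
    Der S (psiCost K n) (sc fun ω =>
      Psi (readS (l.map (· ω)) pt) (readSi (l.map (· ω)) pt flag) (β ω) (μ ω) i) := by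
  refine ((hβ.pow i).mul ((dynSet_sdiff hl h0 pt flag i).evalVanish
    (hμ.le (by unfold memCost; omega)))).le ?_
  have := i.2
  unfold psiCost
  omega

end Reading

/-! ### Counting -/

section Counting

lemma prob_nonneg (Ω : Type) (P : Ω → Prop) : 0 ≤ prob Ω P := by unfold prob; positivity

lemma prob_of_isEmpty (Ω : Type) [IsEmpty Ω] (P : Ω → Prop) : prob Ω P = 0 := by simp [prob]

lemma prob_mono {Ω : Type} [Finite Ω] {P Q : Ω → Prop} (h : ∀ ω, P ω → Q ω) :
    prob Ω P ≤ prob Ω Q := by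
  unfold prob
  gcongr
  exact Nat.card_le_card_of_injective (Subtype.map id h) (Subtype.map_injective h Function.injective_id)

lemma prob_or_le {Ω : Type} [Finite Ω] (P Q : Ω → Prop) :
    prob Ω (fun ω => P ω ∨ Q ω) ≤ prob Ω P + prob Ω Q := by
  unfold prob
  rw [← add_div]
  gcongr
  norm_cast
  have := Set.ncard_union_le {ω | P ω} {ω | Q ω}
  exact this

lemma prob_exists_le {Ω ι : Type} [Finite Ω] [Fintype ι] (P : ι → Ω → Prop) :
    prob Ω (fun ω => ∃ i, P i ω) ≤ ∑ i, prob Ω (P i) := by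
  classical
  have h : ∀ J : Finset ι, prob Ω (fun ω => ∃ i ∈ J, P i ω) ≤ ∑ i ∈ J, prob Ω (P i) := by
    intro J
    induction J using Finset.induction_on with
    | empty => simp [prob]
    | insert i J hi ih =>
      rw [Finset.sum_insert hi]
      refine (prob_mono (fun ω h => ?_)).trans ((prob_or_le (P i) fun ω => ∃ i ∈ J, P i ω).trans
        (add_le_add_right ih _))
      simpa using h
  simpa using h Finset.univ

/-- An event is at most `c` times as likely as another one into which it embeds, together with
independent choices from `A`. -/
lemma prob_le_of_injective {Ω Ω' A : Type} [Finite Ω'] [Finite Ω] [Nonempty A] {P : Ω → Prop}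
    {P' : Ω' → Prop} {c : ℕ} (φ : {ω // P ω} × A → Ω') (hφ : Function.Injective φ)
    (hP : ∀ z, P' (φ z)) (hc : Nat.card Ω' ≤ c * (Nat.card Ω * Nat.card A)) :
    prob Ω P ≤ c * prob Ω' P' := by
  rcases isEmpty_or_nonempty Ω' with hΩ' | hΩ'
  · have : IsEmpty ({ω // P ω} × A) := Function.isEmpty φ
    rcases isEmpty_prod.1 this with h | h
    · have : prob Ω P = 0 := by simp [prob]
      rw [this]
      exact mul_nonneg (by positivity) (prob_nonneg _ _)
    · exact absurd h (not_isEmpty_of_nonempty A)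
  have h0 : 0 < Nat.card Ω' := Nat.card_pos
  have h1 : Nat.card {ω // P ω} * Nat.card A ≤ Nat.card {ω' // P' ω'} := by
    rw [← Nat.card_prod]
    exact Nat.card_le_card_of_injective (fun z => ⟨φ z, hP z⟩) fun z w h =>
      hφ (congrArg Subtype.val h)
  unfold prob
  have hΩ : 0 < Nat.card Ω := by
    rcases Nat.eq_zero_or_pos (Nat.card Ω) with h | h
    · rw [h] at hc; omega
    · exact h
  rw [mul_div_assoc', div_le_div_iff₀ (by exact_mod_cast hΩ) (by exact_mod_cast h0)]
  norm_cast
  calc Nat.card {ω // P ω} * Nat.card Ω'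
      ≤ Nat.card {ω // P ω} * (c * (Nat.card Ω * Nat.card A)) := Nat.mul_le_mul_left _ hc
    _ = c * (Nat.card {ω // P ω} * Nat.card A) * Nat.card Ω := by ring
    _ ≤ _ := by gcongr

end Counting

/-! ### Groups of prime order -/

section PrimeOrder

variable {p : ℕ} [Fact p.Prime] {G : Type} [AddCommGroup G] [Module (ZMod p) G]

lemma exists_smul_eq (hG : Nat.card G = p) {g : G} (hg : g ≠ 0) (u : G) : ∃ a : ZMod p, a • g = u := by
  have hp := (Fact.out : p.Prime).pos
  have : Finite G := Nat.finite_of_card_ne_zero (by omega)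
  have hinj : Function.Injective fun a : ZMod p => a • g := fun a b hab => by
    simp only at hab
    rw [← sub_eq_zero, ← sub_smul, smul_eq_zero] at hab
    exact sub_eq_zero.1 (hab.resolve_right hg)
  exact ((Nat.bijective_iff_injective_and_card _).2 ⟨hinj, by rw [hG, Nat.card_zmod]⟩).2 u

/-- Non-zero elements generate groups of prime order, so `e` would vanish everywhere if it vanished
on one pair of generators. This permits comparing exponents in the target group. -/
lemma pairing_ne_zero (B : BilinearGroup) {g : B.G₁} {h : B.G₂} (hg : g ≠ 0) (hh : h ≠ 0) :
    B.e g h ≠ 0 := by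
  intro h0
  apply B.e_ne_zero
  ext u v
  obtain ⟨a, rfl⟩ := exists_smul_eq B.card₁ hg u
  obtain ⟨b, rfl⟩ := exists_smul_eq B.card₂ hh v
  simp [h0]

instance (B : BilinearGroup) : Finite B.G₁ :=
  Nat.finite_of_card_ne_zero (by rw [B.card₁]; exact B.prime.out.ne_zero)

instance (B : BilinearGroup) : Finite B.G₂ :=
  Nat.finite_of_card_ne_zero (by rw [B.card₂]; exact B.prime.out.ne_zero)

/-- Injectivity of the representation bounds the number of bits of `p`, and with it the cost of
half-powers and the number of shifts in the root finder. -/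
lemma p_le_two_pow_len (B : BilinearGroup) : B.p ≤ 2 ^ B.len := by
  have := Nat.card_le_card_of_injective B.enc₁ B.enc₁_inj
  rw [B.card₁] at this
  simpa using this

lemma card_ne_zero_and_ne_one (B : BilinearGroup) :
    Nat.card {a : B.F // a ≠ 0 ∧ a ≠ 1} = B.p - 2 := by
  classical
  rw [Nat.card_eq_fintype_card, Fintype.card_subtype]
  have : (Finset.univ.filter fun a : B.F => a ≠ 0 ∧ a ≠ 1) = Finset.univ \ {0, 1} := by
    ext a
    simp
  rw [this, Finset.card_sdiff_of_subset (Finset.subset_univ _), Finset.card_univ, ZMod.card,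
    Finset.card_pair zero_ne_one]

lemma card_left_ne_zero (B : BilinearGroup) : Nat.card {g : B.G₁ // g ≠ 0} = B.p - 1 := by
  classical
  have := Fintype.ofFinite B.G₁
  have h := B.card₁
  rw [Nat.card_eq_fintype_card] at h ⊢
  rw [Fintype.card_subtype_compl, h]
  simp

lemma card_right_ne_zero (B : BilinearGroup) : Nat.card {g : B.G₂ // g ≠ 0} = B.p - 1 := by
  classical
  have := Fintype.ofFinite B.G₂
  have h := B.card₂
  rw [Nat.card_eq_fintype_card] at h ⊢
  rw [Fintype.card_subtype_compl, h]
  simp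

end PrimeOrder

/-! ### Symbolic inputs -/

section Inputs

variable {B : BilinearGroup} {Ω : Type} {S : Set (Ω → Val B)}

/-- The reference string as a symbolic memory. -/
def srsSym (d : ℕ) (srs : Ω → Srs B) : List (Ω → Val B) :=
  (expList d).map (fun i => lf fun ω => (srs ω).gx i) ++
  ((expList d).filter (fun i => i ≠ 0)).map (fun i => lf fun ω => (srs ω).gax i) ++
  [rt fun ω => (srs ω).h, rt fun ω => (srs ω).ha, rt fun ω => (srs ω).hax]

lemma srsSym_map (d : ℕ) (srs : Ω → Srs B) (ω : Ω) :
    (srsSym d srs).map (· ω) = srsCells d (srs ω) := by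
  simp [srsSym, srsCells, Function.comp_def, lf, rt]

/-- The coins as a symbolic memory. -/
def coinSym {r : ℕ} (c : Ω → Fin r → B.F) : List (Ω → Val B) :=
  List.ofFn fun k => sc fun ω => c ω k

lemma coinSym_map {r : ℕ} (c : Ω → Fin r → B.F) (ω : Ω) :
    (coinSym c).map (· ω) = coinCells (c ω) := by
  simp [coinSym, coinCells, Function.comp_def, sc]

lemma mem_coinSym {r : ℕ} {c : Ω → Fin r → B.F} (k : Fin r) :
    (sc fun ω => c ω k) ∈ coinSym c := by
  simp [coinSym]

lemma mem_expList {d : ℕ} {i : ℤ} : i ∈ expList d ↔ i ∈ exps d := by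
  simp only [expList, exps, List.mem_map, List.bind_eq_flatMap, List.mem_flatMap, List.pure_def,
    List.mem_singleton, List.mem_range, Finset.mem_Icc]
  constructor
  · rintro ⟨_, ⟨k, hk, rfl⟩, rfl⟩
    omega
  · rintro ⟨h1, h2⟩
    exact ⟨i + d, ⟨(i + d).toNat, by omega, by omega⟩, by omega⟩

lemma gx_mem_srsSym {d : ℕ} {srs : Ω → Srs B} {i : ℤ} (hi : i ∈ exps d) :
    (lf fun ω => (srs ω).gx i) ∈ srsSym d srs := by
  have := mem_expList.2 hi
  simp only [srsSym, List.mem_append, List.mem_map]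
  exact .inl (.inl ⟨i, this, rfl⟩)

lemma right_mem_srsSym {d : ℕ} {srs : Ω → Srs B} :
    (rt fun ω => (srs ω).h) ∈ srsSym d srs ∧ (rt fun ω => (srs ω).ha) ∈ srsSym d srs ∧
      (rt fun ω => (srs ω).hax) ∈ srsSym d srs := by
  simp [srsSym]

/-- Deriving all cells of a reference string. -/
lemma Derives.srs {d a : ℕ} {srs : Ω → Srs B}
    (hx : ∀ i ∈ exps d, Der S a (lf fun ω => (srs ω).gx i))
    (hax : ∀ i ∈ nzExps d, Der S a (lf fun ω => (srs ω).gax i))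
    (h : Der S a (rt fun ω => (srs ω).h)) (ha : Der S a (rt fun ω => (srs ω).ha))
    (hx' : Der S a (rt fun ω => (srs ω).hax)) :
    Derives S ((4 * d + 5) * a) {v | v ∈ srsSym d srs} := by
  have h1 := Derives.family (exps d) hx
  have h2 := Derives.family (nzExps d) hax
  have hc : (exps d).card = 2 * d + 1 := by simp [exps]; omega
  have hc' : (nzExps d).card ≤ 2 * d + 1 := (Finset.card_erase_le).trans hc.le
  refine ((h1.union h2).union (h.union (ha.union hx'))).mono le_rfl ?_ ?_
  · have := Nat.mul_le_mul_right a hc'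
    rw [hc]
    ring_nf at this ⊢
    omega
  · intro v hv
    simp only [srsSym, List.mem_append, List.mem_map, List.mem_filter, Set.mem_ofPred_eq,
      List.mem_cons, List.not_mem_nil, or_false] at hv
    rcases hv with (⟨i, hi, rfl⟩ | ⟨i, hi, rfl⟩) | rfl | rfl | rfl
    · exact .inl (.inl ⟨i, mem_expList.1 hi, rfl⟩)
    · exact .inl (.inr ⟨i, Finset.mem_erase.2 ⟨by simpa using hi.2, mem_expList.1 hi.1⟩, rfl⟩)
    · simp
    · simp
    · simp

/-- A value that is computable from the input is the output of an algorithm. -/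
lemma Der.exists_solver {l : List (Ω → Val B)} {n : ℕ} {y : Ω → B.F}
    (h : Der {v | v ∈ l} n (sc y)) :
    ∃ (P : Prog B) (out : ℕ), P.length ≤ n ∧ ∀ ω, (run P (l.map (· ω))).fld out = y ω := by
  obtain ⟨P, hP, hv⟩ := h l fun v hv => hv
  obtain ⟨i, hi⟩ := exists_address (hv (sc y) rfl)
  exact ⟨P, i, hP, fun ω => by rw [run_map, Mem.fld, hi]; rfl⟩

end Inputs

/-! ### The verification equation as a polynomial identity -/

section Verification

open Polynomial

variable {B : BilinearGroup} {K d : ℕ}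

/-- The polynomial `X ^ d * ∑ aₜ X ^ t`. -/
def expPoly (d : ℕ) (J : Finset ℤ) (a : ℤ → B.F) : B.F[X] :=
  ∑ t ∈ J, C (a t) * X ^ (t + d).toNat

lemma natDegree_expPoly_le {J : Finset ℤ} (hJ : J ⊆ exps d) (a : ℤ → B.F) :
    (expPoly d J a).natDegree ≤ 2 * d := by
  refine natDegree_sum_le_of_forall_le _ _ fun t ht => (natDegree_C_mul_X_pow_le _ _).trans ?_
  have := hJ ht
  simp only [exps, Finset.mem_Icc] at this
  omega

lemma eval_expPoly {J : Finset ℤ} (hJ : J ⊆ exps d) (a : ℤ → B.F) {x : B.F} (hx : x ≠ 0) :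
    (expPoly d J a).eval x = x ^ d * ∑ t ∈ J, a t * x ^ t := by
  rw [expPoly, eval_finsetSum, Finset.mul_sum]
  refine Finset.sum_congr rfl fun t ht => ?_
  have := hJ ht
  simp only [exps, Finset.mem_Icc] at this
  simp only [eval_mul, eval_C, eval_pow, eval_X]
  rw [← zpow_natCast, Int.toNat_of_nonneg (by omega), zpow_add₀ hx, zpow_natCast]
  ring

lemma coeff_expPoly {J : Finset ℤ} (hJ : J ⊆ exps d) (a : ℤ → B.F) (j : ℕ) :
    (expPoly d J a).coeff j = if (j : ℤ) - d ∈ J then a (j - d) else 0 := by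
  rw [expPoly, finsetSum_coeff]
  simp only [coeff_C_mul, coeff_X_pow]
  have : ∀ t ∈ J, (a t * if j = (t + d).toNat then 1 else 0) = if t = (j : ℤ) - d then a t else 0 := by
    intro t ht
    have := hJ ht
    simp only [exps, Finset.mem_Icc] at this
    rw [mul_ite, mul_one, mul_zero]
    exact if_congr (by omega) rfl rfl
  rw [Finset.sum_congr rfl this, Finset.sum_ite_eq']

/-- The part of a representation that belongs to the elements `g^(x^t)`. -/
def Rep.plainPoly (R : Rep) (d : ℕ) (m : Mem B) : B.F[X] :=
  expPoly d (exps d) fun t => m.fld (R.plain t)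

/-- The part of a representation that belongs to the elements `g^(α x^t)`. -/
def Rep.shiftedPoly (R : Rep) (d : ℕ) (m : Mem B) : B.F[X] :=
  expPoly d (nzExps d) fun t => m.fld (R.shifted t)

lemma nzExps_subset (d : ℕ) : nzExps d ⊆ exps d := Finset.erase_subset _ _

/-- The polynomials of a representation carry an additional factor `X ^ d`, which clears the
negative exponents and is undone here. -/
lemma Rep.value_eq (R : Rep) (s : Secrets B) (m : Mem B) :
    R.value d (setup B d s) m = (((s.2.2.2 : B.F) ^ d)⁻¹ * ((R.plainPoly d m).eval (s.2.2.2 : B.F) +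
      (s.2.2.1 : B.F) * (R.shiftedPoly d m).eval (s.2.2.2 : B.F))) • (s.1 : B.G₁) := by
  have hx : (s.2.2.2 : B.F) ≠ 0 := s.2.2.2.2.1
  rw [Rep.plainPoly, Rep.shiftedPoly, eval_expPoly le_rfl _ hx, eval_expPoly (nzExps_subset d) _ hx,
    Rep.value]
  have h1 : ∑ i ∈ exps d, m.fld (R.plain i) • (setup B d s).gx i =
      (∑ i ∈ exps d, m.fld (R.plain i) * (s.2.2.2 : B.F) ^ i) • (s.1 : B.G₁) := by
    rw [Finset.sum_smul]
    refine Finset.sum_congr rfl fun i hi => ?_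
    simp only [setup, if_pos hi]
    rw [smul_smul]
  have h2 : ∑ i ∈ nzExps d, m.fld (R.shifted i) • (setup B d s).gax i =
      ((s.2.2.1 : B.F) * ∑ i ∈ nzExps d, m.fld (R.shifted i) * (s.2.2.2 : B.F) ^ i) •
        (s.1 : B.G₁) := by
    rw [Finset.mul_sum, Finset.sum_smul]
    refine Finset.sum_congr rfl fun i hi => ?_
    simp only [setup, if_pos hi]
    rw [smul_smul]
    congr 1
    ring
  rw [h1, h2, ← add_smul]
  congr 1
  field_simp

namespace Prover

variable (A : Prover B K)

/-- The claimed polynomials. -/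
def gamPoly (m : Mem B) (i : Fin K) : B.F[X] :=
  ∑ t : Fin A.terms, C (m.fld (A.gam i t)) * X ^ (t : ℕ)

variable (d) (m₀ m₁ m₂ m₃ : Mem B) (β μ : B.F)

/-- The verification equation, at degree `0` in `α`. -/
def eq₀ : B.F[X] :=
  ∑ i, C (Psi (readS m₁ A.pt) (readSi m₁ A.pt A.flag) β μ i) * (A.comRep i).plainPoly d m₀

/-- The verification equation, at degree `1` in `α`. -/
def eq₁ : B.F[X] :=
  ∑ i, C (Psi (readS m₁ A.pt) (readSi m₁ A.pt A.flag) β μ i) * (A.comRep i).shiftedPoly d m₀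
    - (X - C μ) * A.pi₂Rep.plainPoly d m₃
    - C ((vanish (readS m₁ A.pt)).eval μ) * A.pi₁Rep.plainPoly d m₂
    - C (∑ i, (A.gamPoly m₁ i).eval μ * Psi (readS m₁ A.pt) (readSi m₁ A.pt A.flag) β μ i) * X ^ d

/-- The verification equation, at degree `2` in `α`. -/
def eq₂ : B.F[X] :=
  - ((X - C μ) * A.pi₂Rep.shiftedPoly d m₃)
    - C ((vanish (readS m₁ A.pt)).eval μ) * A.pi₁Rep.shiftedPoly d m₂

lemma natDegree_eq₀_le : (A.eq₀ d m₀ m₁ β μ).natDegree ≤ 2 * d + 1 :=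
  natDegree_sum_le_of_forall_le _ _ fun i _ => (natDegree_C_mul_le _ _).trans
    ((natDegree_expPoly_le le_rfl _).trans (by omega))

lemma natDegree_eq₁_le : (A.eq₁ d m₀ m₁ m₂ m₃ β μ).natDegree ≤ 2 * d + 1 := by
  refine (natDegree_sub_le _ _).trans (max_le ((natDegree_sub_le _ _).trans (max_le
    ((natDegree_sub_le _ _).trans (max_le ?_ ?_)) ?_)) ?_)
  · exact natDegree_sum_le_of_forall_le _ _ fun i _ => (natDegree_C_mul_le _ _).trans
      ((natDegree_expPoly_le (nzExps_subset d) _).trans (by omega))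
  · refine natDegree_mul_le.trans ?_
    have h1 : (A.pi₂Rep.plainPoly d m₃).natDegree ≤ 2 * d := natDegree_expPoly_le le_rfl _
    have h2 := natDegree_X_sub_C (R := B.F) μ
    omega
  · exact (natDegree_C_mul_le _ _).trans ((natDegree_expPoly_le le_rfl _).trans (by omega))
  · exact (natDegree_C_mul_X_pow_le _ _).trans (by omega)

lemma natDegree_eq₂_le : (A.eq₂ d m₁ m₂ m₃ μ).natDegree ≤ 2 * d + 1 := by
  refine (natDegree_sub_le _ _).trans (max_le ?_ ?_)
  · rw [natDegree_neg]
    refine natDegree_mul_le.trans ?_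
    have h1 : (A.pi₂Rep.shiftedPoly d m₃).natDegree ≤ 2 * d :=
      natDegree_expPoly_le (nzExps_subset d) _
    have h2 := natDegree_X_sub_C (R := B.F) μ
    omega
  · exact (natDegree_C_mul_le _ _).trans ((natDegree_expPoly_le (nzExps_subset d) _).trans (by omega))

variable {d}

/-- Each element of `G₁` is a known multiple of `g`, and `e(g, h) ≠ 0`, so the check is an equation
of scalars. Sorting it by powers of `α` gives the three parts. -/
lemma verification (s : Secrets B) {Fc : Fin K → B.G₁} {π₁ π₂ : B.G₁}
    (hF : ∀ i, Fc i = (A.comRep i).value d (setup B d s) m₀)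
    (h₁ : π₁ = A.pi₁Rep.value d (setup B d s) m₂) (h₂ : π₂ = A.pi₂Rep.value d (setup B d s) m₃)
    (hv : BatchVerify (setup B d s) Fc (readS m₁ A.pt) (readSi m₁ A.pt A.flag) (A.gamPoly m₁) β μ
      π₁ π₂) :
    (A.eq₀ d m₀ m₁ β μ).eval (s.2.2.2 : B.F) +
      (s.2.2.1 : B.F) * (A.eq₁ d m₀ m₁ m₂ m₃ β μ).eval (s.2.2.2 : B.F) +
      (s.2.2.1 : B.F) ^ 2 * (A.eq₂ d m₁ m₂ m₃ μ).eval (s.2.2.2 : B.F) = 0 := by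
  have hx : (s.2.2.2 : B.F) ≠ 0 := s.2.2.2.2.1
  have hxd : (s.2.2.2 : B.F) ^ d ≠ 0 := pow_ne_zero _ hx
  have h0 : (0 : ℤ) ∈ exps d := by simp [exps]
  have hE := pairing_ne_zero B s.1.2 s.2.1.2
  set Ψ := Psi (readS m₁ A.pt) (readSi m₁ A.pt A.flag) β μ with hΨ
  rw [BatchVerify, h₁, h₂] at hv
  simp only [hF, Rep.value_eq] at hv
  simp only [setup, if_pos h0, zpow_zero, one_smul, smul_smul, ← Finset.sum_smul, ← sub_smul,
    map_smul, LinearMap.smul_apply, ← add_smul] at hv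
  rw [← sub_eq_zero, ← sub_smul, smul_eq_zero] at hv
  have hv := hv.resolve_right hE
  simp only [eq₀, eq₁, eq₂, eval_sub, eval_neg, eval_mul, eval_finsetSum, eval_C, eval_X,
    eval_pow, ← hΨ]
  set x := (s.2.2.2 : B.F)
  set α := (s.2.2.1 : B.F)
  have hsum : ∑ i, Ψ i * ((x ^ d)⁻¹ * (((A.comRep i).plainPoly d m₀).eval x +
      α * ((A.comRep i).shiftedPoly d m₀).eval x)) =
      (x ^ d)⁻¹ * (∑ i, Ψ i * ((A.comRep i).plainPoly d m₀).eval x +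
        α * ∑ i, Ψ i * ((A.comRep i).shiftedPoly d m₀).eval x) := by
    rw [Finset.mul_sum, ← Finset.sum_add_distrib, Finset.mul_sum]
    exact Finset.sum_congr rfl fun i _ => by ring
  rw [hsum] at hv
  set a₀ := ∑ i, Ψ i * ((A.comRep i).plainPoly d m₀).eval x
  set a₁ := ∑ i, Ψ i * ((A.comRep i).shiftedPoly d m₀).eval x
  set a₂ := ∑ i, (A.gamPoly m₁ i).eval μ * Ψ i
  -- Multiplication by `-x ^ d` clears the denominator of the representations and fixes the sign.
  have hmul := congrArg (fun y => -(x ^ d) * y) hv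
  simp only [mul_zero] at hmul
  rw [← hmul]
  field_simp
  ring

end Prover

end Verification

/-! ### Reductions from knowledge soundness to `q`-DLOG -/

section Simulation

open Polynomial

variable {B : BilinearGroup} {Ω : Type} {S : Set (Ω → Val B)} {K d : ℕ}

namespace Prover

variable (A : Prover B K) (d) (srs : Ω → Srs B) (co : Ω → Fin A.coins → B.F) (β μ : Ω → B.F)

/-- The symbolic memories of a prover. -/
def sym₀ : List (Ω → Val B) := runF A.prog₀ (srsSym d srs ++ coinSym co)
def sym₁ : List (Ω → Val B) := runF A.prog₁ (A.sym₀ d srs co)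
def sym₂ : List (Ω → Val B) := runF A.prog₂ (A.sym₁ d srs co ++ [sc β])
def sym₃ : List (Ω → Val B) := runF A.prog₃ (A.sym₂ d srs co β ++ [sc μ])

lemma sym₀_map (ω : Ω) : (A.sym₀ d srs co).map (· ω) = A.mem₀ (srs ω) d (co ω) := by
  rw [sym₀, ← run_map, List.map_append, srsSym_map, coinSym_map, mem₀]

lemma sym₁_map (ω : Ω) : (A.sym₁ d srs co).map (· ω) = A.mem₁ (srs ω) d (co ω) := by
  rw [sym₁, ← run_map, sym₀_map, mem₁]

lemma sym₂_map (ω : Ω) : (A.sym₂ d srs co β).map (· ω) = A.mem₂ (srs ω) d (co ω) (β ω) := by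
  rw [sym₂, ← run_map, List.map_append, sym₁_map, mem₂]
  rfl

lemma sym₃_map (ω : Ω) : (A.sym₃ d srs co β μ).map (· ω) = A.mem₃ (srs ω) d (co ω) (β ω) (μ ω) := by
  rw [sym₃, ← run_map, List.map_append, sym₂_map, mem₃]
  rfl

lemma sym₂_subset {v : Ω → Val B} (h : v ∈ A.sym₂ d srs co β) : v ∈ A.sym₃ d srs co β μ :=
  mem_runF (List.mem_append_left _ h)

lemma sym₁_subset {v : Ω → Val B} (h : v ∈ A.sym₁ d srs co) : v ∈ A.sym₃ d srs co β μ :=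
  A.sym₂_subset d srs co β μ (mem_runF (List.mem_append_left _ h))

lemma sym₀_subset {v : Ω → Val B} (h : v ∈ A.sym₀ d srs co) : v ∈ A.sym₃ d srs co β μ :=
  A.sym₁_subset d srs co β μ (mem_runF h)

/-- The prover can be run on a reference string that is computed from other inputs. -/
lemma derives {a : ℕ} (hsrs : Derives S a {v | v ∈ srsSym d srs}) (hco : ∀ v ∈ coinSym co, v ∈ S)
    (hβ : sc β ∈ S) (hμ : sc μ ∈ S) :
    Derives S (a + 1 + A.size) ({v | v ∈ A.sym₃ d srs co β μ} ∪ {zeroVal}) := by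
  have h0 : Derives S (a + 1) ({v | v ∈ srsSym d srs} ∪ {zeroVal}) := hsrs.union (Der.const _)
  set S₁ := S ∪ ({v | v ∈ srsSym d srs} ∪ {zeroVal}) with hS₁
  have z1 : zeroVal ∈ S₁ := by simp [hS₁]
  have h1 := Derives.simulate (S := S₁) A.prog₀ (l := srsSym d srs ++ coinSym co) (by
    intro v hv
    rcases List.mem_append.1 hv with hv | hv
    · exact .inr (.inl hv)
    · exact .inl (hco v hv)) z1
  set S₂ := S₁ ∪ {v | v ∈ A.sym₀ d srs co}
  have h2 := Derives.simulate (S := S₂) A.prog₁ (l := A.sym₀ d srs co) (fun v hv => .inr hv) (.inl z1)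
  set S₃ := S₂ ∪ {v | v ∈ A.sym₁ d srs co}
  have h3 := Derives.simulate (S := S₃) A.prog₂ (l := A.sym₁ d srs co ++ [sc β]) (by
    intro v hv
    rcases List.mem_append.1 hv with hv | hv
    · exact .inr hv
    · rw [List.mem_singleton] at hv
      exact .inl (.inl (.inl (hv ▸ hβ)))) (.inl (.inl z1))
  set S₄ := S₃ ∪ {v | v ∈ A.sym₂ d srs co β}
  have h4 := Derives.simulate (S := S₄) A.prog₃ (l := A.sym₂ d srs co β ++ [sc μ]) (by
    intro v hv
    rcases List.mem_append.1 hv with hv | hv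
    · exact .inr hv
    · rw [List.mem_singleton] at hv
      exact .inl (.inl (.inl (.inl (hv ▸ hμ))))) (.inl (.inl (.inl z1)))
  have h5 := h0.trans ((h1.trans (h2.trans (h3.trans h4))).union (Der.of_mem z1))
  exact h5.mono le_rfl (by unfold size; omega) le_rfl

/-- The cost of a coefficient of the verification equation. -/
def eqCost (K n m : ℕ) : ℕ :=
  K * (psiCost K n + 4) + vanishCost n (memCost n) + K * (m * (3 * m + 5) + psiCost K n + 3) + 40

section Coefficients

variable {β μ}

lemma der_expPoly {l : List (Ω → Val B)} (hl : ∀ v ∈ l, v ∈ S) (h0 : zeroVal ∈ S) {J : Finset ℤ}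
    (hJ : J ⊆ exps d) (addr : ℤ → ℕ) (j : ℕ) :
    Der S 2 (sc fun ω => (expPoly d J fun t => Mem.fld (l.map (· ω)) (addr t)).coeff j) := by
  by_cases h : (j : ℤ) - d ∈ J
  · exact (Der.fld hl h0 (addr (j - d))).congr fun ω => by
      simp only [sc, coeff_expPoly hJ, if_pos h]
  · exact ((Der.sconst 0).congr fun ω => by simp only [sc, coeff_expPoly hJ, if_neg h]).le (by omega)

lemma der_linear_mul {Q : Ω → B.F[X]} (hQ : ∀ j, Der S 2 (sc fun ω => (Q ω).coeff j))
    {μ : Ω → B.F} (hμ : sc μ ∈ S) (j : ℕ) :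
    Der S 8 (sc fun ω => ((X - C (μ ω)) * Q ω).coeff j) := by
  have h1 : Der S 2 (sc fun ω => (X * Q ω).coeff j) := by
    cases j with
    | zero => exact ((Der.sconst 0).congr fun ω => by simp [sc]).le (by omega)
    | succ j => exact (hQ j).congr fun ω => by simp [sc]
  refine ((h1.sub' ((Der.of_mem hμ).mul (hQ j))).congr fun ω => ?_).le (by omega)
  simp only [sc]
  rw [sub_mul, coeff_sub, coeff_C_mul]

lemma der_eq₀ (hS : ∀ v ∈ A.sym₃ d srs co β μ, v ∈ S) (h0 : zeroVal ∈ S)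
    (hβ : sc β ∈ S) (hμ : sc μ ∈ S) (j : ℕ) :
    Der S (eqCost K A.points A.terms) (sc fun ω =>
    (A.eq₀ d (A.mem₀ (srs ω) d (co ω)) (A.mem₁ (srs ω) d (co ω)) (β ω) (μ ω)).coeff j) := by
  have hS0 := fun v hv => hS v (A.sym₀_subset d srs co β μ hv)
  have hS1 := fun v hv => hS v (A.sym₁_subset d srs co β μ hv)
  refine ((Der.sum (Finset.univ : Finset (Fin K)) fun i _ =>
    (Der.psi hS1 h0 A.pt A.flag ((Der.of_mem hβ).le zero_le_two) ((Der.of_mem hμ).le (by omega)) i).mul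
      (der_expPoly d hS0 h0 le_rfl (A.comRep i).plain j)).congr fun ω => ?_).le ?_
  · simp only [sc, eq₀, finsetSum_coeff, coeff_C_mul, sym₁_map, sym₀_map, Rep.plainPoly]
  · simp only [Finset.card_univ, Fintype.card_fin, eqCost]
    ring_nf
    omega

lemma der_gam (hS : ∀ v ∈ A.sym₃ d srs co β μ, v ∈ S) (h0 : zeroVal ∈ S)
    (hμ : sc μ ∈ S) (i : Fin K) :
    Der S (A.terms * (3 * A.terms + 5) + 1)
    (sc fun ω => (A.gamPoly (A.mem₁ (srs ω) d (co ω)) i).eval (μ ω)) := by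
  have hS1 := fun v hv => hS v (A.sym₁_subset d srs co β μ hv)
  refine ((Der.sum (a := 3 * A.terms + 4) (Finset.univ : Finset (Fin A.terms)) fun t _ => ?_).congr
    (u := sc fun ω => ∑ t : Fin A.terms, Mem.fld ((A.sym₁ d srs co).map (· ω)) (A.gam i t) *
      μ ω ^ (t : ℕ)) fun ω => ?_).le ?_
  · refine ((Der.fld hS1 h0 _).mul ((Der.of_mem hμ).pow t)).le ?_
    have := t.2
    omega
  · simp only [sc, gamPoly, eval_finsetSum, eval_mul, eval_C, eval_pow, eval_X, sym₁_map]
  · simp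

lemma der_eq₁ (hS : ∀ v ∈ A.sym₃ d srs co β μ, v ∈ S) (h0 : zeroVal ∈ S)
    (hβ : sc β ∈ S) (hμ : sc μ ∈ S) (j : ℕ) :
    Der S (eqCost K A.points A.terms) (sc fun ω =>
    (A.eq₁ d (A.mem₀ (srs ω) d (co ω)) (A.mem₁ (srs ω) d (co ω)) (A.mem₂ (srs ω) d (co ω) (β ω))
      (A.mem₃ (srs ω) d (co ω) (β ω) (μ ω)) (β ω) (μ ω)).coeff j) := by
  have hS0 := fun v hv => hS v (A.sym₀_subset d srs co β μ hv)
  have hS1 := fun v hv => hS v (A.sym₁_subset d srs co β μ hv)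
  have hS2 := fun v hv => hS v (A.sym₂_subset d srs co β μ hv)
  have hpsi := fun i => Der.psi hS1 h0 A.pt A.flag ((Der.of_mem hβ).le zero_le_two)
    ((Der.of_mem hμ).le (show 0 ≤ 2 by omega)) i
  have e1 := Der.sum (Finset.univ : Finset (Fin K)) fun i _ => (hpsi i).mul
      (der_expPoly d hS0 h0 (nzExps_subset d) (A.comRep i).shifted j)
  have e2 := der_linear_mul (fun j => der_expPoly d hS h0 le_rfl A.pi₂Rep.plain j) hμ j
  have e3 := ((dynSet_readS hS1 h0 A.pt).evalVanish ((Der.of_mem hμ).le (Nat.zero_le _))).mul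
    (der_expPoly d hS2 h0 le_rfl A.pi₁Rep.plain j)
  have e4 := (Der.sum (Finset.univ : Finset (Fin K)) fun i _ =>
    (A.der_gam d srs co hS h0 hμ i).mul (hpsi i)).mul (Der.sconst (if j = d then 1 else 0))
  refine ((((e1.sub' e2).sub' e3).sub' e4).congr fun ω => ?_).le ?_
  · simp only [sc, eq₁, coeff_sub, finsetSum_coeff, coeff_C_mul, coeff_X_pow, sym₁_map, sym₀_map,
      sym₂_map, sym₃_map, Rep.plainPoly, Rep.shiftedPoly]
  · simp only [Finset.card_univ, Fintype.card_fin, eqCost]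
    ring_nf
    omega

lemma der_eq₂ (hS : ∀ v ∈ A.sym₃ d srs co β μ, v ∈ S) (h0 : zeroVal ∈ S)
    (hμ : sc μ ∈ S) (j : ℕ) :
    Der S (eqCost K A.points A.terms) (sc fun ω =>
    (A.eq₂ d (A.mem₁ (srs ω) d (co ω)) (A.mem₂ (srs ω) d (co ω) (β ω))
      (A.mem₃ (srs ω) d (co ω) (β ω) (μ ω)) (μ ω)).coeff j) := by
  have hS1 := fun v hv => hS v (A.sym₁_subset d srs co β μ hv)
  have hS2 := fun v hv => hS v (A.sym₂_subset d srs co β μ hv)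
  have e2 := der_linear_mul (fun j => der_expPoly d hS h0 (nzExps_subset d) A.pi₂Rep.shifted j) hμ j
  have e3 := ((dynSet_readS hS1 h0 A.pt).evalVanish ((Der.of_mem hμ).le (Nat.zero_le _))).mul
    (der_expPoly d hS2 h0 (nzExps_subset d) A.pi₁Rep.shifted j)
  refine ((e2.neg.sub' e3).congr fun ω => ?_).le ?_
  · simp only [sc, eq₂, coeff_sub, coeff_neg, coeff_C_mul, sym₁_map, sym₂_map, sym₃_map,
      Rep.shiftedPoly]
  · unfold eqCost
    omega

end Coefficients

end Prover

lemma Der.evalPoly {N a b : ℕ} {Q : Ω → B.F[X]} {x : Ω → B.F}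
    (hQ : ∀ j, Der S a (sc fun ω => (Q ω).coeff j)) (hN : ∀ ω, (Q ω).natDegree ≤ N)
    (hx : Der S b (sc x)) :
    Der S ((N + 1) * (a + (N * (b + 1) + 1) + 2) + 1) (sc fun ω => (Q ω).eval (x ω)) := by
  refine ((Der.sum (a := a + (N * (b + 1) + 1) + 1) (Finset.range (N + 1)) fun j hj =>
    ((hQ j).mul (hx.pow j)).le ?_).congr fun ω => ?_).le (by simp)
  · have := Nat.mul_le_mul_right (b + 1) (Nat.lt_succ_iff.1 (Finset.mem_range.1 hj))
    omega
  · simp only [sc]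
    rw [eval_eq_sum_range' (Nat.lt_succ_of_le (hN ω))]

end Simulation

/-! ### Embedding a `q`-DLOG challenge into the soundness game -/

section SoundnessReductions

open Polynomial

variable {B : BilinearGroup} {K d : ℕ}

namespace Prover

variable (A : Prover B K) (d : ℕ)

/-- The sample space of the soundness game. -/
abbrev Space : Type := Secrets B × (Fin A.coins → B.F) × B.F × B.F

/-- The parts of the verification equation in a run of the game. -/
def runEq₀ (ω : A.Space) : B.F[X] :=
  A.eq₀ d (A.mem₀ (setup B d ω.1) d ω.2.1) (A.mem₁ (setup B d ω.1) d ω.2.1) ω.2.2.1 ω.2.2.2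

def runEq₁ (ω : A.Space) : B.F[X] :=
  A.eq₁ d (A.mem₀ (setup B d ω.1) d ω.2.1) (A.mem₁ (setup B d ω.1) d ω.2.1)
    (A.mem₂ (setup B d ω.1) d ω.2.1 ω.2.2.1) (A.mem₃ (setup B d ω.1) d ω.2.1 ω.2.2.1 ω.2.2.2)
    ω.2.2.1 ω.2.2.2

def runEq₂ (ω : A.Space) : B.F[X] :=
  A.eq₂ d (A.mem₁ (setup B d ω.1) d ω.2.1) (A.mem₂ (setup B d ω.1) d ω.2.1 ω.2.2.1)
    (A.mem₃ (setup B d ω.1) d ω.2.1 ω.2.2.1 ω.2.2.2) ω.2.2.2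

end Prover

/-- A scalar that can take the role of `α` or `x`. -/
abbrev Trap (B : BilinearGroup) : Type := {a : B.F // a ≠ 0 ∧ a ≠ 1}

/-- Rescaling the generator of `G₂`. -/
def rescale (h : {h : B.G₂ // h ≠ 0}) (c : Trap B) : {h : B.G₂ // h ≠ 0} :=
  ⟨(c : B.F)⁻¹ • (h : B.G₂), smul_ne_zero (inv_ne_zero c.2.1) h.2⟩

lemma smul_rescale (h : {h : B.G₂ // h ≠ 0}) (c : Trap B) :
    (c : B.F) • (rescale h c : B.G₂) = h := by
  simp [rescale, smul_smul, mul_inv_cancel₀ c.2.1]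

/-- Coins that begin with three given scalars. -/
def consCoins {r : ℕ} (a b c : B.F) (ω : Fin r → B.F) : Fin (r + 3) → B.F :=
  Fin.cons a (Fin.cons b (Fin.cons c ω))

lemma consCoins_injective {r : ℕ} {a b c a' b' c' : B.F} {ω ω' : Fin r → B.F}
    (h : consCoins a b c ω = consCoins a' b' c' ω') : a = a' ∧ b = b' ∧ c = c' ∧ ω = ω' := by
  simp only [consCoins, Fin.cons_inj] at h
  tauto

section Coins

variable {Ω : Type} {r : ℕ} {a b c : Ω → B.F} {ω : Ω → Fin r → B.F}

lemma mem_consCoins :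
    sc a ∈ coinSym (fun z => consCoins (a z) (b z) (c z) (ω z)) ∧
    sc b ∈ coinSym (fun z => consCoins (a z) (b z) (c z) (ω z)) ∧
    sc c ∈ coinSym (fun z => consCoins (a z) (b z) (c z) (ω z)) ∧
    ∀ v ∈ coinSym ω, v ∈ coinSym (fun z => consCoins (a z) (b z) (c z) (ω z)) := by
  refine ⟨mem_coinSym (c := fun z => consCoins (a z) (b z) (c z) (ω z)) 0,
    mem_coinSym (c := fun z => consCoins (a z) (b z) (c z) (ω z)) 1,
    mem_coinSym (c := fun z => consCoins (a z) (b z) (c z) (ω z)) 2, fun v hv => ?_⟩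
  simp only [coinSym, List.mem_ofFn] at hv
  obtain ⟨k, rfl⟩ := hv
  exact mem_coinSym (c := fun z => consCoins (a z) (b z) (c z) (ω z)) k.succ.succ.succ

end Coins

variable {A : Prover B K}

/-- An event of the soundness game gives a solver for `q`-DLOG, if the trapdoor can be computed from
some input into which the event embeds. -/
lemma exists_qdlog_solver (hp : B.p ≠ 2) {E : A.Space → Prop}
    (σ : {ω // E ω} × Trap B → Secrets B) (co : {ω // E ω} × Trap B → Fin (A.coins + 3) → B.F)
    (hφ : Function.Injective fun z => (σ z, co z)) {n : ℕ}
    (h : Der {v | v ∈ srsSym d (fun z => setup B d (σ z)) ++ coinSym co} n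
      (sc fun z => ((σ z).2.2.2 : B.F))) :
    ∃ A' : Solver B, A'.size ≤ A.coins + 3 + n ∧ prob A.Space E ≤ 3 * qdlogAdv d A' := by
  obtain ⟨P, out, hP, hout⟩ := h.exists_solver
  refine ⟨⟨A.coins + 3, P, out⟩, by simpa [Solver.size] using hP, ?_⟩
  have hp3 : 3 ≤ B.p := by have := B.prime.out.two_le; omega
  have : Nonempty (Trap B) := by
    by_contra hne
    rw [not_nonempty_iff] at hne
    have := card_ne_zero_and_ne_one B
    rw [Nat.card_of_isEmpty] at this
    omega
  -- The solver's three extra coins are `β`, `μ` and the scalar it chooses itself, while the game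
  -- contributes `β`, `μ` and the factor `Trap B`. The sizes differ by the factor `p / (p - 2)`, at
  -- most `3` for `p ≥ 3`.
  have key := prob_le_of_injective (Ω := A.Space) (A := Trap B) (P := E) (c := 3)
    (Ω' := Secrets B × (Fin (A.coins + 3) → B.F))
    (P' := fun ω => (run P (srsCells d (setup B d ω.1) ++ coinCells ω.2)).fld out =
      (ω.1.2.2.2 : B.F)) (fun z => (σ z, co z)) hφ (fun z => by
        have := hout z
        rw [List.map_append, srsSym_map, coinSym_map] at this
        exact this) (by
      have h1 : Nat.card A.Space = Nat.card (Secrets B) * (B.p ^ A.coins * (B.p * B.p)) :=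
        (Nat.card_prod (Secrets B) _).trans (congrArg _ (by simp))
      have h2 : Nat.card (Secrets B × (Fin (A.coins + 3) → B.F)) =
          Nat.card (Secrets B) * B.p ^ (A.coins + 3) :=
        (Nat.card_prod (Secrets B) _).trans (congrArg _ (by simp))
      rw [h1, h2, card_ne_zero_and_ne_one]
      calc Nat.card (Secrets B) * B.p ^ (A.coins + 3)
          = Nat.card (Secrets B) * B.p ^ A.coins * B.p * B.p * B.p := by ring
        _ ≤ Nat.card (Secrets B) * B.p ^ A.coins * B.p * B.p * (3 * (B.p - 2)) :=
          Nat.mul_le_mul_left _ (by omega)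
        _ = _ := by ring)
  exact_mod_cast key

/-- The cost of the reductions. -/
def reductionCost (d K n m size len : ℕ) : ℕ :=
  (4 * d + 5) * (d + 3) + 1 + size + (2 * d + 2) * Prover.eqCost K n m +
    rootCost (2 * d + 1) len ((2 * d + 1) * 8 + 20) +
    3 * ((2 * d + 2) * (Prover.eqCost K n m + 4 * d + 10) + 10) + rootCost 2 len 20

/-- If a non-zero polynomial with the root `x` is computable from a run of the game, then `x` is
computable from the reference string. -/
lemma exists_solver_of_root (hp : B.p ≠ 2) {E : A.Space → Prop} (Q : A.Space → B.F[X])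
    (hE : ∀ ω, E ω → Q ω ≠ 0 ∧ (Q ω).eval (ω.1.2.2.2 : B.F) = 0)
    (hN : ∀ ω, (Q ω).natDegree ≤ 2 * d + 1)
    (hQ : ∀ (S : Set ({ω // E ω} × Trap B → Val B)) (j : ℕ),
      (∀ v ∈ A.sym₃ d (fun z => setup B d z.1.1.1) (fun z => z.1.1.2.1) (fun z => z.1.1.2.2.1)
        (fun z => z.1.1.2.2.2), v ∈ S) → zeroVal ∈ S →
      (sc fun z => z.1.1.2.2.1) ∈ S → (sc fun z => z.1.1.2.2.2) ∈ S →
      Der S (Prover.eqCost K A.points A.terms) (sc fun z => (Q z.1.1).coeff j)) :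
    ∃ A' : Solver B, A'.size ≤ A.coins + 3 + reductionCost d K A.points A.terms A.size B.len ∧
      prob A.Space E ≤ 3 * qdlogAdv d A' := by
  -- The challenge has an unknown `c` in the role of `α`. With `h ^ (1/c)` as its generator of `G₂`,
  -- its elements `ha` and `hax` are `h` and `h ^ x`. From these and the plain part the string for a
  -- self-chosen `α` is computed.
  set σ : {ω // E ω} × Trap B → Secrets B := fun z =>
    (z.1.1.1.1, rescale z.1.1.1.2.1 z.2, z.2, z.1.1.1.2.2.2) with hσ
  set co : {ω // E ω} × Trap B → Fin (A.coins + 3) → B.F := fun z =>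
    consCoins (z.1.1.1.2.2.1 : B.F) z.1.1.2.2.1 z.1.1.2.2.2 z.1.1.2.1 with hco
  refine exists_qdlog_solver hp σ co ?_ ?_
  · rintro ⟨⟨⟨⟨g, h, α, x⟩, ω, β, μ⟩, hz⟩, c⟩ ⟨⟨⟨⟨g', h', α', x'⟩, ω', β', μ'⟩, hz'⟩, c'⟩ heq
    simp only [hσ, hco, Prod.mk.injEq] at heq
    obtain ⟨⟨rfl, hh, rfl, rfl⟩, hc⟩ := heq
    obtain ⟨hα, rfl, rfl, rfl⟩ := consCoins_injective hc
    obtain rfl : α = α' := Subtype.ext hα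
    obtain rfl : h = h' := Subtype.ext (by rw [← smul_rescale h c, hh, smul_rescale])
    rfl
  set S₀ : Set ({ω // E ω} × Trap B → Val B) :=
    {v | v ∈ srsSym d (fun z => setup B d (σ z)) ++ coinSym co} with hS₀
  have hsrs0 : ∀ v ∈ srsSym d (fun z => setup B d (σ z)), v ∈ S₀ := fun v hv =>
    List.mem_append_left _ hv
  obtain ⟨hα, hβ, hμ, hω⟩ := mem_consCoins (Ω := {ω // E ω} × Trap B)
    (a := fun z => (z.1.1.1.2.2.1 : B.F)) (b := fun z => z.1.1.2.2.1) (c := fun z => z.1.1.2.2.2)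
    (ω := fun z => z.1.1.2.1)
  have hcoS : ∀ v ∈ coinSym co, v ∈ S₀ := fun v hv => List.mem_append_right _ hv
  have hgx : ∀ i ∈ exps d, (lf fun z => (setup B d (σ z)).gx i) ∈ S₀ := fun i hi =>
    hsrs0 _ (gx_mem_srsSym (srs := fun z => setup B d (σ z)) hi)
  have hright := right_mem_srsSym (d := d) (srs := fun z => setup B d (σ z))
  have hsrs : Derives S₀ ((4 * d + 5) * (d + 3)) {v | v ∈ srsSym d fun z => setup B d z.1.1.1} := by
    refine Derives.srs (fun i hi => ?_) (fun i hi => ?_) ?_ ?_ ?_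
    · refine ((Der.of_mem (hgx i hi)).congr fun z => ?_).le (by omega)
      simp [lf, setup, hi, hσ]
    · refine (((Der.of_mem (hcoS _ hα)).smulL (Der.of_mem (hgx i (nzExps_subset d hi)))).congr
        fun z => ?_).le (by omega)
      simp [lf, setup, hi, nzExps_subset d hi, hσ, smul_smul]
    · refine ((Der.of_mem (hsrs0 _ hright.2.1)).congr fun z => ?_).le (by omega)
      simp [rt, setup, hσ, smul_rescale]
    · refine (((Der.of_mem (hcoS _ hα)).smulR (Der.of_mem (hsrs0 _ hright.2.1))).congr
        fun z => ?_).le (by omega)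
      simp [rt, setup, hσ, smul_rescale]
    · refine (((Der.of_mem (hcoS _ hα)).smulR (Der.of_mem (hsrs0 _ hright.2.2))).congr
        fun z => ?_).le (by omega)
      simp only [rt, setup, hσ]
      rw [mul_comm (z.2 : B.F), ← smul_smul, smul_rescale, smul_smul]
  have hrun := A.derives d _ (fun z => z.1.1.2.1) (fun z => z.1.1.2.2.1) (fun z => z.1.1.2.2.2) hsrs
    (fun v hv => hcoS v (hω v hv)) (hcoS _ hβ) (hcoS _ hμ)
  have hcoef := hrun.trans (Derives.coeffs (N := 2 * d + 1)
    (a := Prover.eqCost K A.points A.terms) fun j _ => hQ _ j (fun v hv => .inr (.inl hv))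
      (.inr (.inr rfl)) (.inl (hcoS _ hβ)) (.inl (hcoS _ hμ)))
  refine (hcoef.trans (Der.root (t := (2 * d + 1) * 8 + 20) hp (p_le_two_pow_len B) ?_
    Set.subset_union_right (fun z => (hE _ z.1.2).1) (fun z => (hE _ z.1.2).2)
    (fun z => hN _) fun z => z.1.1.1.2.2.2.2.1)).le (by unfold reductionCost; ring_nf; omega)
  -- A value at `x` of a polynomial of degree at most `2d` is, up to the unit `x ^ d`, an exponent
  -- of a combination of the elements `g ^ (x ^ (j - d))`. This uses the whole plain part of the
  -- string and matches the degree bound `2d + 1` on `Q`.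
  intro S' hS' r hr
  refine (((Der.sumL (Finset.range (2 * d + 1)) fun j hj => (hr j (Finset.mem_range.1 hj)).smulL
    (Der.of_mem (hS' (.inl (hgx ((j : ℤ) - d) (by
      simp [exps] at hj ⊢; omega)))))).eqZeroL).congr fun z => ?_).le (by simp; omega)
  have hx := z.1.1.1.2.2.2.2.1
  simp only [sc]
  congr 2
  have : ∑ j ∈ Finset.range (2 * d + 1), r j z • (setup B d (σ z)).gx ((j : ℤ) - d) =
      (((z.1.1.1.2.2.2 : B.F) ^ d)⁻¹ *
        ∑ j ∈ Finset.range (2 * d + 1), r j z * (z.1.1.1.2.2.2 : B.F) ^ j) •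
          (z.1.1.1.1 : B.G₁) := by
    rw [Finset.mul_sum, Finset.sum_smul]
    refine Finset.sum_congr rfl fun j hj => ?_
    have hj' : (j : ℤ) - d ∈ exps d := by simp [exps] at hj ⊢; omega
    simp only [setup, if_pos hj', hσ]
    rw [smul_smul, zpow_sub₀ hx, zpow_natCast, zpow_natCast]
    congr 1
    field_simp
  rw [this, smul_eq_zero, mul_eq_zero]
  simp [hx, z.1.1.1.1.2]

/-- If `α` is a root of a non-zero quadratic polynomial that is computable from a run of the game with
known `x`, then the trapdoor, in the role of `α`, is computable from the reference string. -/
lemma exists_solver_of_quadratic (hp : B.p ≠ 2) {E : A.Space → Prop}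
    (hE : ∀ ω, E ω → ((A.runEq₀ d ω).eval (ω.1.2.2.2 : B.F) ≠ 0 ∨
        (A.runEq₁ d ω).eval (ω.1.2.2.2 : B.F) ≠ 0) ∧
      (A.runEq₀ d ω).eval (ω.1.2.2.2 : B.F) +
        (ω.1.2.2.1 : B.F) * (A.runEq₁ d ω).eval (ω.1.2.2.2 : B.F) +
        (ω.1.2.2.1 : B.F) ^ 2 * (A.runEq₂ d ω).eval (ω.1.2.2.2 : B.F) = 0) :
    ∃ A' : Solver B, A'.size ≤ A.coins + 3 + reductionCost d K A.points A.terms A.size B.len ∧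
      prob A.Space E ≤ 3 * qdlogAdv d A' := by
  -- Now the trapdoor of the challenge is the `α` of the game, and `x` is a coin of the solver.
  -- After the rescaling, `ha` and `hax` of the challenge are `h` and `h ^ α`.
  set σ : {ω // E ω} × Trap B → Secrets B := fun z =>
    (z.1.1.1.1, rescale z.1.1.1.2.1 z.2, z.2, z.1.1.1.2.2.1) with hσ
  set co : {ω // E ω} × Trap B → Fin (A.coins + 3) → B.F := fun z =>
    consCoins (z.1.1.1.2.2.2 : B.F) z.1.1.2.2.1 z.1.1.2.2.2 z.1.1.2.1 with hco
  refine exists_qdlog_solver hp σ co ?_ ?_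
  · rintro ⟨⟨⟨⟨g, h, α, x⟩, ω, β, μ⟩, hz⟩, c⟩ ⟨⟨⟨⟨g', h', α', x'⟩, ω', β', μ'⟩, hz'⟩, c'⟩ heq
    simp only [hσ, hco, Prod.mk.injEq] at heq
    obtain ⟨⟨rfl, hh, rfl, rfl⟩, hc⟩ := heq
    obtain ⟨hα, rfl, rfl, rfl⟩ := consCoins_injective hc
    obtain rfl : x = x' := Subtype.ext hα
    obtain rfl : h = h' := Subtype.ext (by rw [← smul_rescale h c, hh, smul_rescale])
    rfl
  set S₀ : Set ({ω // E ω} × Trap B → Val B) :=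
    {v | v ∈ srsSym d (fun z => setup B d (σ z)) ++ coinSym co} with hS₀
  have hsrs0 : ∀ v ∈ srsSym d (fun z => setup B d (σ z)), v ∈ S₀ := fun v hv =>
    List.mem_append_left _ hv
  obtain ⟨hx, hβ, hμ, hω⟩ := mem_consCoins (Ω := {ω // E ω} × Trap B)
    (a := fun z => (z.1.1.1.2.2.2 : B.F)) (b := fun z => z.1.1.2.2.1) (c := fun z => z.1.1.2.2.2)
    (ω := fun z => z.1.1.2.1)
  have hcoS : ∀ v ∈ coinSym co, v ∈ S₀ := fun v hv => List.mem_append_right _ hv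
  have hgx : ∀ i ∈ exps d, (lf fun z => (setup B d (σ z)).gx i) ∈ S₀ := fun i hi =>
    hsrs0 _ (gx_mem_srsSym (srs := fun z => setup B d (σ z)) hi)
  have hright := right_mem_srsSym (d := d) (srs := fun z => setup B d (σ z))
  have h0 : (0 : ℤ) ∈ exps d := by simp [exps]
  have hpow : ∀ i ∈ exps d, Der S₀ (d + 2) (sc fun z => (z.1.1.1.2.2.2 : B.F) ^ i) := fun i hi =>
    ((Der.of_mem (hcoS _ hx)).zpow i).le (by simp [exps] at hi; omega)
  have hsrs : Derives S₀ ((4 * d + 5) * (d + 3)) {v | v ∈ srsSym d fun z => setup B d z.1.1.1} := by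
    refine Derives.srs (fun i hi => ?_) (fun i hi => ?_) ?_ ?_ ?_
    · refine (((hpow i hi).smulL (Der.of_mem (hgx 0 h0))).congr fun z => ?_).le (by omega)
      simp [lf, setup, hi, h0, hσ]
    -- The game's `g ^ α` is entry `1` of the challenge. That entry exists, as a non-zero exponent
    -- `i` forces `d ≥ 1`.
    · have h1 : (1 : ℤ) ∈ exps d := by
        simp [nzExps, exps] at hi ⊢; omega
      refine (((hpow i (nzExps_subset d hi)).smulL (Der.of_mem (hgx 1 h1))).congr
        fun z => ?_).le (by omega)
      simp [lf, setup, hi, h1, hσ, smul_smul, mul_comm]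
    · refine ((Der.of_mem (hsrs0 _ hright.2.1)).congr fun z => ?_).le (by omega)
      simp [rt, setup, hσ, smul_rescale]
    · refine ((Der.of_mem (hsrs0 _ hright.2.2)).congr fun z => ?_).le (by omega)
      simp only [rt, setup, hσ]
      rw [mul_comm (z.2 : B.F), ← smul_smul, smul_rescale]
    · refine (((Der.of_mem (hcoS _ hx)).smulR (Der.of_mem (hsrs0 _ hright.2.2))).congr
        fun z => ?_).le (by omega)
      simp only [rt, setup, hσ]
      rw [mul_comm (z.2 : B.F), ← smul_smul, smul_rescale, smul_smul, mul_comm]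
  have hrun := A.derives d _ (fun z => z.1.1.2.1) (fun z => z.1.1.2.2.1) (fun z => z.1.1.2.2.2) hsrs
    (fun v hv => hcoS v (hω v hv)) (hcoS _ hβ) (hcoS _ hμ)
  set S₁ := S₀ ∪ ({v | v ∈ A.sym₃ d (fun z => setup B d z.1.1.1) (fun z => z.1.1.2.1)
    (fun z => z.1.1.2.2.1) (fun z => z.1.1.2.2.2)} ∪ {zeroVal}) with hS₁
  have k1 : ∀ v ∈ A.sym₃ d (fun z => setup B d z.1.1.1) (fun z => z.1.1.2.1)
    (fun z => z.1.1.2.2.1) (fun z => z.1.1.2.2.2), v ∈ S₁ := fun v hv => .inr (.inl hv)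
  have k2 : zeroVal ∈ S₁ := .inr (.inr rfl)
  have k3 : (sc fun z => z.1.1.2.2.1) ∈ S₁ := .inl (hcoS _ hβ)
  have k4 : (sc fun z => z.1.1.2.2.2) ∈ S₁ := .inl (hcoS _ hμ)
  have k5 : Der S₁ 0 (sc fun z => (z.1.1.1.2.2.2 : B.F)) := Der.of_mem (.inl (hcoS _ hx))
  have e₀ := Der.evalPoly (fun j => A.der_eq₀ d _ _ k1 k2 k3 k4 j)
    (fun _ => A.natDegree_eq₀_le d _ _ _ _) k5
  have e₁ := Der.evalPoly (fun j => A.der_eq₁ d _ _ k1 k2 k3 k4 j)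
    (fun _ => A.natDegree_eq₁_le d _ _ _ _ _ _) k5
  have e₂ := Der.evalPoly (fun j => A.der_eq₂ d _ _ k1 k2 k4 j)
    (fun _ => A.natDegree_eq₂_le d _ _ _ _) k5
  set P : {ω // E ω} × Trap B → B.F[X] := fun z =>
    C ((A.runEq₀ d z.1.1).eval (z.1.1.1.2.2.2 : B.F)) +
    C ((A.runEq₁ d z.1.1).eval (z.1.1.1.2.2.2 : B.F)) * X +
    C ((A.runEq₂ d z.1.1).eval (z.1.1.1.2.2.2 : B.F)) * X ^ 2 with hP
  have hcoef : Derives S₁ (3 * ((2 * d + 2) * (Prover.eqCost K A.points A.terms + 4 * d + 10) + 1))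
      (cf 2 P) := by
    refine Derives.coeffs fun j hj => ?_
    have hle : (2 * d + 1 + 1) * (Prover.eqCost K A.points A.terms + ((2 * d + 1) * (0 + 1) + 1) + 2)
        + 1 ≤ (2 * d + 2) * (Prover.eqCost K A.points A.terms + 4 * d + 10) + 1 :=
      Nat.add_le_add_right (Nat.mul_le_mul (by omega) (by omega)) 1
    interval_cases j
    · refine (e₀.congr fun z => ?_).le hle
      simp [sc, hP, Prover.runEq₀, coeff_X]
    · refine (e₁.congr fun z => ?_).le hle
      simp [sc, hP, Prover.runEq₁]
    · refine (e₂.congr fun z => ?_).le hle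
      simp [sc, hP, Prover.runEq₂]
  refine ((hrun.trans hcoef).trans (Der.root (t := 20) (N := 2) (P := P) hp (p_le_two_pow_len B) ?_
    Set.subset_union_right (fun z h => ?_) (fun z => ?_)
    (fun z => ?_) fun z => z.1.1.1.2.2.1.2.1)).le (by unfold reductionCost; ring_nf; omega)
  -- For a quadratic polynomial only `r₀ + r₁ α` has to be tested. The test is made in `G₂`, where
  -- `h` and `h ^ α` are available even if `d = 0`.
  · intro S' hS' r hr
    refine (((((hr 0 (by omega)).smulR (Der.of_mem (hS' (.inl (hsrs0 _ hright.2.1))))).addR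
      ((hr 1 (by omega)).smulR (Der.of_mem (hS' (.inl (hsrs0 _ hright.2.2)))))).eqZeroR).congr
        fun z => ?_).le (by omega)
    simp only [sc]
    congr 2
    rw [Finset.sum_range_succ, Finset.sum_range_one, pow_zero, pow_one, mul_one]
    have hc := z.2.2.1
    have hh := (rescale z.1.1.1.2.1 z.2).2
    simp only [setup, hσ]
    rw [smul_smul, smul_smul, ← add_smul, smul_eq_zero,
      show r 0 z * (z.2 : B.F) + r 1 z * ((z.2 : B.F) * (z.1.1.1.2.2.1 : B.F)) =
        (z.2 : B.F) * (r 0 z + r 1 z * (z.1.1.1.2.2.1 : B.F)) by ring, mul_eq_zero]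
    simp [hc, hh]
  -- A non-zero value of `eq₀` or `eq₁` at `x` is a non-zero coefficient of the quadratic.
  · rcases (hE _ z.1.2).1 with hne | hne
    · apply hne
      have := congrArg (fun q => q.coeff 0) h
      simpa [hP, coeff_X] using this
    · apply hne
      have := congrArg (fun q => q.coeff 1) h
      simpa [hP, coeff_X] using this
  · refine Eq.trans ?_ (hE _ z.1.2).2
    simp [hP]
    ring
  · simp only [hP]
    compute_degree

end SoundnessReductions

/-! ### Soundness: counting the challenges -/

section Counting

open Polynomial

lemma card_prod_subtype_le {Ω A : Type} [Finite Ω] [Finite A] {P : Ω × A → Prop} {c : ℕ}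
    (h : ∀ ω, Nat.card {a // P (ω, a)} ≤ c) : Nat.card {z // P z} ≤ Nat.card Ω * c := by
  have := Fintype.ofFinite Ω
  rw [Nat.card_congr (Equiv.subtypeProdEquivSigmaSubtype fun ω a => P (ω, a)), Nat.card_sigma,
    Nat.card_eq_fintype_card, ← smul_eq_mul, ← Finset.card_univ]
  exact Finset.sum_le_card_nsmul _ _ _ fun ω _ => h ω

/-- A bound on the probability from bounds conditioned on the first two components. -/
lemma prob_prod_le {Ω C A : Type} [Finite Ω] [Finite C] [Finite A] {P : Ω × C × A → Prop} {c : ℕ}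
    (h : ∀ ω b, Nat.card {a // P (ω, b, a)} ≤ c) : prob (Ω × C × A) P ≤ c / Nat.card A := by
  have h1 : Nat.card {z // P z} ≤ Nat.card Ω * (Nat.card C * c) :=
    card_prod_subtype_le fun ω => card_prod_subtype_le (P := fun z => P (ω, z)) fun b => h ω b
  unfold prob
  rw [Nat.card_prod, Nat.card_prod]
  rcases Nat.eq_zero_or_pos (Nat.card Ω * (Nat.card C * Nat.card A)) with h0 | h0
  · rw [h0, Nat.cast_zero, div_zero]
    positivity
  have h0' : 0 < Nat.card A := Nat.pos_of_ne_zero fun h => by simp [h] at h0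
  rw [div_le_div_iff₀ (by exact_mod_cast h0) (by exact_mod_cast h0')]
  norm_cast
  calc _ ≤ Nat.card Ω * (Nat.card C * c) * Nat.card A := Nat.mul_le_mul_right _ h1
    _ = _ := by ring

variable {p : ℕ} [Fact p.Prime]

lemma card_roots_filter_le {Q : (ZMod p)[X]} (hQ : Q ≠ 0) {k : ℕ} (hk : Q.natDegree ≤ k) :
    (Finset.univ.filter fun z : ZMod p => Q.eval z = 0).card ≤ k := by
  classical
  calc _ ≤ Q.roots.toFinset.card := Finset.card_le_card fun z hz => by
        rw [Multiset.mem_toFinset, mem_roots hQ]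
        exact (Finset.mem_filter.1 hz).2
    _ ≤ k := (Multiset.toFinset_card_le _).trans ((card_roots' _).trans hk)

/-- A non-trivial linear combination of powers of `β` vanishes for few `β`. -/
lemma card_powers_filter_le {K : ℕ} (c : Fin K → ZMod p) {i : Fin K} (hi : c i ≠ 0) :
    (Finset.univ.filter fun β : ZMod p => ∑ i : Fin K, β ^ (i : ℕ) * c i = 0).card ≤ K := by
  set Q : (ZMod p)[X] := ∑ i : Fin K, C (c i) * X ^ (i : ℕ) with hQ
  have h1 : Q ≠ 0 := by
    intro h0
    have := congrArg (fun q => q.coeff i) h0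
    simp only [hQ, finsetSum_coeff, coeff_C_mul, coeff_X_pow, coeff_zero] at this
    rw [Finset.sum_eq_single i (fun k _ hk => by
      rw [if_neg, mul_zero]
      exact fun h => hk (Fin.ext h.symm)) (fun h => absurd (Finset.mem_univ i) h)] at this
    rw [if_pos rfl, mul_one] at this
    exact hi this
  have h2 : Q.natDegree ≤ K := natDegree_sum_le_of_forall_le _ _ fun i _ =>
    (natDegree_C_mul_X_pow_le _ _).trans i.2.le
  refine (Finset.card_le_card fun β hβ => ?_).trans (card_roots_filter_le h1 h2)
  simp only [Finset.mem_filter, Finset.mem_univ, true_and] at hβ ⊢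
  rw [← hβ, hQ, eval_finsetSum]
  exact Finset.sum_congr rfl fun i _ => by rw [eval_C_mul, eval_pow, eval_X, mul_comm]

/-- Counting pairs of which the first component is exceptional or the second is one of few. -/
lemma card_pairs_le {A : Type} [Fintype A] (R : A → A → Prop) [∀ a b, Decidable (R a b)]
    (M : Finset A) (k : ℕ)
    (h : ∀ a ∉ M, (Finset.univ.filter fun b => R a b).card ≤ k) :
    (Finset.univ.filter fun z : A × A => R z.1 z.2).card ≤ (M.card + k) * Fintype.card A := by
  classical
  have h1 : (Finset.univ.filter fun z : A × A => R z.1 z.2).card =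
      ∑ a : A, (Finset.univ.filter fun b => R a b).card := by
    simp only [Finset.card_filter]
    rw [← Finset.univ_product_univ, Finset.sum_product]
  rw [h1]
  calc _ ≤ ∑ a : A, ((if a ∈ M then Fintype.card A else 0) + k) := by
        refine Finset.sum_le_sum fun a _ => ?_
        split_ifs with ha
        · exact (Finset.card_le_univ _).trans (Nat.le_add_right _ _)
        · simpa using h a ha
    _ = _ := by
        rw [Finset.sum_add_distrib, Finset.sum_ite_mem]
        simp
        ring

end Counting

/-! ### Runs in which the equation holds identically, and the bound on the soundness advantage -/

section Statistical

open Polynomial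

variable {B : BilinearGroup} {K d : ℕ} (A : Prover B K)

namespace Prover

/-- Non-zero parts of the commitments outside of the span of the `g^(α x^t)` are noticed, except for
few challenges. -/
lemma card_plain_le (m₀ m₁ : Mem B) {i : Fin K} (hi : (A.comRep i).plainPoly d m₀ ≠ 0) :
    Nat.card {z : B.F × B.F // A.eq₀ d m₀ m₁ z.1 z.2 = 0} ≤ (A.points + K) * B.p := by
  classical
  obtain ⟨j, hj⟩ : ∃ j, ((A.comRep i).plainPoly d m₀).coeff j ≠ 0 := by
    by_contra! h
    exact hi (Polynomial.ext fun j => by simpa using h j)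
  -- The part of degree `0` in `α` involves only what is fixed before the challenges, so `μ` may be
  -- fixed first. Outside `S` all factors `Z_{S \ Sᵢ}(μ)` are non-zero, and coefficient `j` is then
  -- a non-zero polynomial in `β`.
  have h := card_pairs_le (A := B.F) (fun μ β => A.eq₀ d m₀ m₁ β μ = 0) (readS m₁ A.pt) K (by
    intro μ hμ
    refine (Finset.card_le_card fun β hβ => ?_).trans (card_powers_filter_le (i := i)
      (fun i => (vanish (readS m₁ A.pt \ readSi m₁ A.pt A.flag i)).eval μ *
        ((A.comRep i).plainPoly d m₀).coeff j) ?_)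
    · simp only [Finset.mem_filter, Finset.mem_univ, true_and] at hβ ⊢
      have := congrArg (fun q => q.coeff j) hβ
      simp only [eq₀, finsetSum_coeff, coeff_C_mul, coeff_zero, Psi, mul_assoc] at this
      exact this
    · exact mul_ne_zero (eval_vanish_ne_zero fun h => hμ (Finset.mem_sdiff.1 h).1) hj)
  refine (Nat.card_congr ((Equiv.prodComm B.F B.F).subtypeEquiv
    (p := fun z : B.F × B.F => A.eq₀ d m₀ m₁ z.1 z.2 = 0)
    (q := fun z : B.F × B.F => A.eq₀ d m₀ m₁ z.2 z.1 = 0) fun z => Iff.rfl)).le.trans ?_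
  rw [Nat.card_eq_fintype_card, Fintype.card_subtype]
  refine h.trans ?_
  rw [ZMod.card]
  exact Nat.mul_le_mul_right _ (Nat.add_le_add_right (card_readS_le _ _) _)

lemma natDegree_gamPoly_le (m : Mem B) (i : Fin K) : (A.gamPoly m i).natDegree ≤ A.terms :=
  natDegree_sum_le_of_forall_le _ _ fun t _ => (natDegree_C_mul_X_pow_le _ _).trans t.2.le

/-- Wrong values are noticed, except for few challenges. -/
lemma card_value_le (m₀ m₁ : Mem B) (m₂ : B.F → Mem B) (m₃ : B.F → B.F → Mem B) {j : Fin K}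
    {z : B.F} (hz : z ∈ readSi m₁ A.pt A.flag j)
    (hne : ((A.comRep j).shiftedPoly d m₀).eval z ≠ z ^ d * (A.gamPoly m₁ j).eval z) :
    Nat.card {c : B.F × B.F // A.eq₁ d m₀ m₁ (m₂ c.1) (m₃ c.1 c.2) c.1 c.2 = 0} ≤
      (K + (A.points + 3 * d + A.terms)) * B.p := by
  classical
  set Z := fun i => vanish (readS m₁ A.pt \ readSi m₁ A.pt A.flag i) with hZ
  set ev : Fin K → B.F := fun i => (Z i).eval z * (((A.comRep i).shiftedPoly d m₀).eval z -
    z ^ d * (A.gamPoly m₁ i).eval z) with hev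
  -- Substituting `X = μ` in `eq₁` removes the term of `π₂`, the only one that depends on `μ`
  -- through the prover. What is left is a polynomial in `μ` fixed by `β`, since `π₁` precedes `μ`.
  set L : B.F → B.F[X] := fun β => ∑ i : Fin K, C (β ^ (i : ℕ)) * (Z i *
    ((A.comRep i).shiftedPoly d m₀ - X ^ d * A.gamPoly m₁ i)) -
      vanish (readS m₁ A.pt) * A.pi₁Rep.plainPoly d (m₂ β) with hL
  -- At `z ∈ S` the term with `Z_S` vanishes, so `π₁` has no influence. The value there is a
  -- combination of powers of `β` whose coefficient `ev j` is non-zero.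
  have hLne : ∀ β ∉ Finset.univ.filter (fun β : B.F => ∑ i : Fin K, β ^ (i : ℕ) * ev i = 0),
      L β ≠ 0 := by
    intro β hβ h0
    apply hβ
    rw [Finset.mem_filter]
    refine ⟨Finset.mem_univ _, ?_⟩
    have := congrArg (eval z) h0
    rw [hL, eval_sub, eval_mul, eval_vanish_of_mem (readSi_subset _ _ _ _ hz), zero_mul, sub_zero,
      eval_finsetSum, eval_zero] at this
    rw [← this]
    exact Finset.sum_congr rfl fun i _ => by simp [hev]
  have hcard : ∀ T : Finset B.F, T ⊆ readS m₁ A.pt → (vanish T).natDegree ≤ A.points := fun T hT => by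
    rw [natDegree_vanish]
    exact (Finset.card_le_card hT).trans (card_readS_le _ _)
  have hdeg : ∀ β, (L β).natDegree ≤ A.points + 3 * d + A.terms := by
    intro β
    refine (natDegree_sub_le _ _).trans (max_le ?_ ?_)
    · refine natDegree_sum_le_of_forall_le _ _ fun i _ => (natDegree_C_mul_le _ _).trans
        (natDegree_mul_le.trans ?_)
      have h1 := hcard _ (Finset.sdiff_subset (s := readS m₁ A.pt) (t := readSi m₁ A.pt A.flag i))
      have h2 : ((A.comRep i).shiftedPoly d m₀).natDegree ≤ 2 * d :=
        natDegree_expPoly_le (nzExps_subset d) _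
      have h3 : (X ^ d * A.gamPoly m₁ i).natDegree ≤ d + A.terms := natDegree_mul_le.trans
        (add_le_add (natDegree_X_pow_le d) (A.natDegree_gamPoly_le m₁ i))
      have h4 := natDegree_sub_le ((A.comRep i).shiftedPoly d m₀) (X ^ d * A.gamPoly m₁ i)
      have h5 := max_le (h2.trans (Nat.le_add_right (2 * d) (d + A.terms))) (h3.trans
        (Nat.le_add_left (d + A.terms) (2 * d)))
      simp only [hZ]
      omega
    · refine natDegree_mul_le.trans ?_
      have h1 := hcard _ (le_refl (readS m₁ A.pt))
      have h2 : (A.pi₁Rep.plainPoly d (m₂ β)).natDegree ≤ 2 * d := natDegree_expPoly_le le_rfl _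
      omega
  have h := card_pairs_le (A := B.F) (fun β μ => A.eq₁ d m₀ m₁ (m₂ β) (m₃ β μ) β μ = 0)
    (Finset.univ.filter (fun β : B.F => ∑ i : Fin K, β ^ (i : ℕ) * ev i = 0))
    (A.points + 3 * d + A.terms) (by
      intro β hβ
      refine (Finset.card_le_card fun μ hμ => ?_).trans (card_roots_filter_le (hLne β hβ) (hdeg β))
      simp only [Finset.mem_filter, Finset.mem_univ, true_and] at hμ ⊢
      have := congrArg (eval μ) hμ
      simp only [eq₁, eval_sub, eval_mul, eval_finsetSum, eval_C, eval_X, sub_self, zero_mul,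
        sub_zero, eval_pow, eval_zero, Finset.sum_mul] at this
      rw [sub_right_comm, ← Finset.sum_sub_distrib] at this
      simp only [hL, eval_sub, eval_finsetSum, eval_mul, eval_C, eval_pow, eval_X]
      rw [← this]
      congr 1
      refine Finset.sum_congr rfl fun i _ => ?_
      simp only [Psi, hZ]
      ring)
  rw [Nat.card_eq_fintype_card, Fintype.card_subtype]
  refine h.trans ?_
  rw [ZMod.card]
  refine Nat.mul_le_mul_right _ (Nat.add_le_add_right (card_powers_filter_le ev (i := j) ?_) _)
  refine mul_ne_zero (eval_vanish_ne_zero fun h => (Finset.mem_sdiff.1 h).2 hz) (sub_ne_zero.2 hne)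

/-- A run in which the verification equation holds identically although the commitments or the values
are wrong. -/
def Lucky (d : ℕ) (ω : A.Space) : Prop :=
  A.runEq₀ d ω = 0 ∧ A.runEq₁ d ω = 0 ∧
    ((∃ i, (A.comRep i).plainPoly d (A.mem₀ (setup B d ω.1) d ω.2.1) ≠ 0) ∨
      ∃ j, ∃ z ∈ readSi (A.mem₁ (setup B d ω.1) d ω.2.1) A.pt A.flag j,
        ((A.comRep j).shiftedPoly d (A.mem₀ (setup B d ω.1) d ω.2.1)).eval z ≠
          z ^ d * (A.gamPoly (A.mem₁ (setup B d ω.1) d ω.2.1) j).eval z)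

/-- The commitments, points and claimed polynomials are fixed before the uniform challenges, so
counting pairs `(β, μ)` for fixed setup and coins suffices. Whichever kind of cheating is present
excludes all but `O(p)` of the `p²` pairs. -/
lemma prob_lucky_le : prob A.Space (A.Lucky d) ≤
    ((A.points + 3 * d + A.terms + A.points + 2 * K : ℕ) : ℝ) * (1 / (B.p : ℝ)) := by
  have hp : (0 : ℝ) < B.p := by exact_mod_cast B.prime.out.pos
  refine (prob_prod_le (c := (A.points + 3 * d + A.terms + A.points + 2 * K) * B.p)
    fun s co => ?_).trans (le_of_eq ?_)
  · set m₀ := A.mem₀ (setup B d s) d co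
    set m₁ := A.mem₁ (setup B d s) d co
    by_cases h1 : ∃ i, (A.comRep i).plainPoly d m₀ ≠ 0
    · obtain ⟨i, hi⟩ := h1
      refine (Nat.card_le_card_of_injective (Subtype.map id fun z hz => hz.1)
        (Subtype.map_injective _ Function.injective_id)).trans
          ((A.card_plain_le m₀ m₁ hi).trans (Nat.mul_le_mul_right _ (by omega)))
    · by_cases h2 : ∃ j, ∃ z ∈ readSi m₁ A.pt A.flag j,
          ((A.comRep j).shiftedPoly d m₀).eval z ≠ z ^ d * (A.gamPoly m₁ j).eval z
      · obtain ⟨j, z, hz, hne⟩ := h2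
        refine (Nat.card_le_card_of_injective (Subtype.map id fun z hz => hz.2.1)
          (Subtype.map_injective _ Function.injective_id)).trans
            ((A.card_value_le m₀ m₁ (fun β => A.mem₂ (setup B d s) d co β)
              (fun β μ => A.mem₃ (setup B d s) d co β μ) hz hne).trans
                (Nat.mul_le_mul_right _ (by omega)))
      · have : IsEmpty {a : B.F × B.F // A.Lucky d (s, co, a)} := ⟨fun a => by
          rcases a.2.2.2 with h | h
          · exact h1 h
          · exact h2 h⟩
        rw [Nat.card_of_isEmpty]
        exact Nat.zero_le _
  · rw [Nat.card_prod, Nat.card_zmod]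
    push_cast
    field_simp

lemma coeff_extracted (E : Extractor B K) (srs : Srs B) (co : Fin A.coins → B.F) (i : Fin K) (t : ℤ) :
    (A.extracted E srs d co i).coeff t =
      if t ∈ nzExps d then (run E.prog (A.mem₀ srs d co)).fld (E.coef i t) else 0 := by
  rw [extracted, AddMonoidAlgebra.coeff_sum, Finset.sum_apply']
  simp only [← LaurentPolynomial.single_eq_C_mul_T, AddMonoidAlgebra.coeff_single,
    Finsupp.single_apply]
  rw [Finset.sum_ite_eq']

/-- How a prover can win against the extractor that reads off the representations. -/
lemma wins_cases (hA : A.Algebraic d) (ω : A.Space)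
    (hw : A.Wins A.readOff d ω.1 ω.2.1 ω.2.2.1 ω.2.2.2) :
    ((A.runEq₀ d ω ≠ 0 ∧ (A.runEq₀ d ω).eval (ω.1.2.2.2 : B.F) = 0) ∨
      (A.runEq₁ d ω ≠ 0 ∧ (A.runEq₁ d ω).eval (ω.1.2.2.2 : B.F) = 0)) ∨
    ((((A.runEq₀ d ω).eval (ω.1.2.2.2 : B.F) ≠ 0 ∨ (A.runEq₁ d ω).eval (ω.1.2.2.2 : B.F) ≠ 0) ∧
      (A.runEq₀ d ω).eval (ω.1.2.2.2 : B.F) +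
        (ω.1.2.2.1 : B.F) * (A.runEq₁ d ω).eval (ω.1.2.2.2 : B.F) +
        (ω.1.2.2.1 : B.F) ^ 2 * (A.runEq₂ d ω).eval (ω.1.2.2.2 : B.F) = 0) ∨ A.Lucky d ω) := by
  obtain ⟨s, co, β, μ⟩ := ω
  obtain ⟨hA0, hA1, hA2⟩ := hA s co β μ
  obtain ⟨hS, hv, j, hj⟩ := hw
  simp only at hv hj hS
  have hver := A.verification (A.mem₀ (setup B d s) d co) (A.mem₁ (setup B d s) d co)
    (A.mem₂ (setup B d s) d co β) (A.mem₃ (setup B d s) d co β μ) β μ s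
    (fun i => by rw [hA0 i]; rfl) (by rw [hA1]; rfl) (by rw [hA2]; rfl) hv
  by_cases h0 : (A.runEq₀ d (s, co, β, μ)).eval (s.2.2.2 : B.F) ≠ 0
  · exact .inr (.inl ⟨.inl h0, hver⟩)
  by_cases h1 : (A.runEq₁ d (s, co, β, μ)).eval (s.2.2.2 : B.F) ≠ 0
  · exact .inr (.inl ⟨.inr h1, hver⟩)
  rw [not_ne_iff] at h0 h1
  by_cases h2 : A.runEq₀ d (s, co, β, μ) = 0
  swap
  · exact .inl (.inl ⟨h2, h0⟩)
  by_cases h3 : A.runEq₁ d (s, co, β, μ) = 0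
  swap
  · exact .inl (.inr ⟨h3, h1⟩)
  refine .inr (.inr ⟨h2, h3, ?_⟩)
  have hco : ∀ i t, (A.extracted A.readOff (setup B d s) d co i).coeff t =
      if t ∈ nzExps d then (A.mem₀ (setup B d s) d co).fld ((A.comRep i).shifted t) else 0 :=
    fun i t => A.coeff_extracted A.readOff (setup B d s) co i t
  rcases hj with hj | ⟨z, hz, hne⟩
  · left
    -- By contraposition: a representation without plain part is exactly a commitment to the
    -- polynomial that is read off.
    refine ⟨j, fun hz => hj ?_⟩
    rw [hA0 j]
    have hplain : ∀ t ∈ exps d, (A.mem₀ (setup B d s) d co).fld ((A.comRep j).plain t) = 0 := by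
      intro t ht
      have h := congrArg (fun q => q.coeff (t + d).toNat) hz
      rw [Rep.plainPoly] at h
      simp only [coeff_zero] at h
      have ht' := ht
      simp only [exps, Finset.mem_Icc] at ht'
      rw [coeff_expPoly le_rfl, show (((t + d).toNat : ℕ) : ℤ) - d = t by omega, if_pos ht] at h
      exact h
    simp only [Val.toLeft, commit, Rep.value]
    rw [Finset.sum_eq_zero (s := exps d) fun t ht => by rw [hplain t ht, zero_smul], zero_add]
    exact Finset.sum_congr rfl fun t ht => by rw [hco, if_pos ht]
  · right
    refine ⟨j, z, hz, fun heq => hne ?_⟩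
    have hz0 : z ≠ 0 := fun h => hS (h ▸ readSi_subset _ _ _ _ hz)
    rw [lev_eq_sum (J := nzExps d) fun t ht => by rw [hco, if_neg ht]]
    rw [Rep.shiftedPoly, eval_expPoly (nzExps_subset d) _ hz0] at heq
    have := mul_left_cancel₀ (pow_ne_zero d hz0) heq
    refine Eq.trans ?_ this
    exact Finset.sum_congr rfl fun t ht => by rw [hco, if_pos ht]

/-- The advantage against soundness is bounded by the advantages of solvers for `q`-DLOG. -/
theorem soundAdv_le (hA : A.Algebraic d) : ∃ A₁ A₂ A₃ : Solver B,
    (∀ A' ∈ [A₁, A₂, A₃],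
      A'.size ≤ A.coins + 3 + reductionCost d K A.points A.terms A.size B.len) ∧
    soundAdv d A A.readOff ≤ 3 * qdlogAdv d A₁ + 3 * qdlogAdv d A₂ + 3 * qdlogAdv d A₃ +
      ((A.points + 3 * d + A.terms + A.points + 2 * K : ℕ) : ℝ) * (1 / (B.p : ℝ)) := by
  rcases eq_or_ne B.p 2 with hp | hp
  -- For `p = 2` no scalar differs from `0` and `1`, so the sample space is empty and the
  -- probability is `0`.
  · have : IsEmpty (Trap B) := by
      have h := Nat.card_eq_zero.1 ((card_ne_zero_and_ne_one B).trans (by omega))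
      exact h.resolve_right fun h => h.not_finite inferInstance
    refine ⟨⟨0, [], 0⟩, ⟨0, [], 0⟩, ⟨0, [], 0⟩, by simp [Solver.size], ?_⟩
    have h1 : soundAdv d A A.readOff = 0 := prob_of_isEmpty _ _
    rw [h1]
    have h2 : ∀ A' : Solver B, 0 ≤ qdlogAdv d A' := fun A' => prob_nonneg _ _
    have := h2 ⟨0, [], 0⟩
    positivity
  obtain ⟨A₁, hA₁, h₁⟩ := exists_solver_of_root (d := d) (A := A) hp
    (E := fun ω => A.runEq₀ d ω ≠ 0 ∧ (A.runEq₀ d ω).eval (ω.1.2.2.2 : B.F) = 0) (A.runEq₀ d)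
    (fun _ h => h) (fun _ => A.natDegree_eq₀_le d _ _ _ _)
    fun S j h1 h2 h3 h4 => A.der_eq₀ d _ _ h1 h2 h3 h4 j
  obtain ⟨A₂, hA₂, h₂⟩ := exists_solver_of_root (d := d) (A := A) hp
    (E := fun ω => A.runEq₁ d ω ≠ 0 ∧ (A.runEq₁ d ω).eval (ω.1.2.2.2 : B.F) = 0) (A.runEq₁ d)
    (fun _ h => h) (fun _ => A.natDegree_eq₁_le d _ _ _ _ _ _)
    fun S j h1 h2 h3 h4 => A.der_eq₁ d _ _ h1 h2 h3 h4 j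
  obtain ⟨A₃, hA₃, h₃⟩ := exists_solver_of_quadratic (d := d) (A := A) hp (fun _ h => h)
  refine ⟨A₁, A₂, A₃, by simp [hA₁, hA₂, hA₃], ?_⟩
  refine (prob_mono (A.wins_cases hA)).trans ((prob_or_le _ _).trans ?_)
  have e1 := prob_or_le (Ω := A.Space)
    (fun ω => A.runEq₀ d ω ≠ 0 ∧ (A.runEq₀ d ω).eval (ω.1.2.2.2 : B.F) = 0)
    (fun ω => A.runEq₁ d ω ≠ 0 ∧ (A.runEq₁ d ω).eval (ω.1.2.2.2 : B.F) = 0)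
  have e2 := prob_or_le (Ω := A.Space)
    (fun ω => ((A.runEq₀ d ω).eval (ω.1.2.2.2 : B.F) ≠ 0 ∨
        (A.runEq₁ d ω).eval (ω.1.2.2.2 : B.F) ≠ 0) ∧
      (A.runEq₀ d ω).eval (ω.1.2.2.2 : B.F) +
        (ω.1.2.2.1 : B.F) * (A.runEq₁ d ω).eval (ω.1.2.2.2 : B.F) +
        (ω.1.2.2.1 : B.F) ^ 2 * (A.runEq₂ d ω).eval (ω.1.2.2.2 : B.F) = 0) (A.Lucky d)
  have e3 := A.prob_lucky_le (d := d)
  linarith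

end Prover

end Statistical

/-! ### Computing in the exponent -/

section Exponent

variable {B : BilinearGroup} {Ω : Type} {S S' : Set (Ω → Val B)} {g : Ω → B.G₁} {a b c n d : ℕ}
  {u v z : Ω → B.F} {p : Ω → Prop}

/-- A scalar held as an exponent of `g`. -/
def ex (g : Ω → B.G₁) (u : Ω → B.F) : Ω → Val B := lf fun ω => u ω • g ω

lemma Der.exSmul (h : Der S a (sc u)) (h' : Der S b (ex g v)) :
    Der S (a + b + 1) (ex g fun ω => u ω * v ω) :=
  (h.smulL h').congr fun ω => by simp only [lf, ex, smul_smul]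

lemma Der.exAdd (h : Der S a (ex g u)) (h' : Der S b (ex g v)) :
    Der S (a + b + 1) (ex g fun ω => u ω + v ω) :=
  (h.addL h').congr fun ω => by simp only [lf, ex, add_smul]

lemma Der.exSub (h : Der S a (ex g u)) (h' : Der S b (ex g v)) :
    Der S (a + b + 3) (ex g fun ω => u ω - v ω) :=
  ((h.exAdd ((Der.sconst (-1)).exSmul h')).congr fun ω => by
    simp only [ex, lf, neg_one_mul, sub_eq_add_neg]).le (by omega)

lemma Der.exSum {ι : Type*} (J : Finset ι) {f : ι → Ω → B.F} (h : ∀ i ∈ J, Der S a (ex g (f i))) :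
    Der S (J.card * (a + 1) + 1) (ex g fun ω => ∑ i ∈ J, f i ω) :=
  (Der.sumL J h).congr fun ω => by simp only [lf, ex, Finset.sum_smul]

lemma Der.exIte (hp : Der S n (sc fun ω => ind (p ω))) (h : Der S a (ex g u)) (h' : Der S b (ex g v)) :
    Der S (2 * n + a + b + 4) (ex g fun ω => ind (p ω) * u ω + ind (¬ p ω) * v ω) :=
  ((hp.exSmul h).exAdd (hp.not.exSmul h')).le (by omega)

lemma card_exps (d : ℕ) : (exps d).card = 2 * d + 1 := by simp [exps]; omega

lemma natAbs_le_of_mem_exps {d : ℕ} {t : ℤ} (ht : t ∈ exps d) : t.natAbs ≤ d := by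
  simp only [exps, Finset.mem_Icc] at ht
  omega

/-- The cost of evaluating a Laurent polynomial. -/
def levCost (d a b : ℕ) : ℕ := (2 * d + 1) * (d * (a + 1) + b + 4) + 1

lemma Der.exLev {st : Ω → ℤ → B.F} (hst : ∀ t ∈ exps d, Der S b (ex g fun ω => st ω t))
    (hz : Der S a (sc z)) :
    Der S (levCost d a b) (ex g fun ω => ∑ t ∈ exps d, st ω t * z ω ^ t) := by
  refine ((Der.exSum (exps d) fun t ht => ((hz.zpow t).exSmul (hst t ht)).le
    (show _ ≤ d * (a + 1) + b + 3 from ?_)).congr fun ω => ?_).le ?_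
  · have := Nat.mul_le_mul_right (a + 1) (natAbs_le_of_mem_exps ht)
    omega
  · simp only [ex, lf, mul_comm]
  · rw [card_exps]
    exact le_of_eq rfl

/-- The coefficients of the quotient by `X - z` of the Laurent polynomial with coefficients `e`. -/
def divLin {F : Type} [Field F] (d : ℕ) (z : F) (e : ℤ → F) (t : ℤ) : F :=
  ∑ k ∈ (exps d).filter (t < ·), z ^ (k - t - 1).toNat * e k

/-- Comparing coefficients gives `q_t = e_{t+1} + z q_{t+1}`, which is solved downwards from the
exponent `d`. The solution is linear in `e`, so it can be computed in the exponent. -/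
lemma coeff_eq_divLin {F : Type} [Field F] {z : F} {e q : F[T;T⁻¹]} (he : e ∈ win F d)
    (hq : q ∈ win F d) (h : e = (LaurentPolynomial.T 1 - LaurentPolynomial.C z) * q) {t : ℤ}
    (ht : t ∈ exps d) : q.coeff t = divLin d z (fun k => e.coeff k) t := by
  obtain ⟨j, hj⟩ : ∃ j : ℕ, t = d - j := ⟨(d - t).toNat, by
    simp only [exps, Finset.mem_Icc] at ht
    omega⟩
  have h1 : ∀ t, q.coeff t = e.coeff (t + 1) + z * q.coeff (t + 1) := fun t => by
    rw [h, coeff_linear_mul, sub_add_cancel]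
  induction j generalizing t with
  | zero =>
    have h0 : (exps d).filter (t < ·) = ∅ := by
      refine Finset.filter_false_of_mem fun k hk => ?_
      simp only [exps, Finset.mem_Icc] at hk
      omega
    have h2 : t + 1 ∉ exps d := by simp [exps]; omega
    rw [divLin, h0, Finset.sum_empty, h1, hq _ h2, he _ h2, mul_zero, add_zero]
  | succ j ih =>
    have ht' : t + 1 ∈ exps d := by
      simp only [exps, Finset.mem_Icc] at ht ⊢
      omega
    have h0 : (exps d).filter (t < ·) = insert (t + 1) ((exps d).filter (t + 1 < ·)) := by
      ext k
      simp only [Finset.mem_filter, Finset.mem_insert]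
      constructor
      · rintro ⟨hk, hk'⟩
        rcases eq_or_ne k (t + 1) with h | h
        · exact .inl h
        · exact .inr ⟨hk, by omega⟩
      · rintro (rfl | ⟨hk, hk'⟩)
        · exact ⟨ht', by omega⟩
        · exact ⟨hk, by omega⟩
    rw [divLin, h0, Finset.sum_insert (by simp), h1, ih ht' (by omega), divLin, Finset.mul_sum]
    congr 1
    · simp
    · refine Finset.sum_congr rfl fun k hk => ?_
      have hk := (Finset.mem_filter.1 hk).2
      rw [show (k - t - 1).toNat = (k - (t + 1) - 1).toNat + 1 by omega, pow_succ]
      ring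

/-- The cost of a division by a linear factor. -/
def divCost (d a b : ℕ) : ℕ := (2 * d + 1) * (2 * d * (a + 1) + b + 3) + 1

lemma Der.exDivLin {st : Ω → ℤ → B.F} (hst : ∀ t ∈ exps d, Der S b (ex g fun ω => st ω t))
    (hz : Der S a (sc z)) {t : ℤ} (ht : t ∈ exps d) :
    Der S (divCost d a b) (ex g fun ω => divLin d (z ω) (st ω) t) := by
  refine (Der.exSum ((exps d).filter (t < ·)) fun k hk => ((hz.pow (k - t - 1).toNat).exSmul
    (hst k (Finset.mem_filter.1 hk).1)).le (show _ ≤ 2 * d * (a + 1) + b + 2 from ?_)).le ?_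
  · have hk := (Finset.mem_filter.1 hk).1
    simp only [exps, Finset.mem_Icc] at hk ht
    have := Nat.mul_le_mul_right (a + 1) (show (k - t - 1).toNat ≤ 2 * d by omega)
    omega
  · have := Nat.mul_le_mul_right (2 * d * (a + 1) + b + 3) ((Finset.card_filter_le (exps d) (t < ·)))
    rw [card_exps] at this
    exact Nat.add_le_add_right this 1

end Exponent

/-! ### Computing the honest proof in the exponent -/

section HonestProof

open LaurentPolynomial

variable {B : BilinearGroup} {Ω : Type} {S : Set (Ω → Val B)} {g : Ω → B.G₁} {a b c n d K : ℕ}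
  {pts : ℕ → Ω → B.F} {T : Ω → Finset B.F}

lemma coeff_C {F : Type} [Field F] (c : F) (t : ℤ) :
    (LaurentPolynomial.C c : F[T;T⁻¹]).coeff t = if t = 0 then c else 0 := by
  rw [show (LaurentPolynomial.C c : F[T;T⁻¹]) = AddMonoidAlgebra.single 0 c from rfl,
    AddMonoidAlgebra.coeff_single, Finsupp.single_apply]
  exact if_congr eq_comm rfl rfl

/-- The cost of computing a quotient `(f - γ) / Z`. -/
def quoCost (d n c b : ℕ) : ℕ :=
  (2 * d + 1) * b + n * ((2 * d + 1) * (2 * freshCost n c + divCost d c (levCost d c 0 + 3) + 4))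

/-- Adding a point `z` turns the quotient `q` into `(q - q(z)) / (X - z)`. This is linear in the
coefficients of `q`, with scalars that depend on `z` alone; exponents of `g` are thus enough. -/
lemma Der.quo (h : DynSet S n c pts T) {f : Ω → B.F[T;T⁻¹]} (hf : ∀ ω, f ω ∈ win B.F d)
    (h0 : ∀ ω, (0 : B.F) ∉ T ω) (hc : ∀ t ∈ exps d, Der S b (ex g fun ω => (f ω).coeff t)) {t : ℤ}
    (ht : t ∈ exps d) : Der S (quoCost d n c b) (ex g fun ω => (quo (f ω) (T ω)).coeff t) := by
  have h1 := h.fold (exps d) (fun ω a => .left (a • g ω)) Der.exIte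
    (fun ω U t => (RKZGb.quo (f ω) U).coeff t)
    (fun ω z st t => divLin d z
      (fun k => st k - if k = 0 then ∑ m ∈ exps d, st m * z ^ m else 0) t)
    (b := divCost d c (levCost d c 0 + 3)) (by
      intro ω U z hU hz hzU i hi
      have h0' : (0 : B.F) ∉ insert z U := fun h => h0 ω (Finset.insert_subset hz hU h)
      have hq := (quo_spec (hf ω) fun h => h0' (Finset.mem_insert_of_mem h)).2
      rw [coeff_eq_divLin (Submodule.sub_mem _ hq (C_mem_win d _)) (quo_spec (hf ω) h0').2
        (quo_insert (hf ω) h0' hzU) hi]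
      congr 1
      funext k
      rw [AddMonoidAlgebra.coeff_sub, Finsupp.sub_apply, lev_eq_sum hq]
      rw [coeff_C]) (by
      intro k hk U i hi
      set S' := S ∪ (fun i ω => Val.left ((RKZGb.quo (f ω) (U ω)).coeff i • g ω)) '' (exps d)
      have hz : Der S' c (sc (pts k)) := (h.pt k hk).weaken Set.subset_union_left
      have hst : ∀ t ∈ exps d, Der S' 0 (ex g fun ω => (RKZGb.quo (f ω) (U ω)).coeff t) :=
        fun t ht => Der.of_mem (.inr ⟨t, ht, rfl⟩)
      refine Der.exDivLin (fun t ht => ?_) hz hi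
      rcases eq_or_ne t 0 with rfl | h
      · simp only [if_true]
        exact ((hst 0 ht).exSub (Der.exLev hst hz)).le (by omega)
      · simp only [if_neg h, sub_zero]
        exact (hst t ht).le (by omega))
  have h2 : Derives S ((2 * d + 1) * b)
      ((fun t ω => Val.left ((RKZGb.quo (f ω) ∅).coeff t • g ω)) '' (exps d)) := by
    rw [← card_exps]
    refine Derives.family _ fun t ht => (hc t ht).congr fun ω => ?_
    rw [quo_eq (q := f ω) (by simp [interp_empty, vanish])]
    rfl
  refine ((h2.trans h1).get ⟨t, ht, rfl⟩).le ?_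
  rw [card_exps]
  exact le_of_eq rfl

/-- First occurrences pick exactly one index for each point, so that repeated listing does not count
a point twice. -/
lemma DynSet.sum_eq {M : Type*} [AddCommMonoid M] (h : DynSet S n c pts T) (F : B.F → M) (ω : Ω) :
    ∑ z ∈ T ω, F z = ∑ k ∈ (Finset.range n).filter
      (fun k => pts k ω ∈ T ω ∧ ∀ i ∈ Finset.range k, ¬ pts i ω = pts k ω), F (pts k ω) := by
  symm
  refine Finset.sum_bij (fun k _ => pts k ω) (fun k hk => (Finset.mem_filter.1 hk).2.1) ?_ ?_
    fun _ _ => rfl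
  · intro k hk m hm heq
    rcases lt_trichotomy k m with h | h | h
    · exact absurd heq ((Finset.mem_filter.1 hm).2.2 k (Finset.mem_range.2 h))
    · exact h
    · exact absurd heq.symm ((Finset.mem_filter.1 hk).2.2 m (Finset.mem_range.2 h))
  · intro z hz
    have hex : ∃ k, k < n ∧ pts k ω = z := by
      obtain ⟨k, hk, h⟩ := h.cover ω z hz
      exact ⟨k, hk, h⟩
    classical
    -- The least index of a point is its first occurrence.
    obtain ⟨hk, hkz⟩ := Nat.find_spec hex
    refine ⟨Nat.find hex, Finset.mem_filter.2 ⟨Finset.mem_range.2 hk, by rwa [hkz], ?_⟩, hkz⟩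
    intro i hi heq
    have hi := Finset.mem_range.1 hi
    exact Nat.find_min hex hi ⟨hi.trans hk, heq.trans hkz⟩

lemma DynSet.erase (h : DynSet S n c pts T) {k : ℕ} (hk : k < n) :
    DynSet S n (3 * c + 6) pts (fun ω => (T ω).erase (pts k ω)) where
  pt i hi := (h.pt i hi).le (by omega)
  mem i hi := by
    refine (((h.mem i hi).and ((h.pt i hi).eq (h.pt k hk)).not).congr fun ω => ?_).le (by omega)
    simp only [sc, Finset.mem_erase]
    congr 2
    exact propext and_comm
  cover ω z hz := h.cover ω z (Finset.mem_of_mem_erase hz)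

/-- Lagrange's formula with basis values written as quotients of vanishing polynomials. The weights
are scalars computed from the points, and the values of `f` enter linearly. -/
lemma eval_interp_eq_sum (f : B.F[T;T⁻¹]) (T : Finset B.F) (μ : B.F) :
    (interp f T).eval μ = ∑ z ∈ T, (vanish (T.erase z)).eval μ *
      ((vanish (T.erase z)).eval z)⁻¹ * lev f z := by
  rw [interp, Lagrange.interpolate_apply, Polynomial.eval_finsetSum]
  refine Finset.sum_congr rfl fun z _ => ?_
  simp only [Lagrange.basis, Polynomial.eval_mul, Polynomial.eval_C, Polynomial.eval_prod,
    Lagrange.basisDivisor, Polynomial.eval_sub, Polynomial.eval_X, eval_vanish, id]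
  rw [Finset.prod_mul_distrib, Finset.prod_inv_distrib]
  ring

/-- The cost of evaluating an interpolation polynomial. -/
def interpCost (d n c b : ℕ) : ℕ :=
  n * (freshCost n c + 2 * vanishCost n (3 * c + 6) + levCost d c b + 6) + 1

/-- In Lagrange's formula the points and `μ` are known scalars, so only the values of `f` have to be
handled in the exponent. -/
lemma Der.interp (h : DynSet S n c pts T) {f : Ω → B.F[T;T⁻¹]} (hf : ∀ ω, f ω ∈ win B.F d)
    (hc : ∀ t ∈ exps d, Der S b (ex g fun ω => (f ω).coeff t)) {μ : Ω → B.F} (hμ : Der S c (sc μ)) :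
    Der S (interpCost d n c b) (ex g fun ω => (interp (f ω) (T ω)).eval (μ ω)) := by
  refine ((Der.exSum (g := g) (Finset.range n) (a := freshCost n c + 2 * vanishCost n (3 * c + 6) +
    levCost d c b + 5) (f := fun k ω => ind (pts k ω ∈ T ω ∧ ∀ i ∈ Finset.range k,
      ¬ pts i ω = pts k ω) * ((vanish ((T ω).erase (pts k ω))).eval (μ ω) *
      ((vanish ((T ω).erase (pts k ω))).eval (pts k ω))⁻¹ * ∑ t ∈ exps d,
        (f ω).coeff t * pts k ω ^ t)) fun k hk => ?_).congr fun ω => ?_).le ?_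
  · have hk := Finset.mem_range.1 hk
    have he := h.erase hk
    exact ((h.fresh hk).exSmul (((he.evalVanish (hμ.le (by omega))).mul
      (he.evalVanish (he.pt k hk)).inv).exSmul (Der.exLev hc (h.pt k hk)))).le (by omega)
  · simp only [ex, lf]
    congr 2
    rw [eval_interp_eq_sum, h.sum_eq, Finset.sum_filter]
    refine Finset.sum_congr rfl fun k _ => ?_
    rw [lev_eq_sum (hf ω)]
    split_ifs with hk
    · rw [ind_true hk, one_mul]
    · rw [ind_false hk, zero_mul]
  · rw [Finset.card_range]
    exact le_of_eq rfl

section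

variable {l : List (Ω → Val B)} {pt : Fin n → ℕ} {flag : Fin K → Fin n → ℕ}
  {f : Ω → Fin K → B.F[T;T⁻¹]} {x β μ : Ω → B.F}

/-- The cost of computing a coefficient of the first quotient. -/
def pCost (d K n : ℕ) : ℕ := K * (3 * K + quoCost d n (memCost n) 0 + 3) + 1

lemma Der.pPoly (hl : ∀ v ∈ l, v ∈ S) (hz : zeroVal ∈ S) (hf : ∀ ω i, f ω i ∈ win B.F d)
    (h0 : ∀ ω, (0 : B.F) ∉ readS (l.map (· ω)) pt)
    (hc : ∀ i, ∀ t ∈ exps d, (ex g fun ω => (f ω i).coeff t) ∈ S) (hβ : Der S 2 (sc β)) {t : ℤ}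
    (ht : t ∈ exps d) : Der S (pCost d K n) (ex g fun ω =>
      (pPoly (readS (l.map (· ω)) pt) (readSi (l.map (· ω)) pt flag) (f ω)
        (gams (f ω) (readSi (l.map (· ω)) pt flag)) (β ω)).coeff t) := by
  refine ((Der.exSum (g := g) (Finset.univ : Finset (Fin K)) (a := 3 * K +
    quoCost d n (memCost n) 0 + 2) (f := fun i ω => β ω ^ (i : ℕ) *
      (RKZGb.quo (f ω i) (readSi (l.map (· ω)) pt flag i)).coeff t) fun i _ => ?_).congr
        fun ω => ?_).le ?_
  · have hi := i.2
    exact ((hβ.pow i).exSmul (Der.quo (dynSet_readSi hl hz pt flag i) (fun ω => hf ω i)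
      (fun ω h => h0 ω (readSi_subset _ _ _ _ h)) (fun t ht => Der.of_mem (hc i t ht)) ht)).le
        (by omega)
  · simp only [ex, lf]
    rw [pPoly_eq (hf ω) (h0 ω) (fun i => readSi_subset _ _ _ _), AddMonoidAlgebra.coeff_sum,
      Finset.sum_apply']
    simp only [← LaurentPolynomial.smul_eq_C_mul]
    rfl
  · rw [Finset.card_univ, Fintype.card_fin]
    exact le_of_eq rfl

/-- The cost of computing a coefficient of the numerator of the second quotient. -/
def ellCost (d K n : ℕ) : ℕ :=
  K * (psiCost K n + interpCost d n (memCost n) 0 + 6) + vanishCost n (memCost n) + pCost d K n + 6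

lemma Der.ellPoly (hl : ∀ v ∈ l, v ∈ S) (hz : zeroVal ∈ S) (hf : ∀ ω i, f ω i ∈ win B.F d)
    (h0 : ∀ ω, (0 : B.F) ∉ readS (l.map (· ω)) pt)
    (hc : ∀ i, ∀ t ∈ exps d, (ex g fun ω => (f ω i).coeff t) ∈ S) (hβ : Der S 2 (sc β))
    (hμ : Der S 2 (sc μ)) {t : ℤ} (ht : t ∈ exps d) : Der S (ellCost d K n) (ex g fun ω =>
      (ellPoly (readS (l.map (· ω)) pt) (readSi (l.map (· ω)) pt flag) (f ω) (β ω) (μ ω)).coeff t) := by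
  have hμ' : Der S (memCost n) (sc μ) := hμ.le (by unfold memCost; omega)
  have hterm : ∀ i : Fin K, Der S (psiCost K n + interpCost d n (memCost n) 0 + 5) (ex g fun ω =>
      Psi (readS (l.map (· ω)) pt) (readSi (l.map (· ω)) pt flag) (β ω) (μ ω) i *
        ((f ω i).coeff t - if t = 0
          then (gams (f ω) (readSi (l.map (· ω)) pt flag) i).eval (μ ω) else 0)) := by
    intro i
    refine ((Der.psi hl hz pt flag hβ hμ i).exSmul
      (b := interpCost d n (memCost n) 0 + 3) ?_).le (by omega)
    rcases eq_or_ne t 0 with rfl | h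
    · simp only [if_true]
      exact ((Der.of_mem (hc i 0 ht)).exSub (Der.interp (dynSet_readSi hl hz pt flag i)
        (fun ω => hf ω i) (fun t ht => Der.of_mem (hc i t ht)) hμ')).le (by omega)
    · simp only [if_neg h, sub_zero]
      exact (Der.of_mem (hc i t ht)).le (by omega)
  refine (((Der.exSum Finset.univ fun i _ => hterm i).exSub
    (((dynSet_readS hl hz pt).evalVanish hμ').exSmul
      (Der.pPoly (flag := flag) hl hz hf h0 hc hβ ht))).congr fun ω => ?_).le ?_
  · simp only [ex, lf, RKZGb.ellPoly]
    rw [AddMonoidAlgebra.coeff_sub, Finsupp.sub_apply, AddMonoidAlgebra.coeff_sum,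
      Finset.sum_apply']
    simp only [← LaurentPolynomial.smul_eq_C_mul, AddMonoidAlgebra.coeff_smul, Finsupp.smul_apply,
      AddMonoidAlgebra.coeff_sub, Finsupp.sub_apply, coeff_C, smul_eq_mul]
  · rw [Finset.card_univ, Fintype.card_fin]
    unfold ellCost
    ring_nf
    omega

/-- The first element of the honest proof can be computed from the coefficients of the polynomials in
the exponent. -/
lemma Der.open₁ {s : Ω → Secrets B} (hl : ∀ v ∈ l, v ∈ S) (hz : zeroVal ∈ S)
    (hf : ∀ ω i, f ω i ∈ win B.F d) (h0 : ∀ ω, (0 : B.F) ∉ readS (l.map (· ω)) pt)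
    (hc : ∀ i, ∀ t ∈ exps d, (ex (fun ω => ((s ω).1 : B.G₁)) fun ω => (f ω i).coeff t) ∈ S)
    (hx : (sc fun ω => ((s ω).2.2.2 : B.F)) ∈ S) (hβ : Der S 2 (sc β)) :
    Der S (levCost d 0 (pCost d K n)) (lf fun ω => open₁ d (setup B d (s ω))
      (readS (l.map (· ω)) pt) (readSi (l.map (· ω)) pt flag) (f ω) (β ω)) := by
  refine (Der.exLev (st := fun ω t => (RKZGb.pPoly (readS (l.map (· ω)) pt)
    (readSi (l.map (· ω)) pt flag) (f ω) (gams (f ω) (readSi (l.map (· ω)) pt flag)) (β ω)).coeff t)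
    (fun t ht => Der.pPoly (flag := flag) hl hz hf h0 hc hβ ht)
    (Der.of_mem hx)).congr fun ω => ?_
  have hSi := fun i => readSi_subset (l.map (· ω)) pt flag i
  have h := pPoly_mem (hf ω) (h0 ω) hSi (β ω)
  simp only [ex, lf, RKZGb.open₁]
  rw [expo_setup _ h, lev_eq_sum h]

/-- The coefficients of `w` are obtained from its numerator by `divLin`, in the exponent. Knowing
`x` as a scalar then replaces the powers `g ^ (x ^ i)` of the string. -/
lemma Der.open₂ {s : Ω → Secrets B} (hl : ∀ v ∈ l, v ∈ S) (hz : zeroVal ∈ S)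
    (hf : ∀ ω i, f ω i ∈ win B.F d) (h0 : ∀ ω, (0 : B.F) ∉ readS (l.map (· ω)) pt)
    (hc : ∀ i, ∀ t ∈ exps d, (ex (fun ω => ((s ω).1 : B.G₁)) fun ω => (f ω i).coeff t) ∈ S)
    (hx : (sc fun ω => ((s ω).2.2.2 : B.F)) ∈ S) (hβ : Der S 2 (sc β)) (hμ : Der S 2 (sc μ)) :
    Der S (levCost d 0 (divCost d 2 (ellCost d K n))) (lf fun ω => open₂ d (setup B d (s ω))
      (readS (l.map (· ω)) pt) (readSi (l.map (· ω)) pt flag) (f ω) (β ω) (μ ω)) := by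
  have hdiv : ∀ t ∈ exps d, Der S (divCost d 2 (ellCost d K n)) (ex (fun ω => ((s ω).1 : B.G₁))
      fun ω => divLin d (μ ω) (fun k => (RKZGb.ellPoly (readS (l.map (· ω)) pt)
        (readSi (l.map (· ω)) pt flag) (f ω) (β ω) (μ ω)).coeff k) t) := fun t ht =>
    Der.exDivLin (fun k hk => Der.ellPoly (flag := flag) hl hz hf h0 hc hβ hμ hk) hμ ht
  refine (Der.exLev hdiv (Der.of_mem hx)).congr fun ω => ?_
  have hSi := fun i => readSi_subset (l.map (· ω)) pt flag i
  obtain ⟨h1, h2⟩ := wPoly_spec (hf ω) (h0 ω) hSi (β ω) (μ ω)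
  simp only [ex, lf, RKZGb.open₂]
  rw [expo_setup _ h2, lev_eq_sum h2]
  congr 2
  refine Finset.sum_congr rfl fun t ht => ?_
  rw [coeff_eq_divLin (ellPoly_mem (hf ω) (h0 ω) hSi (β ω) (μ ω)) h2 h1 ht]

end

end HonestProof

/-! ### The hiding game -/

section OfCoeffs

variable {F : Type} [Field F] {d : ℕ}

lemma coeff_ofCoeffs (a : nzExps d → F) (t : ℤ) :
    (ofCoeffs a).coeff t = if h : t ∈ nzExps d then a ⟨t, h⟩ else 0 := by
  rw [ofCoeffs, AddMonoidAlgebra.coeff_sum, Finset.sum_apply']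
  simp only [← LaurentPolynomial.single_eq_C_mul_T, AddMonoidAlgebra.coeff_single,
    Finsupp.single_apply]
  split_ifs with h
  · rw [Finset.sum_eq_single ⟨t, h⟩ (fun i _ hi => if_neg fun h' => hi (Subtype.ext h'))
      (fun h => absurd (Finset.mem_univ _) h), if_pos rfl]
  · exact Finset.sum_eq_zero fun i _ => if_neg fun (h' : (i : ℤ) = t) => h (h' ▸ i.2)

lemma lev_ofCoeffs (a : nzExps d → F) (z : F) :
    lev (ofCoeffs a) z = ∑ i : nzExps d, a i * z ^ (i : ℤ) := by
  rw [lev_eq_sum (J := nzExps d) fun t ht => by rw [coeff_ofCoeffs, dif_neg ht],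
    ← Finset.sum_coe_sort]
  exact Finset.sum_congr rfl fun i _ => by rw [coeff_ofCoeffs, dif_pos i.2]

lemma card_nzExps (d : ℕ) : (nzExps d).card = 2 * d := by
  rw [nzExps, Finset.card_erase_of_mem (by simp [exps]), card_exps]
  rfl

/-- The coefficients of `X * Z_S`. -/
def maskCoeffs (d : ℕ) (S : Finset F) (i : nzExps d) : F :=
  if 0 < (i : ℤ) then (vanish S).coeff ((i : ℤ) - 1).toNat else 0

/-- The exponents of `X Z_S` are `1, …, |S| + 1`. They are admissible precisely because fewer than
`d` values are revealed, and the factor `X` avoids the constant term. -/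
lemma lev_maskCoeffs {S : Finset F} (hS : S.card < d) (z : F) :
    lev (ofCoeffs (maskCoeffs d S)) z = z * (vanish S).eval z := by
  rw [lev_ofCoeffs, Polynomial.eval_eq_sum_range' (n := d) (by rwa [natDegree_vanish]),
    Finset.mul_sum]
  simp only [maskCoeffs, ite_mul, zero_mul]
  rw [← Finset.sum_filter]
  refine Finset.sum_bij (fun i _ => ((i : ℤ) - 1).toNat) ?_ ?_ ?_ ?_
  · rintro ⟨i, hi⟩ h
    simp only [nzExps, exps, Finset.mem_erase, Finset.mem_Icc,
      Finset.mem_range] at h hi ⊢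
    omega
  · rintro ⟨i, hi⟩ h ⟨k, hk⟩ h' heq
    simp only [Finset.mem_filter] at h h' heq
    exact Subtype.ext (by simp only; omega)
  · intro k hk
    have hk := Finset.mem_range.1 hk
    refine ⟨⟨(k : ℤ) + 1, ?_⟩, ?_, ?_⟩
    · simp only [nzExps, exps, Finset.mem_erase, Finset.mem_Icc]
      omega
    · simp only [Finset.mem_filter, Finset.mem_univ, true_and]
      omega
    · simp
  · rintro ⟨i, hi⟩ h
    simp only [Finset.mem_filter, Finset.mem_univ, true_and] at h ⊢
    obtain ⟨k, rfl⟩ : ∃ k : ℕ, i = k + 1 := ⟨(i - 1).toNat, by omega⟩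
    rw [show ((k : ℤ) + 1 - 1).toNat = k by omega, show (k : ℤ) + 1 = ((k + 1 : ℕ) : ℤ) by simp,
      zpow_natCast, pow_succ]
    ring

lemma lev_ofCoeffs_add_mul (a b : nzExps d → F) (c z : F) :
    lev (ofCoeffs fun i => a i + c * b i) z = lev (ofCoeffs a) z + c * lev (ofCoeffs b) z := by
  simp only [lev_ofCoeffs, Finset.mul_sum, ← Finset.sum_add_distrib]
  exact Finset.sum_congr rfl fun i _ => by ring

lemma ofCoeffs_mem_win (a : nzExps d → F) : ofCoeffs a ∈ win F d := fun i hi => by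
  rw [coeff_ofCoeffs, dif_neg fun h => hi (nzExps_subset d h)]

end OfCoeffs

/-! ### The hiding game, simulated with coefficients in the exponent -/

namespace Spy

variable {B : BilinearGroup} {K d : ℕ} (A : Spy B K)

/-- The sample space of the hiding game. -/
abbrev Space (d : ℕ) : Type := Secrets B × (Fin K → nzExps d → B.F) × (Fin A.coins → B.F)

variable {A}

/-- The random polynomials. -/
def pol (ω : A.Space d) (i : Fin K) : B.F[T;T⁻¹] := ofCoeffs (ω.2.1 i)

/-- The commitments. -/
def com (ω : A.Space d) (i : Fin K) : B.G₁ := commit d (setup B d ω.1) (pol ω i)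

variable (A) in
/-- The memory after the choice of the points. -/
def start (s : Secrets B) (Fc : Fin K → B.G₁) (co : Fin A.coins → B.F) : Mem B :=
  run A.prog₀ (srsCells d (setup B d s) ++ (List.ofFn fun i => Val.left (Fc i)) ++ coinCells co)

/-- The memory in the course of the game. -/
def mem₀ (ω : A.Space d) : Mem B := A.start (d := d) ω.1 (com ω) ω.2.2

def mem₁ (ω : A.Space d) : Mem B := run A.prog₁ (mem₀ ω ++ A.valueCells (mem₀ ω) (pol ω))

/-- The points and the subsets chosen by the adversary. -/
def pts (ω : A.Space d) : Finset B.F := readS (mem₀ ω) A.pt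

def sub (ω : A.Space d) : Fin K → Finset B.F := readSi (mem₀ ω) A.pt A.flag

def mem₂ (ω : A.Space d) : Mem B := run A.prog₂ (mem₁ ω ++
  [.left (open₁ d (setup B d ω.1) (pts ω) (sub ω) (pol ω) ((mem₁ ω).fld A.beta))])

def mem₃ (ω : A.Space d) : Mem B := run A.prog₃ (mem₂ ω ++
  [.left (open₂ d (setup B d ω.1) (pts ω) (sub ω) (pol ω) ((mem₁ ω).fld A.beta)
    ((mem₂ ω).fld A.mu))])

/-- The adversary wins with the `j`-th polynomial. -/
def WinsAt (j : Fin K) (ω : A.Space d) : Prop :=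
  (0 : B.F) ∉ pts ω ∧ (sub ω j).card < d ∧ (mem₃ ω).fld (A.loc j) ≠ 0 ∧
    (mem₃ ω).fld (A.loc j) ∉ sub ω j ∧
    (mem₃ ω).fld (A.guess j) = lev (pol ω j) ((mem₃ ω).fld (A.loc j))

lemma exists_winsAt {ω : A.Space d} (h : A.Wins d ω.1 (fun i => ofCoeffs (ω.2.1 i)) ω.2.2) :
    ∃ j, WinsAt j ω := by
  obtain ⟨h0, j, hj⟩ := h
  exact ⟨j, h0, hj⟩

section Symbolic

variable {Ω : Type} (w : Ω → A.Space d)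

/-- The input of the adversary, and its memory in the course of the game, as symbolic memories. -/
def inputSym : List (Ω → Val B) :=
  srsSym d (fun z => setup B d (w z).1) ++ (List.ofFn fun i => lf fun z => com (w z) i) ++
    coinSym fun z => (w z).2.2

def sym₀ : List (Ω → Val B) := runF A.prog₀ (inputSym w)

/-- The revealed value for the `i`-th polynomial and the `k`-th point. -/
def valueAt (ω : A.Space d) (i : Fin K) (k : Fin A.points) : B.F :=
  if (mem₀ ω).fld (A.pt k) ∈ sub ω i then lev (pol ω i) ((mem₀ ω).fld (A.pt k)) else 0

def valueSym : List (Ω → Val B) :=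
  (List.ofFn fun i : Fin K => List.ofFn fun k : Fin A.points =>
    sc fun z => valueAt (w z) i k).flatten

def sym₁ : List (Ω → Val B) := runF A.prog₁ (sym₀ w ++ valueSym w)

def sym₂ : List (Ω → Val B) := runF A.prog₂ (sym₁ w ++ [lf fun z =>
  open₁ d (setup B d (w z).1) (pts (w z)) (sub (w z)) (pol (w z)) ((mem₁ (w z)).fld A.beta)])

def sym₃ : List (Ω → Val B) := runF A.prog₃ (sym₂ w ++ [lf fun z =>
  open₂ d (setup B d (w z).1) (pts (w z)) (sub (w z)) (pol (w z)) ((mem₁ (w z)).fld A.beta)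
    ((mem₂ (w z)).fld A.mu)])

lemma sym₀_map (z : Ω) : (sym₀ w).map (· z) = mem₀ (w z) := by
  rw [sym₀, ← run_map, inputSym, List.map_append, List.map_append, srsSym_map, coinSym_map]
  simp [mem₀, start, Function.comp_def, lf]

lemma valueSym_map (z : Ω) :
    (valueSym w).map (· z) = A.valueCells (mem₀ (w z)) (pol (w z)) := by
  simp only [valueSym, valueCells, List.map_flatten, List.map_ofFn, Function.comp_def]
  rfl

lemma sym₁_map (z : Ω) : (sym₁ w).map (· z) = mem₁ (w z) := by
  rw [sym₁, ← run_map, List.map_append, sym₀_map, valueSym_map]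
  rfl

lemma sym₂_map (z : Ω) : (sym₂ w).map (· z) = mem₂ (w z) := by
  rw [sym₂, ← run_map, List.map_append, sym₁_map]
  rfl

lemma sym₃_map (z : Ω) : (sym₃ w).map (· z) = mem₃ (w z) := by
  rw [sym₃, ← run_map, List.map_append, sym₂_map]
  rfl

variable {w} {S : Set (Ω → Val B)}

lemma dynSet_sub (hl : ∀ v ∈ sym₀ w, v ∈ S) (hz : zeroVal ∈ S) (i : Fin K) :
    DynSet S A.points (memCost A.points) (ptsOf fun z k => (mem₀ (w z)).fld (A.pt k))
      (fun z => sub (w z) i) := by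
  have := dynSet_readSi hl hz A.pt A.flag i
  simp only [sym₀_map] at this
  exact this

/-- The cost of playing the hiding game, from the choice of the points on. -/
def gameCost (d K n : ℕ) : ℕ :=
  levCost d 0 (pCost d K n) + levCost d 0 (divCost d 2 (ellCost d K n))

/-- The adversary can be run by anyone who knows `x`, the revealed values and, in the exponent, the
coefficients of the polynomials. -/
lemma derives (hl : ∀ v ∈ sym₀ w, v ∈ S) (hz : zeroVal ∈ S) (hval : ∀ v ∈ valueSym w, v ∈ S)
    (h0 : ∀ z, (0 : B.F) ∉ pts (w z))
    (hc : ∀ i, ∀ t ∈ exps d, (ex (fun z => ((w z).1.1 : B.G₁)) fun z => (pol (w z) i).coeff t) ∈ S)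
    (hx : (sc fun z => ((w z).1.2.2.2 : B.F)) ∈ S) :
    Derives S (A.prog₁.length + A.prog₂.length + A.prog₃.length + gameCost d K A.points)
      {v | v ∈ sym₃ w} := by
  have h0' : ∀ z, (0 : B.F) ∉ readS ((sym₀ w).map (· z)) A.pt := fun z => by
    rw [sym₀_map]
    exact h0 z
  have h1 := Derives.simulate (S := S) A.prog₁ (l := sym₀ w ++ valueSym w) (fun v hv =>
    (List.mem_append.1 hv).elim (hl v) (hval v)) hz
  have hβ : ∀ {S'}, (∀ v ∈ sym₁ w, v ∈ S') → zeroVal ∈ S' →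
      Der S' 2 (sc fun z => (mem₁ (w z)).fld A.beta) := fun h h' => by
    have := Der.fld h h' A.beta
    simp only [sym₁_map] at this
    exact this
  have hμ : ∀ {S'}, (∀ v ∈ sym₂ w, v ∈ S') → zeroVal ∈ S' →
      Der S' 2 (sc fun z => (mem₂ (w z)).fld A.mu) := fun h h' => by
    have := Der.fld h h' A.mu
    simp only [sym₂_map] at this
    exact this
  have h2 := Der.open₁ (S := S ∪ {v | v ∈ sym₁ w}) (pt := A.pt) (flag := A.flag)
    (s := fun z => (w z).1) (f := fun z => pol (w z)) (l := sym₀ w)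
    (fun v hv => .inl (hl v hv)) (.inl hz) (fun z i => ofCoeffs_mem_win _) h0'
    (fun i t ht => .inl (hc i t ht)) (.inl hx) (hβ (fun v hv => .inr hv) (.inl hz))
  simp only [sym₀_map] at h2
  have h3 := fun {S'} => Derives.simulate (S := S') A.prog₂ (l := sym₁ w ++ [lf fun z =>
    open₁ d (setup B d (w z).1) (pts (w z)) (sub (w z)) (pol (w z)) ((mem₁ (w z)).fld A.beta)])
  have h5 := fun {S'} => Derives.simulate (S := S') A.prog₃ (l := sym₂ w ++ [lf fun z =>
    open₂ d (setup B d (w z).1) (pts (w z)) (sub (w z)) (pol (w z)) ((mem₁ (w z)).fld A.beta)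
      ((mem₂ (w z)).fld A.mu)])
  have k := (h1.keep.next h2).next (h3 (fun v hv => (List.mem_append.1 hv).elim
    (fun h => .inl (.inr h)) fun h => .inr (List.mem_singleton.1 h)) (.inl (.inl hz)))
  have h4 := Der.open₂ (S := S ∪ {v | v ∈ sym₁ w} ∪ {lf fun z => open₁ d (setup B d (w z).1)
      (pts (w z)) (sub (w z)) (pol (w z)) ((mem₁ (w z)).fld A.beta)} ∪ {v | v ∈ sym₂ w})
    (pt := A.pt) (flag := A.flag) (s := fun z => (w z).1) (f := fun z => pol (w z)) (l := sym₀ w)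
    (fun v hv => .inl (.inl (.inl (hl v hv)))) (.inl (.inl (.inl hz)))
    (fun z i => ofCoeffs_mem_win _) h0' (fun i t ht => .inl (.inl (.inl (hc i t ht))))
    (.inl (.inl (.inl hx))) (hβ (fun v hv => .inl (.inl (.inr hv))) (.inl (.inl (.inl hz))))
    (hμ (fun v hv => .inr hv) (.inl (.inl (.inl hz))))
  simp only [sym₀_map] at h4
  refine (((k.next h4).next (h5 (fun v hv => (List.mem_append.1 hv).elim
    (fun h => .inl (.inr h)) fun h => .inr (List.mem_singleton.1 h)) (.inl (.inl (.inl (.inl hz)))))).sub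
      Set.subset_union_right).le ?_
  unfold gameCost
  omega

end Symbolic

end Spy

/-! ### Hiding: the reduction to discrete logarithms -/

section MaskCoefficients

variable {B : BilinearGroup} {Ω : Type} {S : Set (Ω → Val B)} {n c d : ℕ}
  {pts : ℕ → Ω → B.F} {T : Ω → Finset B.F}

/-- The cost of computing a coefficient of `X * Z_T`. -/
def maskCost (d n c : ℕ) : ℕ := d * 1 + n * (d * (2 * freshCost n c + (c + 5) + 4)) + 1

/-- Multiplying by `X - z` changes coefficient `m` into `c_{m-1} - z c_m`. No higher coefficient is
involved, so it is consistent to keep only those below `d`. -/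
lemma Der.maskCoeffs (h : DynSet S n c pts T) (k : nzExps d) :
    Der S (maskCost d n c) (sc fun ω => maskCoeffs d (T ω) k) := by
  rcases lt_or_ge 0 (k : ℤ) with hk | hk
  swap
  · refine ((Der.sconst 0).congr fun ω => ?_).le (by unfold maskCost; omega)
    simp only [sc, RKZGb.maskCoeffs, if_neg hk.not_gt]
  have h1 := h.fold (Finset.range d) (fun _ a => .scalar a)
    (fun hp h h' => ((hp.mul h).add (hp.not.mul h')).le (by omega))
    (fun _ U m => (vanish U).coeff m)
    (fun ω z st m => (if m = 0 then 0 else st (m - 1)) - z * st m) (b := c + 5)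
    (by
      intro ω U z _ _ hzU m _
      rw [vanish_insert hzU, sub_mul, Polynomial.coeff_sub, Polynomial.coeff_C_mul]
      rcases m with _ | m
      · simp
      · simp [Polynomial.coeff_X_mul]) (by
      intro k hk U m hm
      have hst : ∀ m ∈ Finset.range d, Der (S ∪ (fun (m : ℕ) ω => (Val.scalar
          ((vanish (U ω)).coeff m) : Val B)) '' (Finset.range d)) 0
            (sc fun ω => (vanish (U ω)).coeff m) := fun m hm => Der.of_mem (.inr ⟨m, hm, rfl⟩)
      have hz : Der (S ∪ (fun (m : ℕ) ω => (Val.scalar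
          ((vanish (U ω)).coeff m) : Val B)) '' (Finset.range d)) c (sc (pts k)) :=
        (h.pt k hk).weaken Set.subset_union_left
      refine (Der.sub' (a := 1) ?_ (hz.mul (hst m hm))).le (by omega)
      rcases eq_or_ne m 0 with rfl | h
      · simp only [if_true]
        exact Der.sconst 0
      · simp only [if_neg h]
        exact (hst (m - 1) (Finset.mem_range.2 (by have := Finset.mem_range.1 hm; omega))).le
          zero_le_one)
  have h0 : Derives S (d * 1) ((fun (m : ℕ) (_ : Ω) => (Val.scalar
      ((vanish (∅ : Finset B.F)).coeff m) : Val B)) '' (Finset.range d)) := by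
    conv_lhs => rw [← Finset.card_range d]
    exact Derives.family _ fun m _ => Der.sconst _
  have hk' : ((k : ℤ) - 1).toNat ∈ Finset.range d := by
    have := k.2
    simp only [nzExps, exps, Finset.mem_erase, Finset.mem_Icc] at this
    simp only [Finset.mem_range]
    omega
  refine (((h0.trans h1).get ⟨_, hk', rfl⟩).congr fun ω => ?_).le ?_
  · simp only [sc, RKZGb.maskCoeffs, if_pos hk]
  · rw [Finset.card_range]
    exact Nat.le_succ _

end MaskCoefficients

/-! ### Splitting a random polynomial into a known part and a mask -/

namespace Spy

variable {B : BilinearGroup} {K d : ℕ} {A : Spy B K}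

/-- The coefficients of the random polynomials, where `t * X * Z` is subtracted from the `j`-th one,
`Z` being the vanishing polynomial of the points revealed for it. -/
def base (j : Fin K) (ω : A.Space d) (t : B.F) (i : Fin K) (k : nzExps d) : B.F :=
  ω.2.1 i k - (if i = j then t else 0) * maskCoeffs d (sub ω j) k

/-- The mask vanishes on `S_j`, so revealed values are values of the known part. At every other
non-zero point the mask has a non-zero factor, and a value there determines `t`. -/
lemma lev_pol {j : Fin K} {ω : A.Space d} (hj : (sub ω j).card < d) (t : B.F) (i : Fin K) (y : B.F) :
    lev (pol ω i) y = lev (ofCoeffs (base j ω t i)) y +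
      (if i = j then t else 0) * (y * (vanish (sub ω j)).eval y) := by
  have h : ω.2.1 i = fun k => base j ω t i k + (if i = j then t else 0) *
      maskCoeffs d (sub ω j) k := funext fun k => (sub_add_cancel _ _).symm
  rw [pol, h, lev_ofCoeffs_add_mul, lev_maskCoeffs hj]

lemma com_eq (ω : A.Space d) (i : Fin K) : com ω i =
    ((ω.1.2.2.1 : B.F) * lev (pol ω i) (ω.1.2.2.2 : B.F)) • (ω.1.1 : B.G₁) :=
  commit_setup _ fun t ht => by rw [pol, coeff_ofCoeffs, dif_neg ht]

/-- The cost of evaluating a polynomial with known coefficients. -/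
def evCost (d a : ℕ) : ℕ := 2 * d * (d * (a + 1) + 4) + 1

lemma _root_.RKZGb.Der.levOfCoeffs {Ω : Type} {S : Set (Ω → Val B)} {a : ℕ}
    {c : Ω → nzExps d → B.F} {y : Ω → B.F} (hc : ∀ k, (sc fun z => c z k) ∈ S)
    (hy : Der S a (sc y)) : Der S (evCost d a) (sc fun z => lev (ofCoeffs (c z)) (y z)) := by
  refine ((Der.sum Finset.univ (a := d * (a + 1) + 3) (f := fun (k : nzExps d) z =>
    c z k * y z ^ (k : ℤ)) fun k _ => ?_).congr fun z => ?_).le ?_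
  · have := Nat.mul_le_mul_right (a + 1) (natAbs_le_of_mem_exps (nzExps_subset d k.2))
    exact ((Der.of_mem (hc k)).mul (hy.zpow k)).le (by omega)
  · simp only [sc, lev_ofCoeffs]
  · rw [Finset.card_univ, Fintype.card_coe, card_nzExps]
    exact le_of_eq rfl

/-- The adversary wins with the `j`-th polynomial, and `b` tells whether the trapdoor `x` is among the
points revealed for it. -/
def Case (j : Fin K) (b : Bool) (ω : A.Space d) : Prop :=
  WinsAt j ω ∧ ((ω.1.2.2.2 : B.F) ∈ sub ω j ↔ b = true)

/-- The discrete logarithm that is embedded into the game. -/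
def target (j : Fin K) (b : Bool) (ω : A.Space d) (t : B.F) : B.F :=
  if b = true then t else lev (pol ω j) (ω.1.2.2.2 : B.F)

lemma target_eq {j : Fin K} {b : Bool} {ω : A.Space d} (h : Case j b ω) (t : B.F) :
    target j b ω t = if b = true then t else
      lev (ofCoeffs (base j ω t j)) (ω.1.2.2.2 : B.F) +
        t * ((ω.1.2.2.2 : B.F) * (vanish (sub ω j)).eval (ω.1.2.2.2 : B.F)) := by
  rw [target, lev_pol h.1.2.1 t, if_pos rfl]

lemma mask_ne_zero {j : Fin K} {b : Bool} {ω : A.Space d} (h : Case j b ω) (hb : ¬ b = true) :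
    (ω.1.2.2.2 : B.F) * (vanish (sub ω j)).eval (ω.1.2.2.2 : B.F) ≠ 0 :=
  mul_ne_zero ω.1.2.2.2.2.1 (eval_vanish_ne_zero fun h' => hb (h.2.1 h'))

/-- The commitments must be produced before `S_j` is chosen. If `x ∉ S_j`, the `j`-th one only needs
`f_j(x)`, the embedded logarithm; if `x ∈ S_j`, the mask vanishes at `x` and the known part
suffices. The bit `b` is the solver's guess of the case. -/
lemma com_eq_base {j : Fin K} {b : Bool} {ω : A.Space d} (h : Case j b ω) (t : B.F) (i : Fin K) :
    com ω i = ((ω.1.2.2.1 : B.F) * if i = j ∧ ¬ b = true then target j b ω t else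
      lev (ofCoeffs (base j ω t i)) (ω.1.2.2.2 : B.F)) • (ω.1.1 : B.G₁) := by
  rw [com_eq]
  congr 2
  split_ifs with hi
  · rw [target, if_neg hi.2, hi.1]
  · rw [lev_pol h.1.2.1 t]
    by_cases hij : i = j
    · have hb : b = true := by
        by_contra hb
        exact hi ⟨hij, hb⟩
      rw [eval_vanish_of_mem (h.2.2 hb), mul_zero, mul_zero, add_zero]
    · rw [if_neg hij, zero_mul, add_zero]

section Reduction

variable {Ω : Type} {w : Ω → A.Space d} {t : Ω → B.F} {j : Fin K} {b : Bool} {S : Set (Ω → Val B)}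

/-- The cost of computing the reference string and the commitments. -/
def inputCost (d K : ℕ) : ℕ := (4 * d + 5) * (d + 5) + K * (evCost d 0 + 3)

/-- Neither `t` nor `S_j` has to be known here: the coefficients of the known parts are inputs,
although in the game they are defined through `S_j`. The generator `h` is obtained as a multiple of
the fixed `h₀`. -/
lemma derives_input (hw : ∀ z, Case j b (w z)) (r : Ω → B.F) (h₀ : B.G₂)
    (hr : ∀ z, r z • h₀ = ((w z).1.2.1 : B.G₂))
    (hg : (lf fun z => ((w z).1.1 : B.G₁)) ∈ S)
    (ha : (ex (fun z => ((w z).1.1 : B.G₁)) fun z => target j b (w z) (t z)) ∈ S)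
    (hrS : sc r ∈ S) (hα : (sc fun z => ((w z).1.2.2.1 : B.F)) ∈ S)
    (hx : (sc fun z => ((w z).1.2.2.2 : B.F)) ∈ S)
    (hbase : ∀ i k, (sc fun z => base j (w z) (t z) i k) ∈ S)
    (hco : ∀ v ∈ coinSym (fun z => (w z).2.2), v ∈ S) :
    Derives S (inputCost d K) {v | v ∈ inputSym w} := by
  have hh : Der S 2 (rt fun z => ((w z).1.2.1 : B.G₂)) :=
    ((Der.of_mem hrS).smulR (Der.const (Val.right h₀))).congr fun z => congrArg Val.right (hr z)
  have hsrs : Derives S ((4 * d + 5) * (d + 5)) {v | v ∈ srsSym d fun z => setup B d (w z).1} := by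
    refine Derives.srs (fun i hi => ?_) (fun i hi => ?_) (hh.le (by omega)) ?_ ?_
    · have := natAbs_le_of_mem_exps hi
      refine ((((Der.of_mem hx).zpow i).smulL (Der.of_mem hg)).congr fun z => ?_).le (by omega)
      simp [lf, setup, hi]
    · have := natAbs_le_of_mem_exps (nzExps_subset d hi)
      refine ((((Der.of_mem hα).mul ((Der.of_mem hx).zpow i)).smulL (Der.of_mem hg)).congr
        fun z => ?_).le (by omega)
      simp [lf, setup, hi]
    · exact ((Der.of_mem hα).smulR hh).le (by omega)
    · exact (((Der.of_mem hα).mul (Der.of_mem hx)).smulR hh).le (by omega)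
  have hcom : Derives S (K * (evCost d 0 + 3))
      ((fun (i : Fin K) => lf fun z => com (w z) i) '' (Finset.univ : Finset (Fin K))) := by
    conv_lhs => rw [← Fintype.card_fin K, ← Finset.card_univ]
    refine Derives.family _ fun i _ => ?_
    by_cases hi : i = j ∧ ¬ b = true
    · refine (((Der.of_mem hα).exSmul (Der.of_mem ha)).congr fun z => ?_).le (by omega)
      simp only [ex, lf]
      rw [com_eq_base (hw z) (t z) i, if_pos hi]
    · refine ((((Der.of_mem hα).mul (Der.levOfCoeffs (hbase i) (Der.of_mem hx))).smulL
        (Der.of_mem hg)).congr fun z => ?_).le (by omega)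
      simp only [lf]
      rw [com_eq_base (hw z) (t z) i, if_neg hi]
  refine ((hsrs.union hcom).union (Derives.refl hco)).mono le_rfl (by unfold inputCost; omega) ?_
  intro v hv
  simp only [inputSym, Set.mem_ofPred_eq, List.mem_append, List.mem_ofFn] at hv
  rcases hv with (hv | ⟨i, rfl⟩) | hv
  · exact .inl (.inl hv)
  · exact .inl (.inr ⟨i, Finset.mem_coe.2 (Finset.mem_univ i), rfl⟩)
  · exact .inr hv

end Reduction

end Spy

/-! ### Running the adversary on masked polynomials and recovering the logarithm -/

namespace Spy

variable {B : BilinearGroup} {K d : ℕ} {A : Spy B K}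

section Reduction

variable {Ω : Type} {w : Ω → A.Space d} {t : Ω → B.F} {j : Fin K} {b : Bool} {S : Set (Ω → Val B)}

/-- The cost of a coefficient in the exponent. -/
def coefCost (d n : ℕ) : ℕ := maskCost d n (memCost n) + 10

lemma der_coeff (h : DynSet S A.points (memCost A.points)
      (ptsOf fun z k => (mem₀ (w z)).fld (A.pt k)) (fun z => sub (w z) j))
    (hg : (lf fun z => ((w z).1.1 : B.G₁)) ∈ S)
    (ht : (ex (fun z => ((w z).1.1 : B.G₁)) t) ∈ S)
    (hbase : ∀ i k, (sc fun z => base j (w z) (t z) i k) ∈ S) (i : Fin K) (k : ℤ) :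
    Der S (coefCost d A.points)
      (ex (fun z => ((w z).1.1 : B.G₁)) fun z => (pol (w z) i).coeff k) := by
  by_cases hk : k ∈ nzExps d
  swap
  · refine ((Der.const (Val.left 0)).congr fun z => ?_).le (by unfold coefCost; omega)
    simp only [ex, lf, pol, coeff_ofCoeffs, dif_neg hk, zero_smul]
  have h1 : Der S 1 (ex (fun z => ((w z).1.1 : B.G₁)) fun z => base j (w z) (t z) i ⟨k, hk⟩) :=
    (Der.of_mem (hbase i ⟨k, hk⟩)).smulL (Der.of_mem hg)
  rcases eq_or_ne i j with hij | hij
  · refine ((h1.exAdd ((Der.maskCoeffs h ⟨k, hk⟩).exSmul (Der.of_mem ht))).congr fun z => ?_).le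
      (by unfold coefCost; omega)
    simp only [ex, lf, pol, coeff_ofCoeffs, dif_pos hk, base, if_pos hij]
    congr 2
    ring
  · refine (h1.congr fun z => ?_).le (by unfold coefCost; omega)
    simp only [ex, lf, pol, coeff_ofCoeffs, dif_pos hk, base, if_neg hij, zero_mul, sub_zero]

/-- The cost of a revealed value. -/
def valueCost (d n : ℕ) : ℕ := memCost n + evCost d (memCost n) + 1

/-- Values are requested only where the mask vanishes, so they can be computed as scalars without
`t`. -/
lemma der_valueAt (hw : ∀ z, Case j b (w z))
    (h : ∀ i, DynSet S A.points (memCost A.points)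
      (ptsOf fun z k => (mem₀ (w z)).fld (A.pt k)) (fun z => sub (w z) i))
    (hbase : ∀ i k, (sc fun z => base j (w z) (t z) i k) ∈ S) (i : Fin K) (k : Fin A.points) :
    Der S (valueCost d A.points) (sc fun z => valueAt (w z) i k) := by
  refine ((((h i).mem k k.2).mul (Der.levOfCoeffs (hbase i) ((h i).pt k k.2))).congr
    fun z => ?_).le (by unfold valueCost; omega)
  simp only [sc, ptsOf, dif_pos k.2, Fin.eta, valueAt]
  split_ifs with hk
  · rw [ind_true hk, one_mul, lev_pol (hw z).1.2.1 (t z)]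
    split_ifs with hij
    · rw [eval_vanish_of_mem (hij ▸ hk), mul_zero, mul_zero, add_zero]
    · rw [zero_mul, add_zero]
  · rw [ind_false hk, zero_mul]

/-- The cost of going back and forth between the mask and the discrete logarithm. -/
def solveCost (d n : ℕ) : ℕ := evCost d 0 + evCost d 2 + 2 * vanishCost n (memCost n) + 20

/-- If `x ∉ S_j`, the target is `base_j(x) + t x Z(x)` with a non-zero slope. Once `S_j` is known,
this is solved for `t` in the exponent. -/
lemma der_mask (hw : ∀ z, Case j b (w z)) (h : DynSet S A.points (memCost A.points)
      (ptsOf fun z k => (mem₀ (w z)).fld (A.pt k)) (fun z => sub (w z) j))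
    (hg : (lf fun z => ((w z).1.1 : B.G₁)) ∈ S)
    (ha : (ex (fun z => ((w z).1.1 : B.G₁)) fun z => target j b (w z) (t z)) ∈ S)
    (hx : (sc fun z => ((w z).1.2.2.2 : B.F)) ∈ S)
    (hbase : ∀ i k, (sc fun z => base j (w z) (t z) i k) ∈ S) :
    Der S (solveCost d A.points) (ex (fun z => ((w z).1.1 : B.G₁)) t) := by
  by_cases hb : b = true
  · refine ((Der.of_mem ha).congr fun z => ?_).le (by unfold solveCost; omega)
    simp only [ex, lf, target, if_pos hb]
  · refine ((((Der.of_mem hx).mul (h.evalVanish ((Der.of_mem hx).le (Nat.zero_le _)))).inv.exSmul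
      ((Der.of_mem ha).exSub ((Der.levOfCoeffs (hbase j) (Der.of_mem hx)).smulL
        (Der.of_mem hg)))).congr fun z => ?_).le (by unfold solveCost; omega)
    simp only [ex, lf]
    rw [target_eq (hw z), if_neg hb, add_sub_cancel_left, mul_comm (t z),
      inv_mul_cancel_left₀ (mask_ne_zero (hw z) hb)]

/-- A winning guess is `base_j(z) + t z Z(z)` with `z ≠ 0` outside `S_j`, so `t` can be recovered as
a scalar; the target is an affine function of `t`. -/
lemma der_target (hw : ∀ z, Case j b (w z)) (h : DynSet S A.points (memCost A.points)
      (ptsOf fun z k => (mem₀ (w z)).fld (A.pt k)) (fun z => sub (w z) j))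
    (hl : ∀ v ∈ sym₃ w, v ∈ S) (hz : zeroVal ∈ S)
    (hx : (sc fun z => ((w z).1.2.2.2 : B.F)) ∈ S)
    (hbase : ∀ i k, (sc fun z => base j (w z) (t z) i k) ∈ S) :
    Der S (solveCost d A.points) (sc fun z => target j b (w z) (t z)) := by
  have hloc := Der.fld hl hz (A.loc j)
  have hguess := Der.fld hl hz (A.guess j)
  simp only [sym₃_map] at hloc hguess
  have ht : Der S (evCost d 2 + vanishCost A.points (memCost A.points) + 12) (sc t) := by
    refine (((hguess.sub' (Der.levOfCoeffs (hbase j) hloc)).mul (hloc.mul (h.evalVanish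
      (hloc.le (by unfold memCost; omega)))).inv).congr fun z => ?_).le (by omega)
    obtain ⟨-, hd, hl0, hlS, hwin⟩ := (hw z).1
    simp only [sc]
    rw [hwin, lev_pol hd (t z), if_pos rfl, add_sub_cancel_left,
      mul_inv_cancel_right₀ (mul_ne_zero hl0 (eval_vanish_ne_zero hlS))]
  by_cases hb : b = true
  · refine (ht.congr fun z => ?_).le (by unfold solveCost; omega)
    simp only [target, if_pos hb, sc]
  · refine (((Der.levOfCoeffs (hbase j) (Der.of_mem hx)).add (ht.mul ((Der.of_mem hx).mul
      (h.evalVanish ((Der.of_mem hx).le (Nat.zero_le _)))))).congr fun z => ?_).le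
        (by unfold solveCost; omega)
    simp only [sc]
    rw [target_eq (hw z), if_neg hb]

/-- The cost of the whole reduction. -/
def hidingCost (d K n size : ℕ) : ℕ :=
  inputCost d K + 1 + size + 2 * solveCost d n + K * (2 * d + 1) * coefCost d n +
    K * n * valueCost d n + gameCost d K n

/-- The order of the stages avoids circularity: the inputs do not need `S_j`, the first program
determines it, and only then `g ^ t` and the coefficients needed for `π₁` and `π₂` become available.
-/
lemma der_target_of_input (hw : ∀ z, Case j b (w z)) (r : Ω → B.F) (h₀ : B.G₂)
    (hr : ∀ z, r z • h₀ = ((w z).1.2.1 : B.G₂))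
    (hg : (lf fun z => ((w z).1.1 : B.G₁)) ∈ S)
    (ha : (ex (fun z => ((w z).1.1 : B.G₁)) fun z => target j b (w z) (t z)) ∈ S)
    (hrS : sc r ∈ S) (hα : (sc fun z => ((w z).1.2.2.1 : B.F)) ∈ S)
    (hx : (sc fun z => ((w z).1.2.2.2 : B.F)) ∈ S)
    (hbase : ∀ i k, (sc fun z => base j (w z) (t z) i k) ∈ S)
    (hco : ∀ v ∈ coinSym (fun z => (w z).2.2), v ∈ S) :
    Der S (hidingCost d K A.points A.size) (sc fun z => target j b (w z) (t z)) := by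
  have h1 := (derives_input hw r h₀ hr hg ha hrS hα hx hbase hco).union
    (Der.const (Ω := Ω) (S := S) (Val.scalar (0 : B.F)))
  have h2 := h1.keep.next (Derives.simulate A.prog₀ (l := inputSym w)
    (fun v hv => .inr (.inl hv)) (.inr (.inr rfl)))
  set S₂ : Set (Ω → Val B) := S ∪ ({v | v ∈ inputSym w} ∪ {fun _ => .scalar 0}) ∪
    {v | v ∈ runF A.prog₀ (inputSym w)} with hS₂
  have hS : S ⊆ S₂ := fun v hv => .inl (.inl hv)
  have hz : zeroVal ∈ S₂ := .inl (.inr (.inr rfl))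
  have hdyn := fun i => dynSet_sub (w := w) (S := S₂) (fun v hv => .inr hv) hz i
  have h3 := h2.next (der_mask hw (hdyn j) (hS hg) (hS ha) (hS hx) fun i k => hS (hbase i k))
  set S₃ : Set (Ω → Val B) := S₂ ∪ {ex (fun z => ((w z).1.1 : B.G₁)) t} with hS₃
  have hS' : S₂ ⊆ S₃ := Set.subset_union_left
  have h4 := Derives.family (S := S₃) ((Finset.univ : Finset (Fin K)) ×ˢ exps d)
    (f := fun i => ex (fun z => ((w z).1.1 : B.G₁)) fun z => (pol (w z) i.1).coeff i.2)
    fun i _ => der_coeff ((hdyn j).weaken hS') (hS' (hS hg)) (.inr rfl)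
      (fun i k => hS' (hS (hbase i k))) i.1 i.2
  have h5 := Derives.family (S := S₃) ((Finset.univ : Finset (Fin K)) ×ˢ
      (Finset.univ : Finset (Fin A.points)))
    (f := fun i => sc fun z => valueAt (w z) i.1 i.2)
    fun i _ => der_valueAt hw (fun i => (hdyn i).weaken hS')
      (fun i k => hS' (hS (hbase i k))) i.1 i.2
  have h6 := h3.next (h4.union h5)
  set T₄ : Set (Ω → Val B) := ((fun i : Fin K × ℤ => ex (fun z => ((w z).1.1 : B.G₁))
    fun z => (pol (w z) i.1).coeff i.2) '' ((Finset.univ : Finset (Fin K)) ×ˢ exps d : Finset _))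
  set T₅ : Set (Ω → Val B) := ((fun i : Fin K × Fin A.points => sc fun z => valueAt (w z) i.1 i.2) ''
    ((Finset.univ : Finset (Fin K)) ×ˢ (Finset.univ : Finset (Fin A.points)) : Finset _))
  have hS'' : S₂ ⊆ S₃ ∪ (T₄ ∪ T₅) := fun v hv => .inl (.inl hv)
  have h7 := h6.next (derives (w := w) (fun v hv => .inl (.inl (.inr hv))) (hS'' hz) (by
      intro v hv
      simp only [valueSym, List.mem_flatten, List.mem_ofFn] at hv
      obtain ⟨_, ⟨i, rfl⟩, hv⟩ := hv
      obtain ⟨k, rfl⟩ := List.mem_ofFn.1 hv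
      exact .inr (.inr ⟨(i, k), by simp, rfl⟩)) (fun z => (hw z).1.1)
    (fun i k hk => .inr (.inl ⟨(i, k), by simpa using hk, rfl⟩)) (hS'' (hS hx)))
  have hS3 : S₂ ⊆ S₃ ∪ (T₄ ∪ T₅) ∪ {v | v ∈ sym₃ w} := fun v hv => .inl (hS'' hv)
  refine ((h7.next (der_target hw ((hdyn j).weaken hS3) (fun v hv => .inr hv) (hS3 hz)
    (hS3 (hS hx)) fun i k => hS3 (hS (hbase i k)))).get (.inr rfl)).le ?_
  simp only [Finset.card_product, Finset.card_univ, Fintype.card_fin, card_exps, hidingCost, size]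
  omega

end Reduction

end Spy

/-! ### Embedding the winning runs into discrete logarithm instances -/

namespace Spy

variable {B : BilinearGroup} {K d : ℕ} (A : Spy B K)

/-- The names of the coins of the reduction. -/
abbrev CoinIndex (d : ℕ) : Type := Fin 3 ⊕ (Fin K × nzExps d) ⊕ Fin A.coins

/-- The coins of the reduction: three scalars, the coefficients of the polynomials, and the coins of
the adversary. -/
def packCoins (s : Fin 3 → B.F) (c : Fin K → nzExps d → B.F) (co : Fin A.coins → B.F) :
    Fin (Fintype.card (A.CoinIndex d)) → B.F := fun k =>
  Sum.elim s (Sum.elim (fun i => c i.1 i.2) co) ((Fintype.equivFin (A.CoinIndex d)).symm k)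

variable {A}

lemma packCoins_apply (s : Fin 3 → B.F) (c : Fin K → nzExps d → B.F) (co : Fin A.coins → B.F)
    (i : A.CoinIndex d) : A.packCoins s c co (Fintype.equivFin (A.CoinIndex d) i) =
      Sum.elim s (Sum.elim (fun i => c i.1 i.2) co) i := by
  rw [packCoins, Equiv.symm_apply_apply]

lemma packCoins_injective {s s' : Fin 3 → B.F} {c c' : Fin K → nzExps d → B.F}
    {co co' : Fin A.coins → B.F} (h : A.packCoins s c co = A.packCoins s' c' co') :
    s = s' ∧ c = c' ∧ co = co' := by
  have h := fun i => congrFun h (Fintype.equivFin (A.CoinIndex d) i)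
  simp only [packCoins_apply] at h
  exact ⟨funext fun k => h (.inl k), funext fun i => funext fun k => h (.inr (.inl (i, k))),
    funext fun k => h (.inr (.inr k))⟩

variable (A d) in
lemma card_coinIndex : Fintype.card (A.CoinIndex d) = 3 + (2 * d * K + A.coins) := by
  rw [Fintype.card_sum, Fintype.card_sum, Fintype.card_prod, Fintype.card_fin, Fintype.card_fin,
    Fintype.card_fin, Fintype.card_coe, card_nzExps, mul_comm K]

variable (B) in
lemma exists_right_ne_zero : ∃ h : B.G₂, h ≠ 0 := by
  by_contra! hall
  have : Subsingleton B.G₂ := ⟨fun a b => (hall a).trans (hall b).symm⟩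
  have h1 := Finite.card_le_one_iff_subsingleton.2 this
  rw [B.card₂] at h1
  exact absurd B.prime.out.one_lt (not_lt.2 h1)

/-- The scalars that produce `h`, `α` and `x` are drawn from the whole field, instead of from `p -
1`, `p - 2` and `p - 2` elements. For `p ≥ 3` each replacement costs a factor of at most `3`, hence
`27`. -/
lemma card_space_le (hp : B.p ≠ 2) :
    Nat.card (({g : B.G₁ // g ≠ 0} × B.F) × (Fin (Fintype.card (A.CoinIndex d)) → B.F)) ≤
      27 * (Nat.card (A.Space d) * Nat.card B.F) := by
  have hp3 : 3 ≤ B.p := by have := B.prime.out.two_le; omega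
  have h1 : Nat.card (Fin K → nzExps d → B.F) = B.p ^ (2 * d * K) := by
    simp only [Nat.card_fun, Nat.card_zmod, Nat.card_eq_fintype_card (α := Fin K),
      Nat.card_eq_fintype_card (α := nzExps d), Fintype.card_fin, Fintype.card_coe, card_nzExps]
    rw [← pow_mul]
  have h2 : Nat.card (Fin A.coins → B.F) = B.p ^ A.coins := by simp
  have h3 : Nat.card (Secrets B) = (B.p - 1) * ((B.p - 1) * ((B.p - 2) * (B.p - 2))) := by
    rw [← card_ne_zero_and_ne_one, ← card_right_ne_zero, Nat.card_prod, Nat.card_prod, Nat.card_prod,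
      card_left_ne_zero, card_right_ne_zero]
  have h5 : Nat.card (A.Space d) = Nat.card (Secrets B) *
      (Nat.card (Fin K → nzExps d → B.F) * Nat.card (Fin A.coins → B.F)) := by
    rw [← Nat.card_prod, ← Nat.card_prod]
  rw [Nat.card_prod, Nat.card_prod, h5, h1, h2, h3, card_left_ne_zero]
  simp only [Nat.card_fun, Nat.card_zmod, Nat.card_eq_fintype_card (α := Fin _), Fintype.card_fin]
  rw [card_coinIndex, pow_add, pow_add]
  obtain ⟨q, hq⟩ := Nat.exists_eq_add_of_le hp3
  rw [show B.p - 1 = q + 2 by omega, show B.p - 2 = q + 1 by omega]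
  have h4 : B.p ^ 3 ≤ 27 * ((q + 2) * ((q + 1) * (q + 1))) := by
    rw [hq]
    nlinarith [Nat.zero_le (q ^ 3), Nat.zero_le (q ^ 2), Nat.zero_le q]
  calc _ = ((q + 2) * B.p * (B.p ^ (2 * d * K) * B.p ^ A.coins)) * B.p ^ 3 := by ring
    _ ≤ ((q + 2) * B.p * (B.p ^ (2 * d * K) * B.p ^ A.coins)) *
        (27 * ((q + 2) * ((q + 1) * (q + 1)))) := Nat.mul_le_mul_left _ h4
    _ = _ := by ring

/-- A winning adversary gives a solver for discrete logarithms. -/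
lemma exists_dlog_solver (hp : B.p ≠ 2) (j : Fin K) (b : Bool) : ∃ R : Solver B,
    R.size ≤ 3 + (2 * d * K + A.coins) + hidingCost d K A.points A.size ∧
      prob (A.Space d) (Case j b) ≤ 27 * dlogAdv R := by
  -- A fixed `h₀` is hard-wired, since the instance provides elements of `G₁` only.
  obtain ⟨h₀, hh₀⟩ := exists_right_ne_zero B
  choose r hr using fun u : B.G₂ => exists_smul_eq B.card₂ hh₀ u
  set w : {ω : A.Space d // Case j b ω} × B.F → A.Space d := fun z => z.1.1 with hw
  set t : {ω : A.Space d // Case j b ω} × B.F → B.F := fun z => z.2 with ht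
  -- The coins carry the known parts instead of the polynomials themselves. The free scalar `t`
  -- compensates for the logarithm, which comes from the instance.
  set co : {ω : A.Space d // Case j b ω} × B.F → Fin (Fintype.card (A.CoinIndex d)) → B.F := fun z =>
    A.packCoins ![r (w z).1.2.1, ((w z).1.2.2.1 : B.F), ((w z).1.2.2.2 : B.F)]
      (base j (w z) (t z)) (w z).2.2 with hco
  have hmem : ∀ i : A.CoinIndex d, (sc fun z => co z (Fintype.equivFin _ i)) ∈ coinSym co := fun i =>
    mem_coinSym _
  simp only [hco, packCoins_apply] at hmem
  have hder := der_target_of_input (w := w) (t := t) (j := j) (b := b)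
    (S := {v | v ∈ [lf fun z => ((w z).1.1 : B.G₁),
      ex (fun z => ((w z).1.1 : B.G₁)) fun z => target j b (w z) (t z)] ++ coinSym co})
    (fun z => z.1.2) (fun z => r (w z).1.2.1) h₀ (fun z => hr _) (by simp) (by simp)
    (List.mem_append_right _ (hmem (.inl 0))) (List.mem_append_right _ (hmem (.inl 1)))
    (List.mem_append_right _ (hmem (.inl 2)))
    (fun i k => List.mem_append_right _ (hmem (.inr (.inl (i, k)))))
    (fun v hv => by
      obtain ⟨k, rfl⟩ := List.mem_ofFn.1 hv
      exact List.mem_append_right _ (hmem (.inr (.inr k))))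
  obtain ⟨P, out, hP, hout⟩ := hder.exists_solver
  refine ⟨⟨Fintype.card (A.CoinIndex d), P, out⟩, ?_, ?_⟩
  · simp only [Solver.size, card_coinIndex]
    omega
  have key := prob_le_of_injective (Ω := A.Space d) (A := B.F) (P := Case j b) (c := 27)
    (P' := fun ω : ({g : B.G₁ // g ≠ 0} × B.F) × (Fin (Fintype.card (A.CoinIndex d)) → B.F) =>
      (run P ([.left (ω.1.1 : B.G₁), .left (ω.1.2 • (ω.1.1 : B.G₁))] ++ coinCells ω.2)).fld out =
        ω.1.2)
    (fun z => (((w z).1.1, target j b (w z) (t z)), co z)) ?_ (fun z => by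
      have := hout z
      rw [List.map_append, coinSym_map] at this
      exact this) (card_space_le hp)
  · exact_mod_cast key
  rintro ⟨⟨⟨⟨g, h, α, x⟩, c, ω⟩, hz⟩, u⟩ ⟨⟨⟨⟨g', h', α', x'⟩, c', ω'⟩, hz'⟩, u'⟩ heq
  simp only [hw, ht, hco, Prod.mk.injEq] at heq
  obtain ⟨⟨rfl, ha⟩, heq⟩ := heq
  obtain ⟨hs, hb, rfl⟩ := packCoins_injective heq
  have e0 := congrFun hs 0
  have e1 := congrFun hs 1
  have e2 := congrFun hs 2
  simp only [Matrix.cons_val] at e0 e1 e2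
  obtain rfl : h = h' := Subtype.ext (by rw [← hr h, e0, hr])
  obtain rfl : α = α' := Subtype.ext e1
  obtain rfl : x = x' := Subtype.ext e2
  -- The commitments are functions of the instance and the coins, by `com_eq_base`. The adversary
  -- therefore makes the same choice of `S_j` in both runs, and the two masks agree.
  have hcom : com (A := A) ((g, h, α, x), c, ω) = com ((g, h, α, x), c', ω) := by
    funext i
    rw [com_eq_base hz u, com_eq_base hz' u', ha, hb]
  have hsub : sub (A := A) ((g, h, α, x), c, ω) j = sub ((g, h, α, x), c', ω) j := by
    rw [sub, sub, mem₀, mem₀, hcom]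
  -- For a fixed `S_j` the target is `t` itself or affine in `t` with non-zero slope, so it
  -- determines `t` and thereby the polynomials.
  have hu : u = u' := by
    by_cases hbt : b = true
    · simpa only [target, if_pos hbt] using ha
    · have hne := mask_ne_zero hz' hbt
      rw [target_eq hz, target_eq hz', if_neg hbt, if_neg hbt, hb, hsub] at ha
      exact mul_right_cancel₀ hne (add_left_cancel ha)
  subst hu
  have hc : c = c' := by
    funext i k
    have := congrFun (congrFun hb i) k
    simp only [base, hsub] at this
    exact sub_left_injective this
  subst hc
  rfl

/-- The advantage against hiding is bounded by the advantage of a solver for discrete logarithms. -/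
theorem hidingAdv_le (A : Spy B K) : ∃ R : Solver B,
    R.size ≤ 3 + (2 * d * K + A.coins) + hidingCost d K A.points A.size ∧
      hidingAdv d A ≤ 54 * (K * dlogAdv R) := by
  rcases eq_or_ne B.p 2 with hp | hp
  · refine ⟨⟨0, [], 0⟩, Nat.zero_le _, ?_⟩
    have : IsEmpty (Trap B) := by
      have h := Nat.card_eq_zero.1 ((card_ne_zero_and_ne_one B).trans (by omega))
      exact h.resolve_right fun h => h.not_finite inferInstance
    have h1 : hidingAdv d A = 0 := prob_of_isEmpty _ _
    rw [h1]
    exact mul_nonneg (by norm_num) (mul_nonneg (Nat.cast_nonneg _) (prob_nonneg _ _))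
  choose R hR hadv using fun i : Fin K × Bool => exists_dlog_solver (A := A) (d := d) hp i.1 i.2
  -- The union bound over the winning index `j` and over the two cases for `x` gives `2K` solvers
  -- with a factor `27` each; the best of them is kept.
  have h1 : hidingAdv d A ≤ ∑ j : Fin K, (27 * dlogAdv (R (j, true)) + 27 * dlogAdv (R (j, false))) := by
    refine (prob_mono fun ω => exists_winsAt).trans ((prob_exists_le _).trans
      (Finset.sum_le_sum fun j _ => ?_))
    refine (prob_mono (Q := fun ω => Case j true ω ∨ Case j false ω) fun ω h => ?_).trans
      ((prob_or_le _ _).trans (add_le_add (hadv (j, true)) (hadv (j, false))))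
    by_cases hx : (ω.1.2.2.2 : B.F) ∈ sub ω j
    · exact .inl ⟨h, by simpa using hx⟩
    · exact .inr ⟨h, by simpa using hx⟩
  rcases isEmpty_or_nonempty (Fin K) with hK | hK
  · refine ⟨⟨0, [], 0⟩, Nat.zero_le _, h1.trans ?_⟩
    rw [Finset.univ_eq_empty, Finset.sum_empty]
    exact mul_nonneg (by norm_num) (mul_nonneg (Nat.cast_nonneg _) (prob_nonneg _ _))
  obtain ⟨i, hi⟩ := Finite.exists_max fun i => dlogAdv (R i)
  refine ⟨R i, hR i, h1.trans ((Finset.sum_le_card_nsmul _ _ (54 * dlogAdv (R i)) fun j _ => ?_).trans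
    (le_of_eq ?_))⟩
  · have e1 := hi (j, true)
    have e2 := hi (j, false)
    linarith
  · rw [Finset.card_univ, Fintype.card_fin, nsmul_eq_mul]
    ring

end Spy

/-! ### Asymptotics -/

attribute [fun_prop] PolyBounded

namespace PolyBounded

variable {a b c d f g : ℕ → ℕ}

lemma mono (hg : PolyBounded g) (h : ∀ n, f n ≤ g n) : PolyBounded f := by
  obtain ⟨q, hq⟩ := hg
  exact ⟨q, fun n => (h n).trans (hq n)⟩

@[fun_prop]
lemma const (c : ℕ) : PolyBounded fun _ => c := ⟨Polynomial.C c, fun n => by simp⟩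

@[fun_prop]
lemma add (hf : PolyBounded f) (hg : PolyBounded g) : PolyBounded fun n => f n + g n := by
  obtain ⟨q, hq⟩ := hf
  obtain ⟨r, hr⟩ := hg
  exact ⟨q + r, fun n => by
    rw [Polynomial.eval_add]
    exact Nat.add_le_add (hq n) (hr n)⟩

@[fun_prop]
lemma mul (hf : PolyBounded f) (hg : PolyBounded g) : PolyBounded fun n => f n * g n := by
  obtain ⟨q, hq⟩ := hf
  obtain ⟨r, hr⟩ := hg
  exact ⟨q * r, fun n => by
    rw [Polynomial.eval_mul]
    exact Nat.mul_le_mul (hq n) (hr n)⟩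

@[fun_prop]
lemma freshCost (ha : PolyBounded a) (hb : PolyBounded b) :
    PolyBounded fun n => freshCost (a n) (b n) := by
  unfold RKZGb.freshCost
  fun_prop

@[fun_prop]
lemma vanishCost (ha : PolyBounded a) (hb : PolyBounded b) :
    PolyBounded fun n => vanishCost (a n) (b n) := by
  unfold RKZGb.vanishCost
  fun_prop

@[fun_prop]
lemma memCost (ha : PolyBounded a) : PolyBounded fun n => memCost (a n) := by
  unfold RKZGb.memCost
  fun_prop

@[fun_prop]
lemma psiCost (ha : PolyBounded a) (hb : PolyBounded b) :
    PolyBounded fun n => psiCost (a n) (b n) := by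
  unfold RKZGb.psiCost
  fun_prop

@[fun_prop]
lemma eqCost (ha : PolyBounded a) (hb : PolyBounded b) (hc : PolyBounded c) :
    PolyBounded fun n => RKZGb.Prover.eqCost (a n) (b n) (c n) := by
  unfold RKZGb.Prover.eqCost
  fun_prop

@[fun_prop]
lemma mulCost (ha : PolyBounded a) :
    PolyBounded fun n => RKZGb.mulCost (a n) := by
  unfold RKZGb.mulCost
  fun_prop

@[fun_prop]
lemma descendCost (ha : PolyBounded a) (hb : PolyBounded b) (hc : PolyBounded c) :
    PolyBounded fun n => RKZGb.descendCost (a n) (b n) (c n) := by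
  unfold RKZGb.descendCost
  fun_prop

@[fun_prop]
lemma rootCost (ha : PolyBounded a) (hb : PolyBounded b) (hc : PolyBounded c) :
    PolyBounded fun n => RKZGb.rootCost (a n) (b n) (c n) := by
  unfold RKZGb.rootCost
  fun_prop

@[fun_prop]
lemma reductionCost (ha : PolyBounded a) (hb : PolyBounded b) (hc : PolyBounded c) (hd : PolyBounded d)
    (hf : PolyBounded f) (hg : PolyBounded g) :
    PolyBounded fun n => RKZGb.reductionCost (a n) (b n) (c n) (d n) (f n) (g n) := by
  unfold RKZGb.reductionCost
  fun_prop

@[fun_prop]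
lemma levCost (ha : PolyBounded a) (hb : PolyBounded b) (hc : PolyBounded c) :
    PolyBounded fun n => RKZGb.levCost (a n) (b n) (c n) := by
  unfold RKZGb.levCost
  fun_prop

@[fun_prop]
lemma divCost (ha : PolyBounded a) (hb : PolyBounded b) (hc : PolyBounded c) :
    PolyBounded fun n => RKZGb.divCost (a n) (b n) (c n) := by
  unfold RKZGb.divCost
  fun_prop

@[fun_prop]
lemma quoCost (ha : PolyBounded a) (hb : PolyBounded b) (hc : PolyBounded c) (hd : PolyBounded d) :
    PolyBounded fun n => RKZGb.quoCost (a n) (b n) (c n) (d n) := by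
  unfold RKZGb.quoCost
  fun_prop

@[fun_prop]
lemma interpCost (ha : PolyBounded a) (hb : PolyBounded b) (hc : PolyBounded c) (hd : PolyBounded d) :
    PolyBounded fun n => RKZGb.interpCost (a n) (b n) (c n) (d n) := by
  unfold RKZGb.interpCost
  fun_prop

@[fun_prop]
lemma pCost (ha : PolyBounded a) (hb : PolyBounded b) (hc : PolyBounded c) :
    PolyBounded fun n => RKZGb.pCost (a n) (b n) (c n) := by
  unfold RKZGb.pCost
  fun_prop

@[fun_prop]
lemma ellCost (ha : PolyBounded a) (hb : PolyBounded b) (hc : PolyBounded c) :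
    PolyBounded fun n => RKZGb.ellCost (a n) (b n) (c n) := by
  unfold RKZGb.ellCost
  fun_prop

@[fun_prop]
lemma gameCost (ha : PolyBounded a) (hb : PolyBounded b) (hc : PolyBounded c) :
    PolyBounded fun n => RKZGb.Spy.gameCost (a n) (b n) (c n) := by
  unfold RKZGb.Spy.gameCost
  fun_prop

@[fun_prop]
lemma maskCost (ha : PolyBounded a) (hb : PolyBounded b) (hc : PolyBounded c) :
    PolyBounded fun n => RKZGb.maskCost (a n) (b n) (c n) := by
  unfold RKZGb.maskCost
  fun_prop

@[fun_prop]
lemma evCost (ha : PolyBounded a) (hb : PolyBounded b) :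
    PolyBounded fun n => RKZGb.Spy.evCost (a n) (b n) := by
  unfold RKZGb.Spy.evCost
  fun_prop

@[fun_prop]
lemma inputCost (ha : PolyBounded a) (hb : PolyBounded b) :
    PolyBounded fun n => RKZGb.Spy.inputCost (a n) (b n) := by
  unfold RKZGb.Spy.inputCost
  fun_prop

@[fun_prop]
lemma coefCost (ha : PolyBounded a) (hb : PolyBounded b) :
    PolyBounded fun n => RKZGb.Spy.coefCost (a n) (b n) := by
  unfold RKZGb.Spy.coefCost
  fun_prop

@[fun_prop]
lemma valueCost (ha : PolyBounded a) (hb : PolyBounded b) :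
    PolyBounded fun n => RKZGb.Spy.valueCost (a n) (b n) := by
  unfold RKZGb.Spy.valueCost
  fun_prop

@[fun_prop]
lemma solveCost (ha : PolyBounded a) (hb : PolyBounded b) :
    PolyBounded fun n => RKZGb.Spy.solveCost (a n) (b n) := by
  unfold RKZGb.Spy.solveCost
  fun_prop

@[fun_prop]
lemma hidingCost (ha : PolyBounded a) (hb : PolyBounded b) (hc : PolyBounded c) (hd : PolyBounded d) :
    PolyBounded fun n => RKZGb.Spy.hidingCost (a n) (b n) (c n) (d n) := by
  unfold RKZGb.Spy.hidingCost
  fun_prop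

end PolyBounded

namespace Negligible

variable {ε δ : ℕ → ℝ}

lemma mono (hδ : Negligible δ) (h0 : ∀ n, 0 ≤ ε n) (h : ∀ n, ε n ≤ δ n) : Negligible ε :=
  Asymptotics.SuperpolynomialDecay.trans_abs_le hδ fun n => by
    rw [abs_of_nonneg (h0 n), abs_of_nonneg ((h0 n).trans (h n))]
    exact h n

lemma polyBounded_mul {f : ℕ → ℕ} (hf : PolyBounded f) (hε : Negligible ε) (h0 : ∀ n, 0 ≤ ε n) :
    Negligible fun n => (f n : ℝ) * ε n := by
  obtain ⟨q, hq⟩ := hf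
  refine mono (Asymptotics.SuperpolynomialDecay.polynomial_mul hε (q.map (Nat.castRingHom ℝ)))
    (fun n => mul_nonneg (Nat.cast_nonneg _) (h0 n)) fun n => ?_
  refine mul_le_mul_of_nonneg_right ?_ (h0 n)
  rw [Polynomial.eval_natCast_map]
  exact Nat.cast_le.2 (hq n)

end Negligible

/-! ### The security of the scheme -/

section Security

variable {𝒢 : ℕ → BilinearGroup} {d K : ℕ → ℕ}

/-- Admissibility enters twice: the length of representations bounds the cost of root finding, and
negligibility of `1 / p` absorbs the runs in which the equation holds identically. -/
theorem readOffSound (h𝒢 : Admissible 𝒢) (hd : PolyBounded d) (hK : PolyBounded K)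
    (hq : QDLog 𝒢 d) : ReadOffSound 𝒢 d K := by
  intro A hA hAlg
  have hlen := h𝒢.1
  have hcoins : PolyBounded fun n => (A n).coins := hA.mono fun n => by simp only [Prover.size]; omega
  have hpoints : PolyBounded fun n => (A n).points :=
    hA.mono fun n => by simp only [Prover.size]; omega
  have hterms : PolyBounded fun n => (A n).terms := hA.mono fun n => by simp only [Prover.size]; omega
  choose A₁ A₂ A₃ hsize hadv using fun n => (A n).soundAdv_le (hAlg n)
  have hbound : PolyBounded fun n => (A n).coins + 3 +
      reductionCost (d n) (K n) (A n).points (A n).terms (A n).size (𝒢 n).len := by fun_prop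
  have hc : PolyBounded fun n => (A n).points + 3 * d n + (A n).terms + (A n).points + 2 * K n := by
    fun_prop
  have h₁ := hq A₁ (hbound.mono fun n => hsize n _ (by simp))
  have h₂ := hq A₂ (hbound.mono fun n => hsize n _ (by simp))
  have h₃ := hq A₃ (hbound.mono fun n => hsize n _ (by simp))
  exact Negligible.mono ((((h₁.const_mul 3).add (h₂.const_mul 3)).add (h₃.const_mul 3)).add
    (Negligible.polyBounded_mul hc h𝒢.2 fun n => by positivity)) (fun n => prob_nonneg _ _) hadv

theorem knowledgeSound (h : ReadOffSound 𝒢 d K) : KnowledgeSound 𝒢 d K := fun A hA hAlg =>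
  ⟨fun n => (A n).readOff, PolyBounded.const 0, h A hA hAlg⟩

theorem hiding_of_dLog (hd : PolyBounded d) (hK : PolyBounded K) (hdl : DLog 𝒢) : Hiding 𝒢 d K := by
  intro A hA
  have hcoins : PolyBounded fun n => (A n).coins := hA.mono fun n => by simp only [Spy.size]; omega
  have hpoints : PolyBounded fun n => (A n).points := hA.mono fun n => by simp only [Spy.size]; omega
  choose R hsize hadv using fun n => (A n).hidingAdv_le (d := d n)
  have hbound : PolyBounded fun n => 3 + (2 * d n * K n + (A n).coins) +
      Spy.hidingCost (d n) (K n) (A n).points (A n).size := by fun_prop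
  have h := hdl R (hbound.mono hsize)
  exact Negligible.mono ((Negligible.polyBounded_mul hK h fun n => prob_nonneg _ _).const_mul 54)
    (fun n => prob_nonneg _ _) hadv

end Security

end RKZGb

end

/-- For every admissible family of bilinear groups and polynomially bounded degrees `d` and numbers
`K` of polynomials, the restricted batch scheme is correct, is knowledge sound in the algebraic group
model under `q`-DLOG (already with the extractor that reads off the representations), and is computationally hiding if it is hard to compute `a` from `g, g^a`. -/
theorem theorem2 (𝒢 : ℕ → RKZGb.BilinearGroup) (d K : ℕ → ℕ) (h𝒢 : RKZGb.Admissible 𝒢)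
    (hd : RKZGb.PolyBounded d) (hK : RKZGb.PolyBounded K) :
    (∀ n, RKZGb.Correct (𝒢 n) (d n) (K n)) ∧
    (RKZGb.QDLog 𝒢 d → RKZGb.KnowledgeSound 𝒢 d K ∧ RKZGb.ReadOffSound 𝒢 d K) ∧
    (RKZGb.DLog 𝒢 → RKZGb.Hiding 𝒢 d K) := by
  exact ⟨fun n => RKZGb.correct _ _ _, fun hq =>
    ⟨RKZGb.knowledgeSound (RKZGb.readOffSound h𝒢 hd hK hq), RKZGb.readOffSound h𝒢 hd hK hq⟩,
    fun hdl => RKZGb.hiding_of_dLog hd hK hdl⟩
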